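/- **Setting.** Let $\mu$ be the surface measure on $\mathbb S^2\subset\mathbb R^3$ (total mass $4\pi$), $\lambda_\ell=\ell(\ell+1)$, $P_\ell$ the Legendre polynomials, and, for each $\ell\ge 0$, let $Y_{\ell,1},\dots,Y_{\ell,2\ell+1}$ be an $L_2(\mathbb S^2)$-orthonormal basis of the real spherical harmonics of degree $\ell$. For $\ell\ge1$ put $\mathbf y_{\ell,k}=\lambda_\ell^{-1/2}\,\mathbf L_*Y_{\ell,k}$ and $\mathbf z_{\ell,k}=\lambda_\ell^{-1/2}\,\nabla_*Y_{\ell,k}$, where $\nabla_*$ is the surface gradient and $\mathbf L_*=x\times\nabla$ the surface curl. Set $$\|f\|_{H^\sigma}^2=\sum_{\ell\ge0}\sum_{k}(1+\lambda_\ell)^\sigma\langle f,Y_{\ell,k}\rangle^2,\qquad \|\mathbf f\|_{\mathbf H^\sigma}^2=\sum_{\ell\ge1}\sum_{k}(1+\lambda_\ell)^\sigma\big(\langle \mathbf f,\mathbf y_{\ell,k}\rangle^2+\langle \mathbf f,\mathbf z_{\ell,k}\rangle^2\big)$$ for functions and for tangential vector fields respectively; $H^\sigma(\mathbb S^2)$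 and $\mathbf H^\sigma(\mathbb S^2)$ are the spaces where these norms are finite. For $\sigma>1$ their elements are identified with their continuous representatives. *QMC designs.* Let $\sigma>1$. A sequence of node sets $X_N=\{x_1,\dots,x_N\}\subset\mathbb S^2$, with $N\ge1$ running through a sequence of integers that tends to infinity, is a sequence of QMC designs for $H^\sigma(\mathbb S^2)$ if there is $c>0$, independent of $N$, with $\big|\int f\,d\mu-\frac{4\pi}N\sum_{j=1}^N f(x_j)\big|\le c\,N^{-\sigma/2}\|f\|_{H^\sigma}$ for all $f\in H^\sigma(\mathbb S^2)$. *Kernels.* Let $(\psi_\rho)_{0<\rho<1}$ be a family of continuous zonal kernels $\psi_\rho(x\cdot y)$, $\psi_\rho\in C[-1,1]$, with $2\pi\int_{-1}^1\psi_\rho(t)\,dt=1$ (for example $\psi_\rho(x\cdot y)=C_\rho\,\phi(\|x-y\|/\rho)$ with $\phi\in C[0,\infty)$ and $C_\rho$ the normalizing constant), and let $\widehat\psi_\rho(\ell)=2\pi\int_{-1}^1\psi_\rho(t)P_\ell(t)\,dt$. Assume: 1. (approximation order $\sigma$) there are $0<\rho_0<1$ and $c_1,c_2>0$ such that for $0<\rho<\rho_0$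 we have $|1-\widehat\psi_\rho(\ell)|\le c_1(\ell\rho)^\sigma$ for $0\le\ell\le\lfloor\rho^{-1}-1\rfloor$, and $\widehat\psi_\rho(\ell)\le c_2$ for $\ell>\lfloor\rho^{-1}-1\rfloor$; 2. (decay) for some $s>1$ with $2s\ge\sigma$ (for example $s=\sigma$) there is $c>0$ such that $|\widehat\psi_\rho(\ell)|\le c\,(1+\rho\ell)^{-2s}$ for all $0<\rho<1$ and $\ell\ge1$. Put $\kappa_\rho(t)=\frac1{4\pi(1-t^2)}\int_{-1}^t(1-4\pi\psi_\rho(u))\,du$ (extended continuously to $[-1,1]$) and, with $t=x\cdot y$, $$\Psi_\rho(x,y)=\kappa_\rho'(t)\big[-(x\times y)(x\times y)^\top+(y-tx)(x-ty)^\top\big]+\kappa_\rho(t)\big[t\mathbf I-yx^\top+(\mathbf I-xx^\top)(\mathbf I-yy^\top)\big],$$ where the first summand is read as $0$ at $x=\pm y$ (its continuous extension). *Noise.* Let $B$ be a constant. For each $N$ let $\boldsymbol\epsilon_1,\dots,\boldsymbol\epsilon_N$ be independent square-integrable random vectors in $\mathbb R^3$ with mean zero whose covariance matrices have trace at most $B$,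 and put $$\mathcal L^{\epsilon}_{\Psi_\rho}\mathbf f(x)=\frac{4\pi}N\sum_{j=1}^N\Psi_\rho(x,x_j)\big(\mathbf f(x_j)+\boldsymbol\epsilon_j\big).$$ **Theorem.** Let $\sigma>1$, let $(X_N)$ be a sequence of QMC designs for $H^\sigma(\mathbb S^2)$, and let $(\psi_\rho)$ be as above. Then there is a constant $C>0$, independent of $\rho$, of $N$, of $\mathbf f$ and of the distribution of the noise (except through $B$), such that for all $0<\rho<1$, all $N$ in the sequence and all $\mathbf f\in\mathbf H^\sigma(\mathbb S^2)$, the function $\mathcal L^{\epsilon}_{\Psi_\rho}\mathbf f-\mathbf f$ is square-integrable for every outcome of the noise, its norm $\|\mathcal L^{\epsilon}_{\Psi_\rho}\mathbf f-\mathbf f\|_{\mathbf L_2(\mathbb S^2)}$ is an integrable random variable, and $$\mathbb E\,\big\|\mathcal L^{\epsilon}_{\Psi_\rho}\mathbf f-\mathbf f\big\|_{\mathbf L_2(\mathbb S^2)}\le C\big(\rho^\sigma+\rho^{-\sigma}N^{-\sigma/2}\big)\|\mathbf f\|_{\mathbf H^\sigma}+C\rho^{-1}N^{-1/2}.$$ 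-/

import Mathlib

open MeasureTheory ProbabilityTheory
open scoped Matrix

noncomputable section

namespace VecQI

/-! ### The sphere and its surface measure -/

/-- Euclidean three-space. -/
abbrev E3 : Type := EuclideanSpace ℝ (Fin 3)

/-- The unit sphere of `E3`. -/
abbrev S2 : Type := Metric.sphere (0 : E3) 1

/-- The rotation invariant surface measure on the sphere (total mass `4 π`). -/
def surf : Measure S2 := (volume : Measure E3).toSphere

/-- The cross product on Euclidean three-space. -/
def cross (u v : E3) : E3 := WithLp.toLp 2 (u.ofLp ⨯₃ v.ofLp)

/-- Surface gradient at a point of the sphere: tangential part of the gradient of an extension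
of the function to a neighbourhood of the sphere (the value depends only on the restriction to
the sphere). -/
def surfGrad (F : E3 → ℝ) (x : S2) : E3 :=
  gradient F x - inner ℝ (x : E3) (gradient F x) • (x : E3)

/-- Surface curl `x × ∇ F` at a point of the sphere. -/
def surfCurl (F : E3 → ℝ) (x : S2) : E3 := cross x (gradient F x)

/-! ### Scalar and vector spherical harmonics -/

/-- The Laplacian on polynomials in three variables. -/
def laplacian : MvPolynomial (Fin 3) ℝ →ₗ[ℝ] MvPolynomial (Fin 3) ℝ :=
  ∑ i : Fin 3, (MvPolynomial.pderiv i).toLinearMap ∘ₗ (MvPolynomial.pderiv i).toLinearMap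

/-- Homogeneous harmonic polynomials of degree `ℓ`; their restrictions to the sphere are the
spherical harmonics of degree `ℓ`. -/
def solidHarmonics (ℓ : ℕ) : Submodule ℝ (MvPolynomial (Fin 3) ℝ) :=
  MvPolynomial.homogeneousSubmodule (Fin 3) ℝ ℓ ⊓ LinearMap.ker laplacian

/-- A polynomial as a function on Euclidean space. -/
def polyFun (p : MvPolynomial (Fin 3) ℝ) (x : E3) : ℝ := MvPolynomial.eval (fun i => x i) p

/-- `Y ℓ k`, `k = 1, …, 2 ℓ + 1`, restricts for every `ℓ` to an orthonormal basis, with respect to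
the inner product of `L₂` of the sphere, of the space of spherical harmonics of degree `ℓ`. -/
structure IsHarmonicBasis (Y : ∀ ℓ : ℕ, Fin (2 * ℓ + 1) → MvPolynomial (Fin 3) ℝ) : Prop where
  span_eq : ∀ ℓ, Submodule.span ℝ (Set.range (Y ℓ)) = solidHarmonics ℓ
  orthonormal : ∀ ℓ (k k' : Fin (2 * ℓ + 1)),
    ∫ x : S2, polyFun (Y ℓ k) x * polyFun (Y ℓ k') x ∂surf = if k = k' then 1 else 0

/-- Eigenvalue of (minus) the Laplace–Beltrami operator. -/
def lam (ℓ : ℕ) : ℝ := (ℓ : ℝ) * (ℓ + 1)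

/-- The divergence-free vector spherical harmonic attached to a solid harmonic of degree `ℓ`. -/
def divHarmonic (ℓ : ℕ) (p : MvPolynomial (Fin 3) ℝ) (x : S2) : E3 :=
  (Real.sqrt (lam ℓ))⁻¹ • surfCurl (polyFun p) x

/-- The curl-free vector spherical harmonic attached to a solid harmonic of degree `ℓ`. -/
def curlHarmonic (ℓ : ℕ) (p : MvPolynomial (Fin 3) ℝ) (x : S2) : E3 :=
  (Real.sqrt (lam ℓ))⁻¹ • surfGrad (polyFun p) x

/-! ### Sobolev spaces of order larger than one

For order `σ > 1` every class in the Sobolev space has exactly one continuous representative;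
the spaces below consist of these representatives, which is what point evaluation refers to. -/

section Sobolev

variable (Y : ∀ ℓ : ℕ, Fin (2 * ℓ + 1) → MvPolynomial (Fin 3) ℝ)

/-- Scalar Fourier coefficient. -/
def coeff (f : S2 → ℝ) (ℓ : ℕ) (k : Fin (2 * ℓ + 1)) : ℝ :=
  ∫ x, f x * polyFun (Y ℓ k) x ∂surf

/-- Degree `ℓ` part of the squared scalar Sobolev norm. -/
def sobolevTerm (σ : ℝ) (f : S2 → ℝ) (ℓ : ℕ) : ℝ :=
  (1 + lam ℓ) ^ σ * ∑ k, coeff Y f ℓ k ^ 2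

/-- `f` is (the continuous representative of) an element of the scalar Sobolev space. -/
structure MemSobolev (σ : ℝ) (f : S2 → ℝ) : Prop where
  continuous : Continuous f
  summable : Summable (sobolevTerm Y σ f)

/-- The scalar Sobolev norm. -/
def sobolevNorm (σ : ℝ) (f : S2 → ℝ) : ℝ := Real.sqrt (∑' ℓ, sobolevTerm Y σ f ℓ)

/-- Divergence-free Fourier coefficient of a vector field. -/
def divCoeff (f : S2 → E3) (ℓ : ℕ) (k : Fin (2 * ℓ + 1)) : ℝ :=
  ∫ x, inner ℝ (f x) (divHarmonic ℓ (Y ℓ k) x) ∂surf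

/-- Curl-free Fourier coefficient of a vector field. -/
def curlCoeff (f : S2 → E3) (ℓ : ℕ) (k : Fin (2 * ℓ + 1)) : ℝ :=
  ∫ x, inner ℝ (f x) (curlHarmonic ℓ (Y ℓ k) x) ∂surf

/-- The part of degree `ℓ + 1` of the squared Sobolev norm of a vector field (vector spherical
harmonics have degree at least one). -/
def vecSobolevTerm (σ : ℝ) (f : S2 → E3) (ℓ : ℕ) : ℝ :=
  (1 + lam (ℓ + 1)) ^ σ *
    ∑ k, (divCoeff Y f (ℓ + 1) k ^ 2 + curlCoeff Y f (ℓ + 1) k ^ 2)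

/-- `f` is (the continuous representative of) an element of the Sobolev space of tangential
vector fields. -/
structure MemVecSobolev (σ : ℝ) (f : S2 → E3) : Prop where
  continuous : Continuous f
  tangential : ∀ x : S2, inner ℝ (x : E3) (f x) = 0
  summable : Summable (vecSobolevTerm Y σ f)

/-- The Sobolev norm of a vector field. -/
def vecSobolevNorm (σ : ℝ) (f : S2 → E3) : ℝ := Real.sqrt (∑' ℓ, vecSobolevTerm Y σ f ℓ)

/-- A sequence of QMC designs for the Sobolev space of order `σ`: the `n`-th member has
`N n` nodes, `N n → ∞`, and the equal weight quadrature error is at most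
`c (N n) ^ (-σ / 2)` times the Sobolev norm. -/
structure IsQMCDesignSeq (σ : ℝ) (N : ℕ → ℕ) (X : ∀ n, Fin (N n) → S2) : Prop where
  pos : ∀ n, 0 < N n
  tendsto : Filter.Tendsto N Filter.atTop Filter.atTop
  bound : ∃ c : ℝ, 0 < c ∧ ∀ n, ∀ f : S2 → ℝ, MemSobolev Y σ f →
    |∫ x, f x ∂surf - 4 * Real.pi / N n * ∑ j, f (X n j)|
      ≤ c * (N n : ℝ) ^ (-σ / 2) * sobolevNorm Y σ f

end Sobolev

/-! ### Zonal kernels -/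

/-- The Legendre polynomial (Rodrigues' formula). -/
def legendre (ℓ : ℕ) : Polynomial ℝ :=
  Polynomial.C (1 / (2 ^ ℓ * (ℓ.factorial : ℝ))) *
    Polynomial.derivative^[ℓ] ((Polynomial.X ^ 2 - 1) ^ ℓ)

/-- The Fourier–Legendre coefficient, i.e. the coefficient in
`ψ(t) = ∑ (2 ℓ + 1) / (4 π) * ψ̂(ℓ) * P_ℓ(t)`. -/
def legendreCoeff (ψ : ℝ → ℝ) (ℓ : ℕ) : ℝ :=
  2 * Real.pi * ∫ t in (-1 : ℝ)..1, ψ t * (legendre ℓ).eval t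

/-- A scaled family `ρ ↦ ψ_ρ`, `0 < ρ < 1`, of continuous zonal kernels
`(x, y) ↦ ψ_ρ(x · y)` whose integral over the sphere in one variable is one. -/
structure IsScaledZonalFamily (ψ : ℝ → ℝ → ℝ) : Prop where
  continuousOn : ∀ ρ, 0 < ρ → ρ < 1 → ContinuousOn (ψ ρ) (Set.Icc (-1) 1)
  normalized : ∀ ρ, 0 < ρ → ρ < 1 → 2 * Real.pi * ∫ t in (-1 : ℝ)..1, ψ ρ t = 1

/-- The radial profile `φ(‖x - y‖ / ρ)` as a function of `t = x · y`. -/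
def radialProfile (φ : ℝ → ℝ) (ρ t : ℝ) : ℝ := φ (ρ⁻¹ * Real.sqrt (2 - 2 * t))

/-- The normalized scaled zonal kernel `C_ρ φ(‖x - y‖ / ρ)`, as a function of `t = x · y`. -/
def radialKernel (φ : ℝ → ℝ) (ρ t : ℝ) : ℝ :=
  (2 * Real.pi * ∫ u in (-1 : ℝ)..1, radialProfile φ ρ u)⁻¹ * radialProfile φ ρ t

/-- Restrictions to the sphere of scaled radial functions are instances of the definition. -/
theorem isScaledZonalFamily_radialKernel {φ : ℝ → ℝ} (hφ : ContinuousOn φ (Set.Ici 0))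
    (h0 : ∀ ρ, 0 < ρ → ρ < 1 → ∫ u in (-1 : ℝ)..1, radialProfile φ ρ u ≠ 0) :
    IsScaledZonalFamily (radialKernel φ) where
  continuousOn := by
    intro ρ hρ _
    refine ContinuousOn.mul continuousOn_const ?_
    refine hφ.comp (Continuous.continuousOn (by fun_prop)) ?_
    intro t _
    exact mul_nonneg (inv_nonneg.2 hρ.le) (Real.sqrt_nonneg _)
  normalized := by
    intro ρ hρ hρ1
    have h := h0 ρ hρ hρ1
    have hpi := Real.pi_ne_zero
    simp only [radialKernel, intervalIntegral.integral_const_mul]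
    field_simp

/-- The approximation order condition of order `m`:
`|1 - ψ̂_ρ(ℓ)| ≤ c₁ (ℓ ρ)^m` for `ℓ ≤ ⌊ρ⁻¹ - 1⌋` and `ψ̂_ρ(ℓ) ≤ c₂` for larger `ℓ`,
uniformly for `0 < ρ < ρ₀`. -/
def HasApproxOrder (ψ : ℝ → ℝ → ℝ) (m : ℝ) : Prop :=
  ∃ ρ₀ c₁ c₂ : ℝ, 0 < ρ₀ ∧ ρ₀ < 1 ∧ 0 < c₁ ∧ 0 < c₂ ∧ ∀ ρ, 0 < ρ → ρ < ρ₀ →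
    (∀ ℓ : ℕ, ℓ ≤ ⌊ρ⁻¹ - 1⌋₊ → |1 - legendreCoeff (ψ ρ) ℓ| ≤ c₁ * (ℓ * ρ) ^ m) ∧
    (∀ ℓ : ℕ, ⌊ρ⁻¹ - 1⌋₊ < ℓ → legendreCoeff (ψ ρ) ℓ ≤ c₂)

/-- The decay condition `|ψ̂_ρ(ℓ)| ≤ c (1 + ρ ℓ)^(-2 s)` for all `ℓ > 0`, uniformly for
`0 < ρ < 1`. -/
def HasFourierDecay (ψ : ℝ → ℝ → ℝ) (s : ℝ) : Prop :=
  ∃ c : ℝ, 0 < c ∧ ∀ ρ, 0 < ρ → ρ < 1 → ∀ ℓ : ℕ, 0 < ℓ →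
    |legendreCoeff (ψ ρ) ℓ| ≤ c * (1 + ρ * ℓ) ^ (-2 * s)

/-! ### The matrix-valued kernels and the quasi-interpolant -/

/-- The auxiliary function `κ`; at `t = ± 1` it has its limit values. -/
def kappa (ψ : ℝ → ℝ) (t : ℝ) : ℝ :=
  if t = 1 then (4 * Real.pi * ψ 1 - 1) / (8 * Real.pi)
  else if t = -1 then (1 - 4 * Real.pi * ψ (-1)) / (8 * Real.pi)
  else 1 / (4 * Real.pi * (1 - t ^ 2)) * ∫ u in (-1 : ℝ)..t, (1 - 4 * Real.pi * ψ u)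

/-- `Q(x, y) = -(x × y)(x × y)ᵀ`. -/
def matQ (x y : Fin 3 → ℝ) : Matrix (Fin 3) (Fin 3) ℝ :=
  -Matrix.vecMulVec (x ⨯₃ y) (x ⨯₃ y)

/-- `R(x, y) = t I - y xᵀ`, `t = x · y`. -/
def matR (x y : Fin 3 → ℝ) : Matrix (Fin 3) (Fin 3) ℝ :=
  (x ⬝ᵥ y) • (1 : Matrix (Fin 3) (Fin 3) ℝ) - Matrix.vecMulVec y x

/-- `V(x, y) = (y - t x)(x - t y)ᵀ`, `t = x · y`. -/
def matV (x y : Fin 3 → ℝ) : Matrix (Fin 3) (Fin 3) ℝ :=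
  Matrix.vecMulVec (y - (x ⬝ᵥ y) • x) (x - (x ⬝ᵥ y) • y)

/-- `W(x, y) = (I - x xᵀ)(I - y yᵀ)`. -/
def matW (x y : Fin 3 → ℝ) : Matrix (Fin 3) (Fin 3) ℝ :=
  (1 - Matrix.vecMulVec x x) * (1 - Matrix.vecMulVec y y)

/-- The divergence-free kernel `κ'(t) Q + κ(t) R`. At `t = ± 1` the matrix `Q` vanishes, and the
first term is zero, which is its continuous extension. -/
def divKernel (ψ : ℝ → ℝ) (x y : Fin 3 → ℝ) : Matrix (Fin 3) (Fin 3) ℝ :=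
  deriv (kappa ψ) (x ⬝ᵥ y) • matQ x y + kappa ψ (x ⬝ᵥ y) • matR x y

/-- The curl-free kernel `κ'(t) V + κ(t) W`. At `t = ± 1` the matrix `V` vanishes, and the
first term is zero, which is its continuous extension. -/
def curlKernel (ψ : ℝ → ℝ) (x y : Fin 3 → ℝ) : Matrix (Fin 3) (Fin 3) ℝ :=
  deriv (kappa ψ) (x ⬝ᵥ y) • matV x y + kappa ψ (x ⬝ᵥ y) • matW x y

/-- The combined matrix-valued kernel `Ψ = Ψ^div + Ψ^curl` on the sphere. -/
def matKernel (ψ : ℝ → ℝ) (x y : S2) : Matrix (Fin 3) (Fin 3) ℝ :=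
  divKernel ψ (x : E3).ofLp (y : E3).ofLp + curlKernel ψ (x : E3).ofLp (y : E3).ofLp

/-- The quasi-interpolant `(4 π / N) ∑ⱼ Ψ(x, xⱼ) vⱼ` built from data vectors `vⱼ` at nodes `xⱼ`. -/
def quasiInterp (ψ : ℝ → ℝ) {N : ℕ} (X : Fin N → S2) (v : Fin N → E3) (x : S2) : E3 :=
  (4 * Real.pi / N) • ∑ j, WithLp.toLp 2 (matKernel ψ x (X j) *ᵥ (v j).ofLp)

/-- The quasi-interpolant from noisy observations `f(xⱼ) + εⱼ`. -/
def noisyQuasiInterp (ψ : ℝ → ℝ) {N : ℕ} (X : Fin N → S2) (f : S2 → E3) (ε : Fin N → E3) :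
    S2 → E3 :=
  quasiInterp ψ X (fun j => f (X j) + ε j)

/-- The `L₂` norm of a vector field. -/
def L2norm (g : S2 → E3) : ℝ := (eLpNorm g 2 surf).toReal

/-! ### Noise -/

/-- The covariance matrix of the three components of a random vector. -/
def covMatrix {Ω : Type*} [MeasurableSpace Ω] (P : Measure Ω) (Z : Ω → E3) :
    Matrix (Fin 3) (Fin 3) ℝ :=
  Matrix.of fun a b => covariance (fun ω => Z ω a) (fun ω => Z ω b) P

/-- Independent random vectors with mean zero and finite second moments whose covariance matrices
have trace at most `B`. -/
structure IsNoise {Ω : Type*} [MeasurableSpace Ω] (P : Measure Ω) (B : ℝ) {N : ℕ}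
    (ε : Fin N → Ω → E3) : Prop where
  measurable : ∀ j, Measurable (ε j)
  memLp : ∀ j, MemLp (ε j) 2 P
  indep : iIndepFun ε P
  mean_zero : ∀ j, ∫ ω, ε j ω ∂P = 0
  trace_le : ∀ j, (covMatrix P (ε j)).trace ≤ B

end VecQI

end

/-! The kernel acts as a Fourier multiplier. By the addition theorems for surface curls and surface
gradients, and by the series of κ and κ', Ψ_ρ(x, y) is the sum over ℓ ≥ 1 of ψ̂_ρ(ℓ) times the
reproducing kernel of the vector harmonics of degree ℓ (`hasSum_matKernel`). Hence the
quasi-interpolant of exact data has the coefficients ψ̂_ρ(ℓ) · `quadCoeff`, where `quadCoeff` is the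
quadrature value of the integral defining the coefficient of f. Its error splits as ψ̂ · (quadrature
value − exact coefficient) + (ψ̂ − 1) · (exact coefficient).

The second part costs ρ^σ: approximation order handles ℓρ small, and where ℓρ is bounded below the
trivial bound |1 − ψ̂| ≤ 1 + c is already of order (ℓρ)^σ (`HasApproxOrder.exists_sq_one_sub_le`).

The first part is treated by duality (`sum_sq_quadrature_error_le`). Its squared ℓ₂ norm S is the
quadrature error of the scalar function ⟨f, g⟩ for a suitable finite sum g of vector harmonics. For
σ > 1 the inner product of two fields in H^σ lies in H^σ with norm at most a constant times the
product of the norms (`sobolevNorm_inner_le`), so the QMC property applies and gives S ≤ C N^(-σ/2)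
‖f‖ ‖g‖. The decay of ψ̂ with 2s ≥ σ gives ‖g‖ ≤ c ρ^(-σ) √S, and one factor √S cancels.

The product estimate comes from degree counting. If f_n and g_n are truncations, then ⟨f_n, g_n⟩ is
a polynomial of degree at most 2n + 2, so the components of ⟨f, g⟩ of higher degree are bounded in
L₂ by ⟨f, g⟩ − ⟨f_n, g_n⟩, hence by the Sobolev embedding and the tails of f and g. Summation by
parts over n recovers the Sobolev weight.

The noise contributes its mean square: independence and zero mean remove the cross terms, and each
remaining term is at most B times the sum of 2 · `dens` ℓ · ψ̂(ℓ)², which is O(ρ⁻²). This gives ρ⁻¹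
N^(-1/2) after taking roots.

The harmonic analysis rests on one fact: the components of x × ∇ generate rotations, so their values
integrate to zero over the sphere (`integral_curlOp`). Integration by parts, self-adjointness of the
Laplace–Beltrami operator, orthogonality of different degrees and the addition theorem all descend
from it. -/

open MeasureTheory ProbabilityTheory
open scoped Matrix

noncomputable section

namespace VecQI

open MvPolynomial (pderiv)

/-! ### Integration over the sphere -/

/-- Polynomials in three variables. -/
abbrev Poly : Type := MvPolynomial (Fin 3) ℝ

instance : IsFiniteMeasure surf := by unfold surf; infer_instance

instance : surf.IsOpenPosMeasure := by unfold surf; infer_instance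

theorem surf_real_univ : surf.real Set.univ = 4 * Real.pi := by
  have h : (0 : ℝ) ≤ Real.pi * 4 / 3 := by positivity
  unfold surf
  rw [Measure.toSphere_real_apply_univ, Measure.real, EuclideanSpace.volume_ball_fin_three]
  rw [finrank_euclideanSpace_fin]
  simp only [ENNReal.ofReal_one, one_pow, one_mul, ENNReal.toReal_ofReal h]
  push_cast; ring

theorem integrable_surf {E : Type*} [NormedAddCommGroup E] [SecondCountableTopology E]
    {f : S2 → E} (hf : Continuous f) : Integrable f surf :=
  hf.integrable_of_hasCompactSupport (HasCompactSupport.of_compactSpace f)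

theorem eq_zero_of_integral_eq_zero {f : S2 → ℝ} (hf : Continuous f) (h0 : ∀ x, 0 ≤ f x)
    (h : ∫ x, f x ∂surf = 0) (x : S2) : f x = 0 := by
  rw [integral_eq_zero_iff_of_nonneg h0 (integrable_surf hf)] at h
  exact congrFun ((hf.ae_eq_iff_eq surf continuous_const).1 h) x

theorem sphere_sq (x : S2) : (x : E3) 0 ^ 2 + (x : E3) 1 ^ 2 + (x : E3) 2 ^ 2 = 1 := by
  have h : ‖(x : E3)‖ ^ 2 = 1 := by simp
  rwa [EuclideanSpace.real_norm_sq_eq, Fin.sum_univ_three] at h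

/-! ### Polynomials as functions -/

section polyFun

variable (p q : Poly) (x : E3)

@[simp] theorem polyFun_add : polyFun (p + q) x = polyFun p x + polyFun q x := map_add _ _ _
@[simp] theorem polyFun_sub : polyFun (p - q) x = polyFun p x - polyFun q x := map_sub _ _ _
@[simp] theorem polyFun_neg : polyFun (-p) x = -polyFun p x := map_neg _ _
@[simp] theorem polyFun_mul : polyFun (p * q) x = polyFun p x * polyFun q x := map_mul _ _ _
@[simp] theorem polyFun_pow (n : ℕ) : polyFun (p ^ n) x = polyFun p x ^ n := map_pow _ _ _
@[simp] theorem polyFun_zero : polyFun 0 x = 0 := map_zero _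
@[simp] theorem polyFun_one : polyFun 1 x = 1 := map_one _
@[simp] theorem polyFun_smul (c : ℝ) : polyFun (c • p) x = c * polyFun p x := by
  simp [polyFun, MvPolynomial.smul_eval]
@[simp] theorem polyFun_C (c : ℝ) : polyFun (MvPolynomial.C c) x = c := MvPolynomial.eval_C _
@[simp] theorem polyFun_X (i : Fin 3) : polyFun (MvPolynomial.X i) x = x i :=
  MvPolynomial.eval_X _
@[simp] theorem polyFun_sum {ι : Type*} (s : Finset ι) (f : ι → Poly) :
    polyFun (∑ i ∈ s, f i) x = ∑ i ∈ s, polyFun (f i) x := map_sum _ _ _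
@[simp] theorem polyFun_natCast (n : ℕ) : polyFun (n : Poly) x = n := map_natCast _ _

end polyFun

@[fun_prop]
theorem continuous_polyFun (p : Poly) : Continuous (polyFun p) := by
  unfold polyFun
  exact (MvPolynomial.continuous_eval p).comp (by fun_prop)

@[fun_prop]
theorem continuous_polyFun_sphere (p : Poly) : Continuous fun x : S2 => polyFun p x :=
  (continuous_polyFun p).comp continuous_subtype_val

/-- The gradient of a polynomial. -/
def gradP (p : Poly) (x : E3) : E3 := WithLp.toLp 2 fun i => polyFun (pderiv i p) x

theorem inner_gradP (p : Poly) (x v : E3) :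
    inner ℝ (gradP p x) v = ∑ i, polyFun (pderiv i p) x * v i := by
  simp [gradP, PiLp.inner_apply, mul_comm]

theorem hasGradientAt_polyFun (p : Poly) (x : E3) : HasGradientAt (polyFun p) (gradP p x) x := by
  rw [hasGradientAt_iff_hasFDerivAt]
  induction p using MvPolynomial.induction_on with
  | C a =>
    have h : polyFun (MvPolynomial.C a) = fun _ => a := by ext; simp
    rw [h]
    refine (hasFDerivAt_const a x).congr_fderiv ?_
    ext v
    simp [inner_gradP]
  | add p q hp hq =>
    have h : polyFun (p + q) = fun x => polyFun p x + polyFun q x := by ext; simp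
    rw [h]
    refine (hp.add hq).congr_fderiv ?_
    ext v
    simp [inner_gradP, Finset.sum_add_distrib, add_mul]
  | mul_X p i hp =>
    have h : polyFun (p * MvPolynomial.X i) = fun x => polyFun p x * x i := by ext; simp
    rw [h]
    have h2 : HasFDerivAt (fun x : E3 => x i) (EuclideanSpace.proj i : E3 →L[ℝ] ℝ) x :=
      (EuclideanSpace.proj i : E3 →L[ℝ] ℝ).hasFDerivAt
    refine (hp.mul h2).congr_fderiv ?_
    ext v
    simp only [add_apply, smul_apply,
      InnerProductSpace.toDual_apply_apply, inner_gradP, Derivation.leibniz, smul_eq_mul,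
      MvPolynomial.pderiv_X, polyFun_add, polyFun_mul, polyFun_X, add_mul, Finset.sum_add_distrib,
      PiLp.proj_apply, Finset.mul_sum]
    congr 1
    · rw [Finset.sum_eq_single i]
      · simp
      · intro j _ hj; simp [hj.symm]
      · simp
    · exact Finset.sum_congr rfl fun j _ => by ring

theorem gradient_polyFun (p : Poly) (x : E3) : gradient (polyFun p) x = gradP p x :=
  (hasGradientAt_polyFun p x).gradient

/-- The components of the operator `x × ∇`. -/
def curlOp (i : Fin 3) : Derivation ℝ Poly Poly :=
  (MvPolynomial.X (i + 1) : Poly) • pderiv (i + 2) - (MvPolynomial.X (i + 2) : Poly) • pderiv (i + 1)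

theorem curlOp_apply (i : Fin 3) (p : Poly) :
    curlOp i p = MvPolynomial.X (i + 1) * pderiv (i + 2) p
      - MvPolynomial.X (i + 2) * pderiv (i + 1) p := rfl

theorem curlOp_mul (i : Fin 3) (p q : Poly) :
    curlOp i (p * q) = p * curlOp i q + q * curlOp i p := by
  simp [Derivation.leibniz]

theorem surfCurl_polyFun (p : Poly) (x : S2) (i : Fin 3) :
    surfCurl (polyFun p) x i = polyFun (curlOp i p) x := by
  rw [surfCurl, gradient_polyFun]
  fin_cases i <;> simp [cross, crossProduct, gradP, curlOp_apply]

/-! ### Rotation invariance -/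

/-- The surface measure of a set is a multiple of the volume of the cone over it. A linear isometry
carries cones to cones and preserves volume. -/
theorem integral_surf_isometry (R : E3 ≃ₗᵢ[ℝ] E3) (f : E3 → ℝ) :
    ∫ x : S2, f (R x) ∂surf = ∫ x : S2, f x ∂surf := by
  let g : S2 ≃ₜ S2 :=
    { toFun := fun x => ⟨R x, by simp⟩
      invFun := fun x => ⟨R.symm x, by simp⟩
      left_inv := fun x => by simp
      right_inv := fun x => by simp
      continuous_toFun := by fun_prop
      continuous_invFun := by fun_prop }
  have hg : MeasurePreserving g surf surf := by
    refine ⟨g.continuous.measurable, ?_⟩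
    ext s hs
    rw [Measure.map_apply g.continuous.measurable hs]
    unfold surf
    rw [Measure.toSphere_apply' _ (g.continuous.measurable hs), Measure.toSphere_apply' _ hs]
    congr 1
    have hR : MeasurePreserving R (volume : Measure E3) volume := R.measurePreserving
    refine Eq.trans (congrArg _ ?_)
      (hR.measure_preimage_equiv (f := R.toHomeomorph.toMeasurableEquiv) _)
    ext y
    simp only [Set.mem_smul, Set.mem_image, Set.mem_preimage]
    constructor
    · rintro ⟨t, ht, _, ⟨x, hx, rfl⟩, rfl⟩
      exact ⟨t, ht, _, ⟨g x, hx, rfl⟩, (map_smul R t (x : E3)).symm⟩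
    · rintro ⟨t, ht, _, ⟨x, hx, rfl⟩, h⟩
      refine ⟨t, ht, _, ⟨g.symm x, by simpa using hx, rfl⟩, ?_⟩
      have h' : t • (x : E3) = R y := h
      apply R.injective
      simp [g, ← h']
  exact hg.integral_comp g.measurableEmbedding (fun x : S2 => f x)

/-- Rotation about the coordinate axis `i`. -/
def axisRot (i : Fin 3) (θ : ℝ) (x : E3) : E3 :=
  WithLp.toLp 2 fun j => if j = i then x i
    else if j = i + 1 then Real.cos θ * x (i + 1) - Real.sin θ * x (i + 2)
    else Real.sin θ * x (i + 1) + Real.cos θ * x (i + 2)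

theorem norm_axisRot (i : Fin 3) (θ : ℝ) (x : E3) : ‖axisRot i θ x‖ = ‖x‖ := by
  have h : ‖axisRot i θ x‖ ^ 2 = ‖x‖ ^ 2 := by
    rw [EuclideanSpace.real_norm_sq_eq, EuclideanSpace.real_norm_sq_eq, Fin.sum_univ_three,
      Fin.sum_univ_three]
    have h1 := Real.sin_sq_add_cos_sq θ
    fin_cases i <;> simp [axisRot]
    · linear_combination (x 1 ^ 2 + x 2 ^ 2) * h1
    · linear_combination (x 0 ^ 2 + x 2 ^ 2) * h1
    · linear_combination (x 0 ^ 2 + x 1 ^ 2) * h1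
  exact (sq_eq_sq₀ (norm_nonneg _) (norm_nonneg _)).1 h

/-- Rotation about the coordinate axis `i`, as an isometry. -/
def axisRotIso (i : Fin 3) (θ : ℝ) : E3 ≃ₗᵢ[ℝ] E3 :=
  LinearIsometry.toLinearIsometryEquiv
    { toFun := axisRot i θ
      map_add' := fun x y => by
        ext j
        simp only [axisRot, PiLp.add_apply]
        split_ifs <;> ring
      map_smul' := fun c x => by
        ext j
        simp only [axisRot, PiLp.smul_apply, smul_eq_mul, RingHom.id_apply]
        split_ifs <;> ring
      norm_map' := norm_axisRot i θ } rfl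

/-- `curlOp i` is the infinitesimal generator of the rotations about the axis `i`. -/
theorem hasDerivAt_polyFun_axisRot (i : Fin 3) (p : Poly) (x : E3) (θ : ℝ) :
    HasDerivAt (fun θ => polyFun p (axisRot i θ x)) (polyFun (curlOp i p) (axisRot i θ x)) θ := by
  have h1 : HasDerivAt (fun θ => axisRot i θ x)
      (WithLp.toLp 2 fun j => if j = i then 0
        else if j = i + 1 then -axisRot i θ x (i + 2) else axisRot i θ x (i + 1)) θ := by
    refine ((PiLp.continuousLinearEquiv 2 ℝ fun _ : Fin 3 => ℝ).symm.hasFDerivAt.comp_hasDerivAt θ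
      (hasDerivAt_pi.2 fun j => ?_) :)
    have hs := (Real.hasDerivAt_sin θ)
    have hc := (Real.hasDerivAt_cos θ)
    fin_cases i <;> fin_cases j <;> simp [axisRot]
    all_goals first
      | exact hasDerivAt_const _ _
      | (refine ((hs.mul_const _).add (hc.mul_const _)).congr_deriv ?_; ring)
      | (refine ((hc.mul_const _).sub (hs.mul_const _)).congr_deriv ?_; ring)
  have h2 := (hasGradientAt_polyFun p (axisRot i θ x)).hasFDerivAt.comp_hasDerivAt θ h1
  refine h2.congr_deriv ?_
  rw [InnerProductSpace.toDual_apply_apply, inner_gradP, Fin.sum_univ_three]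
  fin_cases i <;> simp [curlOp_apply] <;> ring

theorem exists_bound_sphere {f : S2 → ℝ} (hf : Continuous f) : ∃ C, ∀ x, |f x| ≤ C := by
  obtain ⟨C, hC⟩ := isCompact_univ.exists_bound_of_continuousOn (f := f) hf.continuousOn
  exact ⟨C, fun x => hC x trivial⟩

/-- The integral of p over the rotated sphere does not depend on the angle; differentiating under
the integral sign at angle 0 gives the claim. Every integration by parts below reduces to this. -/
theorem integral_curlOp (i : Fin 3) (p : Poly) :
    ∫ x : S2, polyFun (curlOp i p) x ∂surf = 0 := by
  obtain ⟨C, hC⟩ := exists_bound_sphere (continuous_polyFun_sphere (curlOp i p))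
  have hcont : ∀ θ, Continuous fun x : S2 => axisRot i θ x := fun θ =>
    (axisRotIso i θ).continuous.comp continuous_subtype_val
  have h := (hasDerivAt_integral_of_dominated_loc_of_deriv_le (μ := surf) (𝕜 := ℝ) (x₀ := 0)
    (s := Set.univ) (F := fun θ (x : S2) => polyFun p (axisRot i θ x))
    (F' := fun θ (x : S2) => polyFun (curlOp i p) (axisRot i θ x)) (bound := fun _ => C)
    Filter.univ_mem
    (Filter.Eventually.of_forall fun θ =>
      ((continuous_polyFun p).comp (hcont θ)).aestronglyMeasurable)
    (integrable_surf ((continuous_polyFun p).comp (hcont 0)))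
    ((continuous_polyFun _).comp (hcont 0)).aestronglyMeasurable
    (Filter.Eventually.of_forall fun x θ _ =>
      hC ⟨axisRot i θ x, by simp [norm_axisRot]⟩)
    (integrable_const _)
    (Filter.Eventually.of_forall fun x θ _ => hasDerivAt_polyFun_axisRot i p x θ)).2
  have hc : (fun θ => ∫ x : S2, polyFun p (axisRot i θ x) ∂surf)
      = fun _ => ∫ x : S2, polyFun p x ∂surf := by
    funext θ
    exact integral_surf_isometry (axisRotIso i θ) (polyFun p)
  rw [hc] at h
  have h0 := h.unique (hasDerivAt_const _ _)
  -- Invariance is used once more, so the rotation by angle 0 need not be simplified to the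
  -- identity.
  rw [← integral_surf_isometry (axisRotIso i 0)]
  exact h0

open MvPolynomial (pderiv)

/-! ### Spherical harmonics: algebra -/

/-- The commutator of two derivations is a derivation, and this one kills every variable. -/
theorem pderiv_comm (i j : Fin 3) (p : Poly) :
    pderiv i (pderiv j p) = pderiv j (pderiv i p) := by
  have h : ⁅(pderiv i : Derivation ℝ Poly Poly), (pderiv j : Derivation ℝ Poly Poly)⁆ = 0 := by
    apply MvPolynomial.derivation_ext
    intro k
    simp [Derivation.commutator_apply, MvPolynomial.pderiv_X, Pi.single_apply, apply_ite]
  have h1 := DFunLike.congr_fun h p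
  rwa [Derivation.commutator_apply, Derivation.zero_apply, sub_eq_zero] at h1

/-- The polynomial `|x|²`. -/
def normSqPoly : Poly := ∑ i, MvPolynomial.X i ^ 2

theorem polyFun_normSqPoly (x : S2) : polyFun normSqPoly x = 1 := by
  simpa [normSqPoly, Fin.sum_univ_three] using sphere_sq x

theorem isHomogeneous_normSqPoly : normSqPoly.IsHomogeneous 2 :=
  MvPolynomial.IsHomogeneous.sum _ _ _ fun i _ => MvPolynomial.isHomogeneous_X_pow i 2

theorem laplacian_apply (p : Poly) : laplacian p = ∑ i, pderiv i (pderiv i p) := by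
  simp [laplacian]

/-- The operator `∑ (x × ∇)ᵢ²`, which extends the Laplace–Beltrami operator to polynomials. -/
def sphLap : Poly →ₗ[ℝ] Poly := ∑ i, (curlOp i).toLinearMap ∘ₗ (curlOp i).toLinearMap

theorem sphLap_apply (p : Poly) : sphLap p = ∑ i, curlOp i (curlOp i p) := by
  simp [sphLap]

theorem euler {p : Poly} {d : ℕ} (hp : p.IsHomogeneous d) :
    ∑ i : Fin 3, MvPolynomial.X i * pderiv i p = (d : Poly) * p := by
  rw [hp.sum_X_mul_pderiv, nsmul_eq_mul]

theorem euler_pderiv {p : Poly} {d : ℕ} (hp : p.IsHomogeneous d) (j : Fin 3) :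
    ∑ i : Fin 3, MvPolynomial.X i * pderiv j (pderiv i p) = ((d : Poly) - 1) * pderiv j p := by
  have h := congrArg (pderiv j) (euler hp)
  rw [Fin.sum_univ_three] at h ⊢
  simp only [map_add, Derivation.leibniz, smul_eq_mul, MvPolynomial.pderiv_X,
    Derivation.map_natCast, mul_zero, add_zero] at h
  fin_cases j <;> simp at h ⊢ <;> linear_combination h

/-- With the Euler operator E = x · ∇ one has ∑ (x × ∇)ᵢ² = |x|² Δ − E(E + 1), and E acts as d on
homogeneous polynomials of degree d. -/
theorem sphLap_eq {p : Poly} {d : ℕ} (hp : p.IsHomogeneous d) :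
    sphLap p = normSqPoly * laplacian p - ((d : Poly) * (d + 1)) * p := by
  have h := euler hp
  have h0 := euler_pderiv hp 0
  have h1 := euler_pderiv hp 1
  have h2 := euler_pderiv hp 2
  rw [Fin.sum_univ_three] at h h0 h1 h2
  rw [sphLap_apply, laplacian_apply, normSqPoly]
  simp only [Fin.sum_univ_three, curlOp_apply, map_sub, Derivation.leibniz, smul_eq_mul,
    MvPolynomial.pderiv_X]
  simp
  rw [pderiv_comm 1 0 p] at *
  rw [pderiv_comm 2 0 p] at *
  rw [pderiv_comm 2 1 p] at *
  linear_combination (-(d : Poly) - 1) * h - MvPolynomial.X 0 * h0 - MvPolynomial.X 1 * h1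
    - MvPolynomial.X 2 * h2

theorem isHomogeneous_laplacian {p : Poly} {d : ℕ} (hp : p.IsHomogeneous d) :
    (laplacian p).IsHomogeneous (d - 2) := by
  rw [laplacian_apply]
  exact MvPolynomial.IsHomogeneous.sum _ _ _ fun i _ => hp.pderiv.pderiv

theorem laplacian_eq_zero {p : Poly} {d : ℕ} (hp : p.IsHomogeneous d) (hd : d ≤ 1) :
    laplacian p = 0 := by
  rw [laplacian_apply]
  refine Finset.sum_eq_zero fun i _ => ?_
  have h : (pderiv i p).IsHomogeneous 0 := by
    have := hp.pderiv (i := i)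
    rwa [show d - 1 = 0 by omega] at this
  rw [← MvPolynomial.totalDegree_zero_iff_isHomogeneous, MvPolynomial.totalDegree_eq_zero_iff_eq_C]
    at h
  rw [h, MvPolynomial.pderiv_C]

theorem curlOp_normSqPoly (i : Fin 3) : curlOp i normSqPoly = 0 := by
  simp only [normSqPoly, map_sum, Derivation.leibniz_pow, curlOp_apply, MvPolynomial.pderiv_X]
  fin_cases i <;> simp [Fin.sum_univ_three, Pi.single_apply] <;> ring

/-- Integration by parts: the product rule combined with `integral_curlOp`. -/
theorem integral_mul_curlOp (i : Fin 3) (p q : Poly) :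
    ∫ x : S2, polyFun p x * polyFun (curlOp i q) x ∂surf
      = -∫ x : S2, polyFun q x * polyFun (curlOp i p) x ∂surf := by
  have h := integral_curlOp i (p * q)
  simp only [curlOp_mul, polyFun_add, polyFun_mul] at h
  rw [integral_add (integrable_surf (by fun_prop)) (integrable_surf (by fun_prop))] at h
  linarith

theorem integral_mul_sphLap (p q : Poly) :
    ∫ x : S2, polyFun p x * polyFun (sphLap q) x ∂surf
      = -∫ x : S2, ∑ i, polyFun (curlOp i p) x * polyFun (curlOp i q) x ∂surf := by
  simp only [sphLap_apply, polyFun_sum, Finset.mul_sum]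
  rw [integral_finsetSum _ fun i _ => integrable_surf (by fun_prop),
    integral_finsetSum _ fun i _ => integrable_surf (by fun_prop), ← Finset.sum_neg_distrib]
  refine Finset.sum_congr rfl fun i _ => ?_
  rw [integral_mul_curlOp]
  simp only [mul_comm]

theorem integral_mul_sphLap_comm (p q : Poly) :
    ∫ x : S2, polyFun p x * polyFun (sphLap q) x ∂surf
      = ∫ x : S2, polyFun q x * polyFun (sphLap p) x ∂surf := by
  rw [integral_mul_sphLap, integral_mul_sphLap]
  simp only [mul_comm]

theorem sphLap_harmonic {h : Poly} {m : ℕ} (hh : h ∈ solidHarmonics m) :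
    sphLap h = -((m : Poly) * (m + 1) * h) := by
  rw [sphLap_eq hh.1, LinearMap.mem_ker.1 hh.2]; ring

/-- Self-adjointness of `sphLap` is compared on h and p. On the sphere h has eigenvalue −m(m + 1),
while p has −d(d + 1) up to the term Δp, which has degree d − 2 and is orthogonal to h by induction.
The two factors differ, so the integral vanishes. -/
theorem integral_harmonic_mul_homogeneous {m : ℕ} {h : Poly} (hh : h ∈ solidHarmonics m) :
    ∀ (d : ℕ) (p : Poly), p.IsHomogeneous d → d < m →
      ∫ x : S2, polyFun h x * polyFun p x ∂surf = 0 := by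
  intro d
  induction d using Nat.strong_induction_on with
  | _ d ih =>
    intro p hp hd
    have h1 := integral_mul_sphLap_comm h p
    have hΔ : ∫ x : S2, polyFun h x * polyFun (laplacian p) x ∂surf = 0 := by
      rcases le_or_gt d 1 with h2 | h2
      · simp [laplacian_eq_zero hp h2]
      · exact ih (d - 2) (by omega) _ (isHomogeneous_laplacian hp) (by omega)
    have e1 : ∀ x : S2, polyFun h x * polyFun (sphLap p) x
        = polyFun h x * polyFun (laplacian p) x
          - ((d : ℝ) * (d + 1)) * (polyFun h x * polyFun p x) := by
      intro x
      rw [sphLap_eq hp]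
      simp [polyFun_normSqPoly]
      ring
    have e2 : ∀ x : S2, polyFun p x * polyFun (sphLap h) x
        = -((m : ℝ) * (m + 1)) * (polyFun h x * polyFun p x) := by
      intro x
      rw [sphLap_harmonic hh]
      simp
      ring
    simp only [e1, e2] at h1
    rw [integral_sub (integrable_surf (by fun_prop)) (integrable_surf (by fun_prop)),
      integral_const_mul, integral_const_mul, hΔ] at h1
    have hne : (m : ℝ) * (m + 1) - d * (d + 1) ≠ 0 := by
      have : (d : ℝ) < m := by exact_mod_cast hd
      have h0 : (0 : ℝ) ≤ d := by positivity
      nlinarith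
    refine (mul_eq_zero.1 (?_ : ((m : ℝ) * (m + 1) - d * (d + 1)) * _ = 0)).resolve_left hne
    linarith

theorem integral_harmonic_mul_of_totalDegree_lt {m : ℕ} {h : Poly} (hh : h ∈ solidHarmonics m)
    {p : Poly} (hp : p.totalDegree < m) :
    ∫ x : S2, polyFun h x * polyFun p x ∂surf = 0 := by
  rw [← MvPolynomial.sum_homogeneousComponent p]
  simp only [polyFun_sum, Finset.mul_sum]
  rw [integral_finsetSum _ fun i _ => integrable_surf (by fun_prop)]
  refine Finset.sum_eq_zero fun d hd => ?_
  rw [Finset.mem_range] at hd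
  exact integral_harmonic_mul_homogeneous hh d _
    (MvPolynomial.homogeneousComponent_isHomogeneous d p) (by omega)

theorem integral_harmonic_mul_harmonic {m n : ℕ} {h h' : Poly} (hh : h ∈ solidHarmonics m)
    (hh' : h' ∈ solidHarmonics n) (hmn : m ≠ n) :
    ∫ x : S2, polyFun h x * polyFun h' x ∂surf = 0 := by
  rcases lt_or_gt_of_ne hmn with hlt | hlt
  · simp only [mul_comm (polyFun h _)]
    exact integral_harmonic_mul_homogeneous hh' m h hh.1 hlt
  · exact integral_harmonic_mul_homogeneous hh n h' hh'.1 hlt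

theorem polyFun_smul_of_isHomogeneous {p : Poly} {n : ℕ} (hp : p.IsHomogeneous n) (c : ℝ)
    (x : E3) : polyFun p (c • x) = c ^ n * polyFun p x := by
  unfold polyFun
  rw [MvPolynomial.eval_eq', MvPolynomial.eval_eq', Finset.mul_sum]
  refine Finset.sum_congr rfl fun d hd => ?_
  have h1 : ∑ i, d i = n := by
    have : Finsupp.weight (fun _ : Fin 3 => 1) d = n := hp (MvPolynomial.mem_support_iff.1 hd)
    rwa [← Finsupp.degree_eq_weight_one, Finsupp.degree_eq_sum] at this
  simp only [PiLp.smul_apply, smul_eq_mul, mul_pow, Finset.prod_mul_distrib,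
    Finset.prod_pow_eq_pow_sum, h1]
  ring

/-- Homogeneity spreads the zeros along rays. The factor X 0 takes care of the origin uniformly in
the degree, including degree 0. -/
theorem eq_zero_of_polyFun_sphere_eq_zero {p : Poly} {n : ℕ} (hp : p.IsHomogeneous n)
    (h : ∀ x : S2, polyFun p x = 0) : p = 0 := by
  have h1 : (MvPolynomial.X 0 : Poly) * p = 0 := by
    apply MvPolynomial.funext
    intro y
    let x : E3 := WithLp.toLp 2 y
    have hx : polyFun (MvPolynomial.X 0 * p) x = 0 := by
      by_cases h0 : x = 0
      · simp [h0]
      · have h2 := polyFun_smul_of_isHomogeneous hp ‖x‖ (‖x‖⁻¹ • x)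
        rw [smul_inv_smul₀ (norm_ne_zero_iff.2 h0)] at h2
        have h3 := h ⟨‖x‖⁻¹ • x, by simp [norm_smul, h0]⟩
        rw [polyFun_mul, h2, h3, mul_zero, mul_zero]
    rw [map_zero]
    exact hx
  exact (mul_eq_zero.1 h1).resolve_left (MvPolynomial.X_ne_zero 0)

/-- The operator `q ↦ Δ (|x|² q)` on homogeneous polynomials. -/
def lapNormSq (n : ℕ) :
    MvPolynomial.homogeneousSubmodule (Fin 3) ℝ n →ₗ[ℝ]
      MvPolynomial.homogeneousSubmodule (Fin 3) ℝ n :=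
  (laplacian ∘ₗ LinearMap.mulLeft ℝ normSqPoly).restrict fun q hq => by
    have h := isHomogeneous_laplacian (isHomogeneous_normSqPoly.mul hq)
    rwa [show 2 + n - 2 = n by omega] at h

/-- In finite dimension injectivity suffices. If |x|² q is harmonic, of degree n + 2, then it is
orthogonal on the sphere to q, which has degree n; as |x| = 1 there, the integral of q² is zero. -/
theorem lapNormSq_surjective (n : ℕ) : Function.Surjective (lapNormSq n) := by
  have : Module.Finite ℝ (MvPolynomial.homogeneousSubmodule (Fin 3) ℝ n) :=
    Module.Finite.iff_fg.2 (MvPolynomial.homogeneousSubmodule_fg _ _ n)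
  refine LinearMap.injective_iff_surjective.1 ?_
  rw [← LinearMap.ker_eq_bot, LinearMap.ker_eq_bot']
  rintro ⟨q, hq⟩ h0
  have h1 : laplacian (normSqPoly * q) = 0 := congrArg Subtype.val h0
  have hh : normSqPoly * q ∈ solidHarmonics (2 + n) :=
    ⟨isHomogeneous_normSqPoly.mul hq, h1⟩
  have h2 := integral_harmonic_mul_homogeneous hh n q hq (by omega)
  simp only [polyFun_mul, polyFun_normSqPoly, one_mul] at h2
  have h3 : q = 0 := by
    refine eq_zero_of_polyFun_sphere_eq_zero hq fun x => ?_
    exact mul_self_eq_zero.1 (eq_zero_of_integral_eq_zero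
      (f := fun x : S2 => polyFun q x * polyFun q x) (by fun_prop)
      (fun x => mul_self_nonneg _) h2 x)
  exact Subtype.ext h3

/-- Induction over polynomials through the decomposition `p = h + |x|² q`, `h` harmonic. -/
theorem harmonic_induction {motive : Poly → Prop}
    (harm : ∀ ℓ, ∀ h ∈ solidHarmonics ℓ, motive h)
    (add : ∀ p q, motive p → motive q → motive (p + q))
    (normSq : ∀ q, motive q → motive (normSqPoly * q)) (p : Poly) : motive p := by
  have hom : ∀ (d : ℕ) (p : Poly), p.IsHomogeneous d → motive p := by
    intro d
    induction d using Nat.strong_induction_on with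
    | _ d ih =>
      intro p hp
      rcases le_or_gt d 1 with h1 | h1
      · exact harm d p ⟨hp, laplacian_eq_zero hp h1⟩
      · obtain ⟨n, rfl⟩ : ∃ n, d = n + 2 := ⟨d - 2, by omega⟩
        -- With Δ(|x|² q) = Δp, the remainder p − |x|² q is harmonic.
        obtain ⟨⟨q, hq⟩, h2⟩ := lapNormSq_surjective n ⟨laplacian p, isHomogeneous_laplacian hp⟩
        have h3 : laplacian (normSqPoly * q) = laplacian p := congrArg Subtype.val h2
        have h4 : p - normSqPoly * q ∈ solidHarmonics (n + 2) := by
          refine ⟨Submodule.sub_mem _ hp ?_, ?_⟩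
          · have := isHomogeneous_normSqPoly.mul hq
            rwa [add_comm] at this
          · exact LinearMap.mem_ker.2 (by rw [map_sub, h3, sub_self])
        have h5 := add _ _ (harm _ _ h4) (normSq q (ih n (by omega) q hq))
        rwa [sub_add_cancel] at h5
  rw [← MvPolynomial.sum_homogeneousComponent p]
  refine Finset.sum_induction _ motive add (harm 0 0 (Submodule.zero_mem _)) fun d _ => ?_
  exact hom d _ (MvPolynomial.homogeneousComponent_isHomogeneous d p)

/-! ### Completeness -/

/-- Polynomials as continuous functions on the sphere. -/
def polyToContinuous : Poly →ₐ[ℝ] C(S2, ℝ) :=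
  MvPolynomial.aeval fun i => ⟨fun x : S2 => (x : E3) i, by fun_prop⟩

theorem polyToContinuous_apply (p : Poly) (x : S2) : polyToContinuous p x = polyFun p x := by
  induction p using MvPolynomial.induction_on with
  | C a => simp [polyToContinuous]
  | add p q hp hq => simp [hp, hq]
  | mul_X p i hp => rw [map_mul, ContinuousMap.mul_apply, hp]; simp [polyToContinuous]

/-- Stone–Weierstrass: ∫ f² = ∫ f (f − p) for every polynomial p, and p can be uniformly close to f.
-/
theorem eq_zero_of_integral_mul_polyFun {f : S2 → ℝ} (hf : Continuous f)
    (h : ∀ p : Poly, ∫ x, f x * polyFun p x ∂surf = 0) (x : S2) : f x = 0 := by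
  have hsep : (polyToContinuous.range).SeparatesPoints := by
    intro x y hxy
    have : ∃ i, (x : E3) i ≠ (y : E3) i := by
      by_contra! hc
      exact hxy (Subtype.ext (by ext i; exact hc i))
    obtain ⟨i, hi⟩ := this
    refine ⟨polyToContinuous (MvPolynomial.X i), ⟨_, ⟨_, rfl⟩, rfl⟩, ?_⟩
    simpa [polyToContinuous_apply] using hi
  obtain ⟨C, hC⟩ := exists_bound_sphere hf
  have hC0 : 0 ≤ C := (abs_nonneg _).trans (hC x)
  have hsq : ∫ x, f x * f x ∂surf = 0 := by
    refine le_antisymm (le_of_forall_pos_le_add fun ε hε => ?_)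
      (integral_nonneg fun x => mul_self_nonneg _)
    -- The tolerance makes C · 4π · δ at most ε; the summand 1 covers C = 0.
    have hδ : 0 < ε / (C * (4 * Real.pi) + 1) := by positivity
    obtain ⟨⟨_, ⟨p, rfl⟩⟩, hp⟩ :=
      ContinuousMap.exists_mem_subalgebra_near_continuous_of_separatesPoints _ hsep f hf _ hδ
    have h1 : ∫ x, f x * f x ∂surf = ∫ x, f x * (f x - polyFun p x) ∂surf := by
      simp only [mul_sub]
      rw [integral_sub (integrable_surf (by fun_prop)) (integrable_surf (by fun_prop)), h p,
        sub_zero]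
    rw [h1, zero_add]
    have h2 : ∫ x, f x * (f x - polyFun p x) ∂surf
        ≤ ∫ _x : S2, C * (ε / (C * (4 * Real.pi) + 1)) ∂surf := by
      refine integral_mono (integrable_surf (by fun_prop)) (integrable_const _) fun y => ?_
      refine (le_abs_self _).trans ?_
      rw [abs_mul]
      have h3 : |polyToContinuous p y - f y| < _ := hp y
      rw [polyToContinuous_apply] at h3
      rw [abs_sub_comm] at h3
      exact mul_le_mul (hC y) h3.le (abs_nonneg _) hC0
    refine h2.trans ?_
    rw [integral_const, surf_real_univ, smul_eq_mul,
      show 4 * Real.pi * (C * (ε / (C * (4 * Real.pi) + 1)))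
        = ε * ((C * (4 * Real.pi)) / (C * (4 * Real.pi) + 1)) by ring]
    refine mul_le_of_le_one_right hε.le ?_
    rw [div_le_one (by positivity)]
    linarith
  exact mul_self_eq_zero.1 (eq_zero_of_integral_eq_zero (f := fun x => f x * f x) (by fun_prop)
    (fun x => mul_self_nonneg _) hsq x)

/-- On the sphere the factor |x|² in `harmonic_induction` equals 1, so harmonic polynomials already
test against all polynomials. -/
theorem eq_zero_of_integral_mul_harmonic {f : S2 → ℝ} (hf : Continuous f)
    (h : ∀ ℓ, ∀ p ∈ solidHarmonics ℓ, ∫ x, f x * polyFun p x ∂surf = 0) (x : S2) : f x = 0 := by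
  refine eq_zero_of_integral_mul_polyFun hf (fun p => ?_) x
  induction p using harmonic_induction with
  | harm ℓ p hp => exact h ℓ p hp
  | add p q hp hq =>
    simp only [polyFun_add, mul_add]
    rw [integral_add (integrable_surf (by fun_prop)) (integrable_surf (by fun_prop)), hp, hq,
      add_zero]
  | normSq q hq => simpa only [polyFun_mul, polyFun_normSqPoly, one_mul] using hq

/-- Polynomials which agree on the sphere have the same surface curl. -/
theorem curlOp_congr_sphere {p q : Poly} (h : ∀ x : S2, polyFun p x = polyFun q x) (i : Fin 3)
    (x : S2) : polyFun (curlOp i p) x = polyFun (curlOp i q) x := by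
  have h1 : ∀ x : S2, polyFun (curlOp i (p - q)) x = 0 := by
    intro x
    -- Tested against any r, the operator moves onto r by parts, leaving a factor p − q that
    -- vanishes on the sphere.
    refine eq_zero_of_integral_mul_polyFun (f := fun x : S2 => polyFun (curlOp i (p - q)) x)
      (by fun_prop) (fun r => ?_) x
    simp only [mul_comm]
    rw [integral_mul_curlOp]
    simp [h]
  have h2 := h1 x
  rwa [map_sub, polyFun_sub, sub_eq_zero] at h2

open MvPolynomial (pderiv)

/-! ### Legendre polynomials -/

section Legendre

open Polynomial

theorem iterate_derivative_X_mul' (n : ℕ) (u : ℝ[X]) :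
    derivative^[n + 1] (X * u) = X * derivative^[n + 1] u + ((n : ℝ[X]) + 1) * derivative^[n] u := by
  induction n with
  | zero => simp [derivative_mul, add_comm]
  | succ n ih =>
    rw [Function.iterate_succ_apply', ih]
    simp only [derivative_add, derivative_mul, derivative_X, derivative_natCast, derivative_one,
      ← Function.iterate_succ_apply' (f := derivative)]
    push_cast
    ring

theorem iterate_derivative_sq_sub_one_mul (n : ℕ) (u : ℝ[X]) :
    derivative^[n + 2] ((X ^ 2 - 1) * u) = (X ^ 2 - 1) * derivative^[n + 2] u
      + 2 * ((n : ℝ[X]) + 2) * X * derivative^[n + 1] u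
      + ((n : ℝ[X]) + 2) * ((n : ℝ[X]) + 1) * derivative^[n] u := by
  induction n with
  | zero =>
    simp [derivative_mul, sq]
    ring
  | succ n ih =>
    rw [Function.iterate_succ_apply', ih]
    simp only [sq, derivative_add, derivative_sub, derivative_mul, derivative_X,
      derivative_natCast, derivative_one, derivative_ofNat,
      ← Function.iterate_succ_apply' (f := derivative)]
    push_cast
    ring

/-- Legendre's differential equation. -/
theorem legendre_ode (ℓ : ℕ) :
    (X ^ 2 - 1) * derivative (derivative (legendre ℓ)) + 2 * X * derivative (legendre ℓ)
      = (ℓ : ℝ[X]) * ((ℓ : ℝ[X]) + 1) * legendre ℓ := by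
  cases ℓ with
  | zero => simp [legendre]
  | succ m =>
    set w : ℝ[X] := (X ^ 2 - 1) ^ (m + 1) with hw
    -- The power w in Rodrigues' formula satisfies a first-order equation; differentiating it m + 2
    -- times produces the equation for the derivative of order m + 1.
    have h1 : (X ^ 2 - 1) * derivative w = 2 * ((m : ℝ[X]) + 1) * (X * w) := by
      rw [hw, derivative_pow]
      simp
      ring
    have h2 := congrArg (derivative^[m + 2]) h1
    rw [iterate_derivative_sq_sub_one_mul,
      show 2 * ((m : ℝ[X]) + 1) * (X * w) = C (2 * ((m : ℝ) + 1)) * (X * w) by simp [C_ofNat],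
      iterate_derivative_C_mul, iterate_derivative_X_mul'] at h2
    simp only [← Function.iterate_succ_apply (f := derivative)] at h2
    have e : legendre (m + 1)
        = C (1 / (2 ^ (m + 1) * ((m + 1).factorial : ℝ))) * derivative^[m + 1] w := rfl
    rw [e]
    simp only [derivative_C_mul, ← Function.iterate_succ_apply' (f := derivative)]
    simp only [map_mul, map_add, map_natCast, map_one, map_ofNat] at h2
    push_cast at h2 ⊢
    linear_combination C (1 / (2 ^ (m + 1) * ((m + 1).factorial : ℝ))) * h2

theorem eval_iterate_derivative_X_sub_C_pow_mul (a : ℝ) (n : ℕ) (q : ℝ[X]) :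
    (derivative^[n] ((X - C a) ^ n * q)).eval a = n.factorial * q.eval a := by
  induction n generalizing q with
  | zero => simp
  | succ n ih =>
    rw [Function.iterate_succ_apply]
    have h : derivative ((X - C a) ^ (n + 1) * q)
        = (X - C a) ^ n * (((n : ℝ[X]) + 1) * q + (X - C a) * derivative q) := by
      rw [derivative_mul, derivative_X_sub_C_pow]
      simp
      ring
    rw [h, ih]
    simp [Nat.factorial_succ]
    ring

theorem legendre_eval_one (ℓ : ℕ) : (legendre ℓ).eval 1 = 1 := by
  have h : ((X : ℝ[X]) ^ 2 - 1) ^ ℓ = (X - C 1) ^ ℓ * (X + 1) ^ ℓ := by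
    rw [← mul_pow]; congr 1; simp; ring
  rw [legendre, h, eval_mul, eval_iterate_derivative_X_sub_C_pow_mul]
  have := Nat.factorial_ne_zero ℓ
  simp
  norm_num
  field_simp

theorem legendre_eval_neg_one (ℓ : ℕ) : (legendre ℓ).eval (-1) = (-1) ^ ℓ := by
  have h : ((X : ℝ[X]) ^ 2 - 1) ^ ℓ = (X - C (-1)) ^ ℓ * (X - 1) ^ ℓ := by
    rw [← mul_pow]; congr 1; simp; ring
  rw [legendre, h, eval_mul, eval_iterate_derivative_X_sub_C_pow_mul]
  have := Nat.factorial_ne_zero ℓ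
  simp
  norm_num
  rw [show (-2 : ℝ) = -1 * 2 by norm_num, mul_pow]
  field_simp

theorem natDegree_legendre_le (ℓ : ℕ) : (legendre ℓ).natDegree ≤ ℓ := by
  refine (natDegree_C_mul_le _ _).trans ((natDegree_iterate_derivative _ _).trans ?_)
  have : (((X : ℝ[X]) ^ 2 - 1) ^ ℓ).natDegree ≤ ℓ * 2 := by
    refine natDegree_pow_le_of_le ℓ ?_
    compute_degree
  omega

/-! ### Orthogonality, norms and completeness of the Legendre polynomials -/

theorem integral_derivative (p : ℝ[X]) :
    ∫ t in (-1 : ℝ)..1, (derivative p).eval t = p.eval 1 - p.eval (-1) :=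
  intervalIntegral.integral_eq_sub_of_hasDerivAt (fun t _ => p.hasDerivAt t)
    ((derivative p).continuous.intervalIntegrable _ _)

theorem intervalIntegrable_eval (p : ℝ[X]) (a b : ℝ) :
    IntervalIntegrable (fun t => p.eval t) volume a b :=
  p.continuous.intervalIntegrable a b

/-- Symmetry of Legendre's differential operator. -/
theorem integral_legendre_mul_ode (ℓ : ℕ) (q : ℝ[X]) :
    ∫ t in (-1 : ℝ)..1, (legendre ℓ * ((X ^ 2 - 1) * derivative (derivative q)
      + 2 * X * derivative q)).eval t
      = ℓ * (ℓ + 1) * ∫ t in (-1 : ℝ)..1, (legendre ℓ * q).eval t := by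
  -- This is X² − 1 times the Wronskian of `legendre ℓ` and q. It vanishes at both endpoints, and
  -- its derivative is the difference of the two integrands.
  have h := integral_derivative ((X ^ 2 - 1) * (legendre ℓ * derivative q
    - q * derivative (legendre ℓ)))
  have e : derivative ((X ^ 2 - 1) * (legendre ℓ * derivative q - q * derivative (legendre ℓ)))
      = legendre ℓ * ((X ^ 2 - 1) * derivative (derivative q) + 2 * X * derivative q)
        - C ((ℓ : ℝ) * (ℓ + 1)) * (legendre ℓ * q) := by
    simp only [sq, derivative_mul, derivative_sub, derivative_X, derivative_one]
    simp
    linear_combination (-q) * legendre_ode ℓ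
  have b : ∀ p : ℝ[X], ((X ^ 2 - 1) * p).eval 1 - ((X ^ 2 - 1) * p).eval (-1) = 0 := by simp
  rw [b, e] at h
  simp only [eval_sub, eval_C_mul] at h
  rw [intervalIntegral.integral_sub (intervalIntegrable_eval _ _ _)
    ((intervalIntegrable_eval _ _ _).const_mul _), intervalIntegral.integral_const_mul] at h
  linarith

/-- Legendre's operator sends X^k to k(k + 1) X^k − k(k − 1) X^(k − 2). The second term is
orthogonal to `legendre ℓ` by induction, so symmetry gives (ℓ(ℓ + 1) − k(k + 1)) times the integral
equal to 0. -/
theorem integral_legendre_mul_X_pow (ℓ : ℕ) :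
    ∀ k < ℓ, ∫ t in (-1 : ℝ)..1, (legendre ℓ * X ^ k).eval t = 0 := by
  intro k
  induction k using Nat.strong_induction_on with
  | _ k ih =>
    intro hk
    have h := integral_legendre_mul_ode ℓ (X ^ k)
    -- For k < 2 the coefficient k(k − 1) is zero, so the truncated exponent k − 2 does no harm.
    have hprev : ∫ t in (-1 : ℝ)..1, (C ((k : ℝ) * (k - 1)) * (legendre ℓ * X ^ (k - 2))).eval t
        = 0 := by
      simp only [eval_C_mul]
      rw [intervalIntegral.integral_const_mul]
      rcases Nat.lt_or_ge k 2 with h2 | h2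
      · interval_cases k <;> simp
      · rw [ih (k - 2) (by omega) (by omega), mul_zero]
    have e : legendre ℓ * ((X ^ 2 - 1) * derivative (derivative (X ^ k))
        + 2 * X * derivative (X ^ k)) = C ((k : ℝ) * (k + 1)) * (legendre ℓ * X ^ k)
          - C ((k : ℝ) * (k - 1)) * (legendre ℓ * X ^ (k - 2)) := by
      rcases Nat.lt_or_ge k 2 with h2 | h2
      · interval_cases k <;> simp
        ring
      · obtain ⟨m, rfl⟩ : ∃ m, k = m + 2 := ⟨k - 2, by omega⟩
        simp [map_ofNat C]
        ring
    rw [e] at h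
    simp only [eval_sub, eval_C_mul (a := (k : ℝ) * (k + 1))] at h
    rw [intervalIntegral.integral_sub ((intervalIntegrable_eval _ _ _).const_mul _)
      (intervalIntegrable_eval _ _ _), intervalIntegral.integral_const_mul, hprev, sub_zero] at h
    have hne : (ℓ : ℝ) * (ℓ + 1) - k * (k + 1) ≠ 0 := by
      have : (k : ℝ) < ℓ := by exact_mod_cast hk
      have h0 : (0 : ℝ) ≤ k := by positivity
      nlinarith
    refine (mul_eq_zero.1 (?_ : ((ℓ : ℝ) * (ℓ + 1) - k * (k + 1)) * _ = 0)).resolve_left hne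
    linarith

theorem integral_legendre_mul_of_degree_lt (ℓ : ℕ) {q : ℝ[X]} (hq : q.degree < ℓ) :
    ∫ t in (-1 : ℝ)..1, (legendre ℓ * q).eval t = 0 := by
  by_cases h0 : q = 0
  · simp [h0]
  have h1 : q.natDegree < ℓ := (natDegree_lt_iff_degree_lt h0).2 hq
  have e : legendre ℓ * q
      = ∑ k ∈ Finset.range (q.natDegree + 1), C (q.coeff k) * (legendre ℓ * X ^ k) := by
    conv_lhs => rw [q.as_sum_range_C_mul_X_pow, Finset.mul_sum]
    exact Finset.sum_congr rfl fun k _ => by ring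
  rw [e]
  simp only [eval_finsetSum, eval_C_mul]
  rw [intervalIntegral.integral_finsetSum fun k _ => (intervalIntegrable_eval _ _ _).const_mul _]
  refine Finset.sum_eq_zero fun k hk => ?_
  rw [Finset.mem_range] at hk
  rw [intervalIntegral.integral_const_mul, integral_legendre_mul_X_pow ℓ k (by omega), mul_zero]

/-- The derivative of X P² is (2ℓ + 1) P² + 2 P (X P' − ℓ P). The bracket has degree below ℓ and is
orthogonal to P, and X P² changes by 2 from −1 to 1. -/
theorem integral_legendre_sq (ℓ : ℕ) :
    ∫ t in (-1 : ℝ)..1, (legendre ℓ * legendre ℓ).eval t = 2 / (2 * ℓ + 1) := by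
  have h1 := integral_derivative (X * (legendre ℓ * legendre ℓ))
  -- X P' − ℓ P has no term in X^ℓ, because X d/dX multiplies that coefficient by ℓ.
  have hr : (X * derivative (legendre ℓ) - C (ℓ : ℝ) * legendre ℓ).degree
      < (ℓ : WithBot ℕ) := by
    rw [degree_lt_iff_coeff_zero]
    intro k hk
    rcases Nat.eq_zero_or_pos k with h0 | h0
    · subst h0
      simp at hk
      simp [hk]
    · obtain ⟨m, rfl⟩ : ∃ m, k = m + 1 := ⟨k - 1, by omega⟩
      rw [coeff_sub, coeff_X_mul, coeff_derivative, coeff_C_mul]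
      rcases Nat.lt_or_ge ℓ (m + 1) with h2 | h2
      · rw [coeff_eq_zero_of_natDegree_lt ((natDegree_legendre_le ℓ).trans_lt h2)]
        simp
      · rw [show ℓ = m + 1 by omega]
        push_cast
        ring
  have h2 := integral_legendre_mul_of_degree_lt ℓ hr
  have e : derivative (X * (legendre ℓ * legendre ℓ))
      = C ((2 : ℝ)) * (legendre ℓ * (X * derivative (legendre ℓ) - C (ℓ : ℝ) * legendre ℓ))
        + C (2 * (ℓ : ℝ) + 1) * (legendre ℓ * legendre ℓ) := by
    simp only [derivative_mul, derivative_X]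
    simp [C_ofNat]
    ring
  rw [e] at h1
  simp only [eval_add, eval_C_mul] at h1
  rw [intervalIntegral.integral_add ((intervalIntegrable_eval _ _ _).const_mul _)
    ((intervalIntegrable_eval _ _ _).const_mul _), intervalIntegral.integral_const_mul,
    intervalIntegral.integral_const_mul, h2] at h1
  simp only [eval_mul, eval_X, legendre_eval_one, legendre_eval_neg_one] at h1
  have h3 : ((-1 : ℝ) ^ ℓ) * (-1) ^ ℓ = 1 := by rw [← mul_pow]; simp
  rw [h3] at h1
  simp only [eval_mul]
  rw [eq_div_iff (by positivity)]
  linarith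

/-- A polynomial of smaller degree would be orthogonal to `legendre ℓ`, thus to itself, against its
positive norm. -/
theorem degree_legendre (ℓ : ℕ) : (legendre ℓ).degree = ℓ := by
  by_contra hne
  have hlt : (legendre ℓ).degree < ℓ :=
    lt_of_le_of_ne (natDegree_le_iff_degree_le.1 (natDegree_legendre_le ℓ)) hne
  have h := integral_legendre_sq ℓ
  rw [integral_legendre_mul_of_degree_lt ℓ hlt] at h
  have : (0 : ℝ) < 2 / (2 * ℓ + 1) := by positivity
  linarith

theorem integral_legendre_mul_legendre {ℓ m : ℕ} (h : ℓ ≠ m) :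
    ∫ t in (-1 : ℝ)..1, (legendre ℓ * legendre m).eval t = 0 := by
  rcases lt_or_gt_of_ne h with h1 | h1
  · rw [mul_comm]
    exact integral_legendre_mul_of_degree_lt m (by rw [degree_legendre]; exact_mod_cast h1)
  · exact integral_legendre_mul_of_degree_lt ℓ (by rw [degree_legendre]; exact_mod_cast h1)

/-- The Legendre polynomials as a sequence of polynomials of degree `0, 1, 2, …`. -/
def legendreSequence : Polynomial.Sequence ℝ where
  elems' := legendre
  degree_eq' := degree_legendre

/-- A continuous function on `[-1, 1]` which is orthogonal to all Legendre polynomials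
vanishes. -/
theorem eq_zero_of_integral_mul_legendre {u : ℝ → ℝ} (hu : ContinuousOn u (Set.Icc (-1) 1))
    (h : ∀ ℓ, ∫ t in (-1 : ℝ)..1, u t * (legendre ℓ).eval t = 0) :
    ∀ t ∈ Set.Icc (-1 : ℝ) 1, u t = 0 := by
  have hu' : ContinuousOn u (Set.uIcc (-1) 1) := by rwa [Set.uIcc_of_le (by norm_num)]
  have hint : ∀ p : ℝ[X], IntervalIntegrable (fun t => u t * p.eval t) volume (-1) 1 := fun p =>
    (hu'.mul p.continuous.continuousOn).intervalIntegrable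
  have hall : ∀ p : ℝ[X], ∫ t in (-1 : ℝ)..1, u t * p.eval t = 0 := by
    intro p
    have hp : p ∈ Submodule.span ℝ (Set.range legendreSequence) := by
      rw [legendreSequence.span fun i => isUnit_iff_ne_zero.2
        (leadingCoeff_ne_zero.2 (legendreSequence.ne_zero i))]
      trivial
    induction hp using Submodule.span_induction with
    | mem p hp => obtain ⟨ℓ, rfl⟩ := hp; exact h ℓ
    | zero => simp
    | add p q _ _ hp hq =>
      simp only [eval_add, mul_add]
      rw [intervalIntegral.integral_add (hint p) (hint q), hp, hq, add_zero]
    | smul a p _ hp =>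
      simp only [eval_smul, smul_eq_mul, mul_left_comm _ a]
      rw [intervalIntegral.integral_const_mul, hp, mul_zero]
  obtain ⟨C, hC⟩ := isCompact_Icc.exists_bound_of_continuousOn hu
  have hC0 : 0 ≤ C := (norm_nonneg _).trans (hC 0 (by norm_num))
  have hsq : ∫ t in (-1 : ℝ)..1, u t * u t ≤ 0 := by
    refine le_of_forall_pos_le_add fun ε hε => ?_
    obtain ⟨p, hp⟩ := exists_polynomial_near_of_continuousOn (-1) 1 u hu (ε / (2 * C + 1))
      (by positivity)
    have h1 : ∫ t in (-1 : ℝ)..1, u t * u t = ∫ t in (-1 : ℝ)..1, u t * (u t - p.eval t) := by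
      simp only [mul_sub]
      rw [intervalIntegral.integral_sub (f := fun t => u t * u t)
        (hu'.mul hu').intervalIntegrable (hint p), hall p, sub_zero]
    rw [h1, zero_add]
    have h2 : ∫ t in (-1 : ℝ)..1, u t * (u t - p.eval t)
        ≤ ∫ _t in (-1 : ℝ)..1, C * (ε / (2 * C + 1)) := by
      refine intervalIntegral.integral_mono_on (by norm_num)
        (hu'.mul (hu'.sub p.continuous.continuousOn)).intervalIntegrable
        intervalIntegrable_const fun t ht => ?_
      refine (le_abs_self _).trans ?_
      rw [abs_mul, abs_sub_comm]
      exact mul_le_mul (hC t ht) (hp t ht).le (abs_nonneg _) hC0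
    refine h2.trans ?_
    rw [intervalIntegral.integral_const, smul_eq_mul,
      show (1 - -1) * (C * (ε / (2 * C + 1))) = ε * ((2 * C) / (2 * C + 1)) by ring]
    refine mul_le_of_le_one_right hε.le ?_
    rw [div_le_one (by positivity)]
    linarith
  by_contra! hc
  obtain ⟨t, ht, h0⟩ := hc
  have := intervalIntegral.integral_pos (f := fun t => u t * u t) (by norm_num) (hu.mul hu)
    (fun x _ => mul_self_nonneg (u x)) ⟨t, ht, mul_self_pos.2 h0⟩
  linarith

end Legendre

/-! ### Zonal polynomials -/

/-- The inner product of two points of the sphere. -/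
def sdot (x y : S2) : ℝ := (x : E3).ofLp ⬝ᵥ (y : E3).ofLp

theorem sdot_eq (x y : S2) :
    sdot x y = (x : E3) 0 * (y : E3) 0 + (x : E3) 1 * (y : E3) 1 + (x : E3) 2 * (y : E3) 2 := by
  simp [sdot, dotProduct, Fin.sum_univ_three]

theorem sdot_comm (x y : S2) : sdot x y = sdot y x := dotProduct_comm _ _

theorem sdot_self (x : S2) : sdot x x = 1 := by
  rw [sdot_eq]; linear_combination sphere_sq x

@[fun_prop]
theorem continuous_sdot (y : S2) : Continuous fun x => sdot x y := by
  simp only [sdot_eq]; fun_prop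

theorem sdot_mem (x y : S2) : sdot x y ∈ Set.Icc (-1 : ℝ) 1 := by
  have hx := sphere_sq x
  have hy := sphere_sq y
  rw [sdot_eq]
  constructor <;>
  nlinarith [sq_nonneg ((x : E3) 0 - (y : E3) 0), sq_nonneg ((x : E3) 1 - (y : E3) 1),
    sq_nonneg ((x : E3) 2 - (y : E3) 2), sq_nonneg ((x : E3) 0 + (y : E3) 0),
    sq_nonneg ((x : E3) 1 + (y : E3) 1), sq_nonneg ((x : E3) 2 + (y : E3) 2)]

/-- The linear polynomial `x ↦ x · y`. -/
def linPoly (y : S2) : Poly := ∑ i, MvPolynomial.C ((y : E3) i) * MvPolynomial.X i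

theorem polyFun_linPoly (x y : S2) : polyFun (linPoly y) x = sdot x y := by
  simp [linPoly, sdot_eq, Fin.sum_univ_three, mul_comm]

/-- The polynomial `x ↦ q(x · y)`. -/
def zonal (y : S2) (q : Polynomial ℝ) : Poly := Polynomial.aeval (linPoly y) q

theorem polyFun_zonal (x y : S2) (q : Polynomial ℝ) :
    polyFun (zonal y q) x = q.eval (sdot x y) := by
  rw [← polyFun_linPoly]
  induction q using Polynomial.induction_on' with
  | add p q hp hq => rw [zonal] at *; simp [hp, hq]
  | monomial n a => simp [zonal, Polynomial.aeval_monomial]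

theorem curlOp_zonal (i : Fin 3) (y : S2) (q : Polynomial ℝ) :
    curlOp i (zonal y q) = zonal y (Polynomial.derivative q) * curlOp i (linPoly y) := by
  rw [zonal, Derivation.map_aeval, smul_eq_mul]; rfl

theorem isHomogeneous_linPoly (y : S2) : (linPoly y).IsHomogeneous 1 :=
  MvPolynomial.IsHomogeneous.sum _ _ _ fun i _ => by
    have := (MvPolynomial.isHomogeneous_C (Fin 3) ((y : E3) i)).mul
      (MvPolynomial.isHomogeneous_X ℝ i)
    rwa [zero_add] at this

theorem polyFun_curlOp_linPoly (i : Fin 3) (x y : S2) :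
    polyFun (curlOp i (linPoly y)) x = ((x : E3).ofLp ⨯₃ (y : E3).ofLp) i := by
  have h : ∀ j, pderiv j (linPoly y) = MvPolynomial.C ((y : E3) j) := by
    intro j
    fin_cases j <;> simp [linPoly, Fin.sum_univ_three, Derivation.leibniz, MvPolynomial.pderiv_X]
  rw [curlOp_apply, h, h]
  fin_cases i <;> simp [crossProduct]

/-- The chain rule gives (x × ∇) q(x · y) = q'(x · y) x × y. With |x × y|² = 1 − (x · y)² and the
eigenvalue −2 of the linear polynomial, Laplace–Beltrami on zonal functions becomes minus the
operator in `legendre_ode`. -/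
theorem polyFun_sphLap_zonal (x y : S2) (q : Polynomial ℝ) :
    polyFun (sphLap (zonal y q)) x
      = -((Polynomial.X ^ 2 - 1) * Polynomial.derivative (Polynomial.derivative q)
        + 2 * Polynomial.X * Polynomial.derivative q).eval (sdot x y) := by
  have h1 : polyFun (sphLap (linPoly y)) x = -2 * sdot x y := by
    rw [sphLap_eq (isHomogeneous_linPoly y), laplacian_eq_zero (isHomogeneous_linPoly y) le_rfl]
    simp [polyFun_linPoly]
    norm_num
  rw [sphLap_apply, polyFun_sum] at h1 ⊢
  rw [Fin.sum_univ_three] at h1 ⊢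
  simp only [curlOp_zonal, curlOp_mul, polyFun_add, polyFun_mul, polyFun_zonal,
    polyFun_curlOp_linPoly, Polynomial.eval_add, Polynomial.eval_mul, Polynomial.eval_sub,
    Polynomial.eval_pow, Polynomial.eval_X, Polynomial.eval_one, Polynomial.eval_ofNat] at h1 ⊢
  have h2 : ((x : E3).ofLp ⨯₃ (y : E3).ofLp) 0 ^ 2 + ((x : E3).ofLp ⨯₃ (y : E3).ofLp) 1 ^ 2
      + ((x : E3).ofLp ⨯₃ (y : E3).ofLp) 2 ^ 2 = 1 - sdot x y ^ 2 := by
    rw [sdot_eq]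
    simp [crossProduct]
    linear_combination ((y : E3) 0 ^ 2 + (y : E3) 1 ^ 2 + (y : E3) 2 ^ 2) * sphere_sq x
      + sphere_sq y
  linear_combination (Polynomial.derivative q).eval (sdot x y) * h1
    + (Polynomial.derivative (Polynomial.derivative q)).eval (sdot x y) * h2

/-- Integrals of zonal polynomials. -/
theorem integral_zonal (y : S2) (q : Polynomial ℝ) :
    ∫ x : S2, q.eval (sdot x y) ∂surf = 2 * Real.pi * ∫ t in (-1 : ℝ)..1, q.eval t := by
  have hz : ∀ q : Polynomial ℝ, Continuous fun x : S2 => q.eval (sdot x y) := fun q =>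
    q.continuous.comp (continuous_sdot y)
  -- Integration by parts against the constant 1.
  have hlap : ∀ q : Polynomial ℝ, ∫ x : S2, ((Polynomial.X ^ 2 - 1)
      * Polynomial.derivative (Polynomial.derivative q)
        + 2 * Polynomial.X * Polynomial.derivative q).eval (sdot x y) ∂surf = 0 := by
    intro q
    have h := integral_mul_sphLap 1 (zonal y q)
    simp only [polyFun_one, one_mul, polyFun_sphLap_zonal, Derivation.map_one_eq_zero,
      polyFun_zero, zero_mul, Finset.sum_const_zero, integral_zero, neg_zero] at h
    rw [integral_neg] at h
    exact neg_eq_zero.1 h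
  -- Applied to X^(k + 2), `hlap` yields the recursion (k + 3) m_(k+2) = (k + 1) m_k for the
  -- moments, which the integrals of t^k over [−1, 1] satisfy as well. The cases k = 0 and k = 1
  -- start it.
  have hpow : ∀ k : ℕ, ∫ x : S2, sdot x y ^ k ∂surf = 2 * Real.pi * ∫ t in (-1 : ℝ)..1, t ^ k := by
    intro k
    induction k using Nat.twoStepInduction with
    | zero =>
      simp [surf_real_univ]
      ring
    | one =>
      have h := hlap Polynomial.X
      simp at h
      rw [integral_const_mul] at h
      simp
      linarith
    | more k ih _ =>
      have h := hlap (Polynomial.X ^ (k + 2))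
      have e : ∀ t : ℝ, (((Polynomial.X : Polynomial ℝ) ^ 2 - 1)
          * Polynomial.derivative (Polynomial.derivative (Polynomial.X ^ (k + 2)))
          + 2 * Polynomial.X * Polynomial.derivative (Polynomial.X ^ (k + 2))).eval t
          = ((k : ℝ) + 2) * (k + 3) * t ^ (k + 2) - ((k : ℝ) + 2) * (k + 1) * t ^ k := by
        intro t
        simp
        ring
      simp only [e] at h
      rw [integral_sub (integrable_surf (by fun_prop)) (integrable_surf (by fun_prop)),
        integral_const_mul, integral_const_mul, ih] at h
      have h2 : (∫ x : S2, sdot x y ^ (k + 2) ∂surf)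
          = (k + 1) / (k + 3) * (2 * Real.pi * ∫ t in (-1 : ℝ)..1, t ^ k) := by
        have : ((k : ℝ) + 2) ≠ 0 := by positivity
        have h3 : ((k : ℝ) + 3) ≠ 0 := by positivity
        field_simp
        have h4 := mul_left_cancel₀ this (by linarith :
          ((k : ℝ) + 2) * ((k + 3) * ∫ x : S2, sdot x y ^ (k + 2) ∂surf)
            = (k + 2) * ((k + 1) * (2 * Real.pi * ∫ t in (-1 : ℝ)..1, t ^ k)))
        linarith
      rw [h2, integral_pow, integral_pow]
      push_cast
      field_simp
      ring
  induction q using Polynomial.induction_on' with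
  | add p q hp hq =>
    simp only [Polynomial.eval_add]
    rw [integral_add (integrable_surf (hz p)) (integrable_surf (hz q)), hp, hq,
      intervalIntegral.integral_add (intervalIntegrable_eval _ _ _) (intervalIntegrable_eval _ _ _)]
    ring
  | monomial n a =>
    simp only [Polynomial.eval_monomial]
    rw [integral_const_mul, intervalIntegral.integral_const_mul, hpow]
    ring

open MvPolynomial (pderiv)

/-! ### The addition theorem -/

/-- The density `(2 ℓ + 1) / (4 π)`. -/
def dens (ℓ : ℕ) : ℝ := (2 * ℓ + 1) / (4 * Real.pi)

theorem dens_pos (ℓ : ℕ) : 0 < dens ℓ := by unfold dens; positivity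

theorem lam_nonneg (ℓ : ℕ) : 0 ≤ lam ℓ := by unfold lam; positivity

theorem lam_succ_pos (n : ℕ) : 0 < lam (n + 1) := by unfold lam; positivity

section Addition

variable {Y : ∀ ℓ : ℕ, Fin (2 * ℓ + 1) → MvPolynomial (Fin 3) ℝ} (hY : IsHarmonicBasis Y)

include hY in
theorem harmonicBasis_mem (ℓ : ℕ) (k : Fin (2 * ℓ + 1)) : Y ℓ k ∈ solidHarmonics ℓ := by
  rw [← hY.span_eq ℓ]
  exact Submodule.subset_span ⟨k, rfl⟩

include hY in
theorem exists_eq_sum_harmonicBasis {ℓ : ℕ} {h : Poly} (hh : h ∈ solidHarmonics ℓ) :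
    ∃ a : Fin (2 * ℓ + 1) → ℝ, h = ∑ k, a k • Y ℓ k := by
  rw [← hY.span_eq ℓ, Submodule.mem_span_range_iff_exists_fun] at hh
  obtain ⟨a, ha⟩ := hh
  exact ⟨a, ha.symm⟩

include hY in
theorem integral_sum_mul_harmonicBasis (ℓ : ℕ) (a : Fin (2 * ℓ + 1) → ℝ) (k : Fin (2 * ℓ + 1)) :
    ∫ x : S2, (∑ k', a k' * polyFun (Y ℓ k') x) * polyFun (Y ℓ k) x ∂surf = a k := by
  simp only [Finset.sum_mul, mul_assoc]
  rw [integral_finsetSum _ fun k' _ => integrable_surf (by fun_prop)]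
  simp [integral_const_mul, hY.orthonormal]

include hY in
/-- A continuous function which is orthogonal to all spherical harmonics vanishes. -/
theorem eq_zero_of_coeff_eq_zero {f : S2 → ℝ} (hf : Continuous f)
    (h : ∀ ℓ k, coeff Y f ℓ k = 0) (x : S2) : f x = 0 := by
  refine eq_zero_of_integral_mul_harmonic hf (fun ℓ p hp => ?_) x
  obtain ⟨a, rfl⟩ := exists_eq_sum_harmonicBasis hY hp
  simp only [polyFun_sum, polyFun_smul, Finset.mul_sum, mul_left_comm _ (a _)]
  rw [integral_finsetSum _ fun k' _ => integrable_surf (by fun_prop)]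
  refine Finset.sum_eq_zero fun k _ => ?_
  rw [integral_const_mul]
  exact mul_eq_zero_of_right _ (h ℓ k)

/-- Both factors are eigenfunctions of the symmetric operator `sphLap` on the sphere, with different
eigenvalues. No harmonicity of a homogeneous extension of the zonal function is needed. -/
theorem integral_zonal_legendre_mul_harmonic {ℓ m : ℕ} (hm : ℓ ≠ m) (y : S2) {h : Poly}
    (hh : h ∈ solidHarmonics m) :
    ∫ x : S2, (legendre ℓ).eval (sdot x y) * polyFun h x ∂surf = 0 := by
  have h1 := integral_mul_sphLap_comm h (zonal y (legendre ℓ))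
  rw [sphLap_harmonic hh] at h1
  simp only [polyFun_sphLap_zonal, legendre_ode, polyFun_zonal, polyFun_neg, polyFun_mul,
    polyFun_natCast, polyFun_add, polyFun_one, Polynomial.eval_mul, Polynomial.eval_natCast,
    Polynomial.eval_add, Polynomial.eval_one] at h1
  have e1 : ∀ x : S2, polyFun h x * -((ℓ : ℝ) * (ℓ + 1) * (legendre ℓ).eval (sdot x y))
      = -((ℓ : ℝ) * (ℓ + 1)) * ((legendre ℓ).eval (sdot x y) * polyFun h x) := fun x => by ring
  have e2 : ∀ x : S2, (legendre ℓ).eval (sdot x y) * -((m : ℝ) * (m + 1) * polyFun h x)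
      = -((m : ℝ) * (m + 1)) * ((legendre ℓ).eval (sdot x y) * polyFun h x) := fun x => by ring
  simp only [e1, e2] at h1
  rw [integral_const_mul, integral_const_mul] at h1
  have hne : (m : ℝ) * (m + 1) - ℓ * (ℓ + 1) ≠ 0 := by
    have h0 : (0 : ℝ) ≤ ℓ := by positivity
    have h2 : (0 : ℝ) ≤ m := by positivity
    have h3 : (m : ℝ) - ℓ ≠ 0 := sub_ne_zero.2 (by exact_mod_cast hm.symm)
    have : (m : ℝ) * (m + 1) - ℓ * (ℓ + 1) = (m - ℓ) * (m + ℓ + 1) := by ring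
    rw [this]
    exact mul_ne_zero h3 (by positivity)
  refine (mul_eq_zero.1 (?_ : ((m : ℝ) * (m + 1) - ℓ * (ℓ + 1)) * _ = 0)).resolve_left hne
  linarith

theorem continuous_eval_sdot (q : Polynomial ℝ) (y : S2) :
    Continuous fun x : S2 => q.eval (sdot x y) :=
  q.continuous.comp (continuous_sdot y)

include hY in
-- The zonal function is orthogonal to every other degree, so the difference from its projection
-- onto degree ℓ has only zero coefficients.
theorem legendre_sdot_eq_sum (ℓ : ℕ) (x y : S2) :
    (legendre ℓ).eval (sdot x y)
      = ∑ k, coeff Y (fun z => (legendre ℓ).eval (sdot z y)) ℓ k * polyFun (Y ℓ k) x := by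
  have hc := continuous_eval_sdot (legendre ℓ) y
  rw [← sub_eq_zero]
  refine eq_zero_of_coeff_eq_zero hY (f := fun x : S2 => (legendre ℓ).eval (sdot x y)
    - ∑ k, coeff Y (fun z => (legendre ℓ).eval (sdot z y)) ℓ k * polyFun (Y ℓ k) x)
    (by fun_prop) (fun m k => ?_) x
  unfold coeff
  simp only [sub_mul]
  rw [integral_sub (integrable_surf (by fun_prop)) (integrable_surf (by fun_prop)), sub_eq_zero]
  by_cases hm : ℓ = m
  · subst hm
    rw [integral_sum_mul_harmonicBasis hY]
  · rw [integral_zonal_legendre_mul_harmonic hm y (harmonicBasis_mem hY m k)]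
    simp only [Finset.sum_mul, mul_assoc]
    rw [integral_finsetSum _ fun k' _ => integrable_surf (by fun_prop)]
    symm
    refine Finset.sum_eq_zero fun k' _ => ?_
    rw [integral_const_mul, integral_harmonic_mul_harmonic (harmonicBasis_mem hY ℓ k')
      (harmonicBasis_mem hY m k) hm, mul_zero]

include hY in
-- The L₂ distance between the two sides of the addition theorem is computed from the diagonal value
-- alone; this makes the positivity argument in `sum_harmonicBasis_sq` possible.
theorem integral_addition_defect (ℓ : ℕ) (y : S2) :
    ∫ x : S2, ((legendre ℓ).eval (sdot x y)
      - (dens ℓ)⁻¹ * ∑ k, polyFun (Y ℓ k) y * polyFun (Y ℓ k) x) ^ 2 ∂surf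
      = (dens ℓ)⁻¹ ^ 2 * (∑ k, polyFun (Y ℓ k) y ^ 2 - dens ℓ) := by
  have hc := continuous_eval_sdot (legendre ℓ) y
  set c := (dens ℓ)⁻¹ with hcdef
  have hd := (dens_pos ℓ).ne'
  have h1 : ∫ x : S2, (legendre ℓ).eval (sdot x y) ^ 2 ∂surf = c := by
    have h := integral_zonal y (legendre ℓ * legendre ℓ)
    rw [integral_legendre_sq] at h
    simp only [Polynomial.eval_mul] at h
    simp only [sq]
    rw [h, hcdef, dens]
    field_simp
    ring
  -- This is the expansion of the zonal function evaluated at x = y, where its value is P_ℓ(1) = 1.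
  have h2 : ∫ x : S2, (legendre ℓ).eval (sdot x y)
      * ∑ k, polyFun (Y ℓ k) y * polyFun (Y ℓ k) x ∂surf = 1 := by
    simp only [Finset.mul_sum, mul_left_comm _ (polyFun (Y ℓ _) (y : E3))]
    rw [integral_finsetSum _ fun k' _ => integrable_surf (by fun_prop)]
    have h := legendre_sdot_eq_sum hY ℓ y y
    rw [sdot_self, legendre_eval_one] at h
    refine Eq.trans ?_ h.symm
    refine Finset.sum_congr rfl fun k _ => ?_
    rw [integral_const_mul, mul_comm]
    rfl
  have h3 : ∫ x : S2, (∑ k, polyFun (Y ℓ k) y * polyFun (Y ℓ k) x) ^ 2 ∂surf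
      = ∑ k, polyFun (Y ℓ k) y ^ 2 := by
    have e : ∀ x : S2, (∑ k, polyFun (Y ℓ k) y * polyFun (Y ℓ k) x) ^ 2
        = ∑ k, polyFun (Y ℓ k) y
          * ((∑ k', polyFun (Y ℓ k') y * polyFun (Y ℓ k') x) * polyFun (Y ℓ k) x) := by
      intro x
      rw [sq, Finset.mul_sum]
      exact Finset.sum_congr rfl fun k _ => by ring
    simp only [e]
    rw [integral_finsetSum _ fun k' _ => integrable_surf (by fun_prop)]
    refine Finset.sum_congr rfl fun k _ => ?_
    rw [integral_const_mul, integral_sum_mul_harmonicBasis hY ℓ fun k' => polyFun (Y ℓ k') y, sq]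
  have e : ∀ x : S2, ((legendre ℓ).eval (sdot x y)
      - c * ∑ k, polyFun (Y ℓ k) y * polyFun (Y ℓ k) x) ^ 2
      = (legendre ℓ).eval (sdot x y) ^ 2
        - 2 * c * ((legendre ℓ).eval (sdot x y) * ∑ k, polyFun (Y ℓ k) y * polyFun (Y ℓ k) x)
        + c ^ 2 * (∑ k, polyFun (Y ℓ k) y * polyFun (Y ℓ k) x) ^ 2 := fun x => by ring
  simp only [e]
  rw [integral_add (integrable_surf (by fun_prop)) (integrable_surf (by fun_prop)),
    integral_sub (integrable_surf (by fun_prop)) (integrable_surf (by fun_prop)),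
    integral_const_mul, integral_const_mul, h1, h2, h3]
  have h4 : c ^ 2 * dens ℓ = c := by rw [hcdef]; field_simp
  linear_combination h4

include hY in
-- The defect is an integral of a square, so the sum is at least `dens ℓ` at every point. Integrated
-- over the sphere both give 2ℓ + 1, the number of basis elements, so a continuous nonnegative
-- difference has integral zero.
theorem sum_harmonicBasis_sq (ℓ : ℕ) (y : S2) : ∑ k, polyFun (Y ℓ k) y ^ 2 = dens ℓ := by
  have hc : 0 < (dens ℓ)⁻¹ ^ 2 := by have := dens_pos ℓ; positivity
  have h0 : ∀ y : S2, 0 ≤ ∑ k, polyFun (Y ℓ k) y ^ 2 - dens ℓ := by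
    intro y
    have h := integral_addition_defect hY ℓ y
    have h1 : 0 ≤ (dens ℓ)⁻¹ ^ 2 * (∑ k, polyFun (Y ℓ k) y ^ 2 - dens ℓ) := by
      rw [← h]; exact integral_nonneg fun x => sq_nonneg _
    exact nonneg_of_mul_nonneg_right h1 hc
  have h1 : ∫ y : S2, (∑ k, polyFun (Y ℓ k) y ^ 2 - dens ℓ) ∂surf = 0 := by
    rw [integral_sub (integrable_surf (by fun_prop)) (integrable_const _),
      integral_finsetSum _ fun k' _ => integrable_surf (by fun_prop), integral_const,
      surf_real_univ]
    simp only [sq, hY.orthonormal]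
    simp [dens]
    field_simp
    ring
  exact sub_eq_zero.1 (eq_zero_of_integral_eq_zero (by fun_prop) h0 h1 y)

include hY in
/-- The addition theorem for spherical harmonics. -/
theorem sum_harmonicBasis_mul (ℓ : ℕ) (x y : S2) :
    ∑ k, polyFun (Y ℓ k) x * polyFun (Y ℓ k) y = dens ℓ * (legendre ℓ).eval (sdot x y) := by
  have hc := continuous_eval_sdot (legendre ℓ) y
  have h := integral_addition_defect hY ℓ y
  rw [sum_harmonicBasis_sq hY, sub_self, mul_zero] at h
  have h1 := eq_zero_of_integral_eq_zero (by fun_prop) (fun x => sq_nonneg _) h x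
  have h2 : (legendre ℓ).eval (sdot x y)
      = (dens ℓ)⁻¹ * ∑ k, polyFun (Y ℓ k) y * polyFun (Y ℓ k) x :=
    sub_eq_zero.1 (pow_eq_zero_iff (two_ne_zero)|>.1 h1)
  rw [h2, mul_inv_cancel_left₀ (dens_pos ℓ).ne']
  exact Finset.sum_congr rfl fun k _ => mul_comm _ _

theorem exists_sdot_eq {t : ℝ} (ht : t ∈ Set.Icc (-1 : ℝ) 1) : ∃ x y : S2, sdot x y = t := by
  have h0 : 0 ≤ 1 - t ^ 2 := by nlinarith [ht.1, ht.2]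
  refine ⟨⟨!₂[t, Real.sqrt (1 - t ^ 2), 0], ?_⟩, ⟨!₂[1, 0, 0], ?_⟩, ?_⟩
  · rw [mem_sphere_zero_iff_norm, EuclideanSpace.norm_eq]
    simp [Fin.sum_univ_three, Real.sq_sqrt h0]
  · rw [mem_sphere_zero_iff_norm, EuclideanSpace.norm_eq]
    simp [Fin.sum_univ_three]
  · simp [sdot_eq]

include hY in
-- Cauchy–Schwarz in the addition theorem, since every t in [−1, 1] is an inner product of two
-- points of the sphere.
theorem abs_legendre_le_one (ℓ : ℕ) {t : ℝ} (ht : t ∈ Set.Icc (-1 : ℝ) 1) :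
    |(legendre ℓ).eval t| ≤ 1 := by
  obtain ⟨x, y, rfl⟩ := exists_sdot_eq ht
  have h := Finset.sum_mul_sq_le_sq_mul_sq Finset.univ (fun k => polyFun (Y ℓ k) (x : E3))
    (fun k => polyFun (Y ℓ k) (y : E3))
  rw [sum_harmonicBasis_mul hY, sum_harmonicBasis_sq hY, sum_harmonicBasis_sq hY, mul_pow,
    sq (dens ℓ)] at h
  have hd := dens_pos ℓ
  have h1 : (legendre ℓ).eval (sdot x y) ^ 2 ≤ 1 :=
    le_of_mul_le_mul_left (by simpa using h) (mul_pos hd hd)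
  exact (sq_le_one_iff_abs_le_one _).1 h1

/-! ### Addition theorems for vector spherical harmonics -/

theorem polyFun_curlOp_curlOp_linPoly (i j : Fin 3) (x y : S2) :
    polyFun (curlOp j (curlOp i (linPoly x))) y
      = -matR (x : E3).ofLp (y : E3).ofLp i j := by
  have h : ∀ j, pderiv j (linPoly x) = MvPolynomial.C ((x : E3) j) := by
    intro j
    fin_cases j <;> simp [linPoly, Fin.sum_univ_three, Derivation.leibniz, MvPolynomial.pderiv_X]
  rw [curlOp_apply i, h, h]
  fin_cases i <;> fin_cases j <;>
    simp [curlOp_apply, matR, Matrix.vecMulVec_apply, dotProduct, Fin.sum_univ_three,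
      Derivation.leibniz, MvPolynomial.pderiv_X] <;> ring

include hY in
-- The addition theorem is differentiated in x. Its sides are polynomials that agree only on the
-- sphere, which is enough because x × ∇ is tangential (`curlOp_congr_sphere`).
theorem sum_curlOp_mul (ℓ : ℕ) (x y : S2) (i : Fin 3) :
    ∑ k, polyFun (curlOp i (Y ℓ k)) x * polyFun (Y ℓ k) y
      = dens ℓ * ((Polynomial.derivative (legendre ℓ)).eval (sdot x y)
        * ((x : E3).ofLp ⨯₃ (y : E3).ofLp) i) := by
  have h := curlOp_congr_sphere (p := ∑ k, polyFun (Y ℓ k) y • Y ℓ k)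
    (q := dens ℓ • zonal y (legendre ℓ)) (fun x => ?_) i x
  · simp only [map_sum, Derivation.map_smul, polyFun_sum, polyFun_smul, curlOp_zonal, polyFun_mul,
      polyFun_zonal, polyFun_curlOp_linPoly] at h
    rw [← h]
    exact Finset.sum_congr rfl fun k _ => mul_comm _ _
  · simp only [polyFun_sum, polyFun_smul, polyFun_zonal]
    rw [← sum_harmonicBasis_mul hY]
    exact Finset.sum_congr rfl fun k _ => mul_comm _ _

include hY in
/-- The addition theorem for surface curls. -/
theorem sum_curlOp_mul_curlOp (ℓ : ℕ) (x y : S2) (i j : Fin 3) :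
    ∑ k, polyFun (curlOp i (Y ℓ k)) x * polyFun (curlOp j (Y ℓ k)) y
      = dens ℓ * ((Polynomial.derivative (Polynomial.derivative (legendre ℓ))).eval (sdot x y)
          * matQ (x : E3).ofLp (y : E3).ofLp i j
        + (Polynomial.derivative (legendre ℓ)).eval (sdot x y)
          * matR (x : E3).ofLp (y : E3).ofLp i j) := by
  have hcross : ∀ (x y : S2) (i : Fin 3), ((x : E3).ofLp ⨯₃ (y : E3).ofLp) i
      = -polyFun (curlOp i (linPoly x)) y := by
    intro x y i
    rw [polyFun_curlOp_linPoly, ← cross_anticomm]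
    rfl
  -- Now x is frozen and the identity just obtained is differentiated in y; the minus sign comes
  -- from exchanging the factors of the cross product.
  have h := curlOp_congr_sphere (p := ∑ k, polyFun (curlOp i (Y ℓ k)) x • Y ℓ k)
    (q := -(dens ℓ • (zonal x (Polynomial.derivative (legendre ℓ)) * curlOp i (linPoly x))))
    (fun y => ?_) j y
  · simp only [map_sum, Derivation.map_smul, polyFun_sum, polyFun_smul, map_neg, curlOp_mul,
      polyFun_neg, polyFun_add, curlOp_zonal, polyFun_mul, polyFun_zonal,
      polyFun_curlOp_curlOp_linPoly] at h
    rw [h, sdot_comm y x]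
    simp only [matQ, Matrix.neg_apply, Matrix.vecMulVec_apply, hcross x y]
    ring
  · simp only [polyFun_sum, polyFun_smul, polyFun_neg, polyFun_mul, polyFun_zonal]
    rw [sum_curlOp_mul hY, hcross, sdot_comm y x]
    ring

/-- On the sphere the surface gradient is the vector (x × ∇p) × x. Statements about gradients thus
reduce to statements about curls. -/
theorem surfGrad_polyFun (p : Poly) (x : S2) (i : Fin 3) :
    surfGrad (polyFun p) x i = (x : E3) (i + 2) * polyFun (curlOp (i + 1) p) x
      - (x : E3) (i + 1) * polyFun (curlOp (i + 2) p) x := by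
  have hx := sphere_sq x
  rw [surfGrad, gradient_polyFun, real_inner_comm, PiLp.sub_apply, PiLp.smul_apply, smul_eq_mul,
    inner_gradP, Fin.sum_univ_three]
  fin_cases i <;> simp [gradP, curlOp_apply]
  · linear_combination (-polyFun (pderiv 0 p) x) * hx
  · linear_combination (-polyFun (pderiv 1 p) x) * hx
  · linear_combination (-polyFun (pderiv 2 p) x) * hx

/-- Taking the cross product with x in the left index and with y in the right index is the passage
from curls to gradients in both variables. Together with `rotate_matR` it transports the addition
theorem from one type of harmonic to the other. -/
theorem rotate_matQ (x y : S2) (i j : Fin 3) :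
    (x : E3) (i + 2) * (y : E3) (j + 2) * matQ (x : E3).ofLp (y : E3).ofLp (i + 1) (j + 1)
      - (x : E3) (i + 2) * (y : E3) (j + 1) * matQ (x : E3).ofLp (y : E3).ofLp (i + 1) (j + 2)
      - (x : E3) (i + 1) * (y : E3) (j + 2) * matQ (x : E3).ofLp (y : E3).ofLp (i + 2) (j + 1)
      + (x : E3) (i + 1) * (y : E3) (j + 1) * matQ (x : E3).ofLp (y : E3).ofLp (i + 2) (j + 2)
      = matV (x : E3).ofLp (y : E3).ofLp i j := by
  have hx := sphere_sq x
  have hy := sphere_sq y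
  have ht := sdot_eq x y
  have e : (x : E3).ofLp ⬝ᵥ (y : E3).ofLp = sdot x y := rfl
  simp only [matQ, matV, Matrix.neg_apply, Matrix.vecMulVec_apply, e, Pi.sub_apply, Pi.smul_apply,
    smul_eq_mul]
  have ex : ∀ i : Fin 3, (x : E3) (i + 2) * ((x : E3).ofLp ⨯₃ (y : E3).ofLp) (i + 1)
      - (x : E3) (i + 1) * ((x : E3).ofLp ⨯₃ (y : E3).ofLp) (i + 2)
      = (y : E3) i - sdot x y * (x : E3) i := by
    intro i
    fin_cases i <;> simp [crossProduct]
    · linear_combination (y : E3) 0 * hx + (x : E3) 0 * ht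
    · linear_combination (y : E3) 1 * hx + (x : E3) 1 * ht
    · linear_combination (y : E3) 2 * hx + (x : E3) 2 * ht
  have ey : ∀ j : Fin 3, (y : E3) (j + 1) * ((x : E3).ofLp ⨯₃ (y : E3).ofLp) (j + 2)
      - (y : E3) (j + 2) * ((x : E3).ofLp ⨯₃ (y : E3).ofLp) (j + 1)
      = (x : E3) j - sdot x y * (y : E3) j := by
    intro j
    fin_cases j <;> simp [crossProduct]
    · linear_combination (x : E3) 0 * hy + (y : E3) 0 * ht
    · linear_combination (x : E3) 1 * hy + (y : E3) 1 * ht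
    · linear_combination (x : E3) 2 * hy + (y : E3) 2 * ht
  rw [← ex i, ← ey j]
  ring

theorem rotate_matR (x y : S2) (i j : Fin 3) :
    (x : E3) (i + 2) * (y : E3) (j + 2) * matR (x : E3).ofLp (y : E3).ofLp (i + 1) (j + 1)
      - (x : E3) (i + 2) * (y : E3) (j + 1) * matR (x : E3).ofLp (y : E3).ofLp (i + 1) (j + 2)
      - (x : E3) (i + 1) * (y : E3) (j + 2) * matR (x : E3).ofLp (y : E3).ofLp (i + 2) (j + 1)
      + (x : E3) (i + 1) * (y : E3) (j + 1) * matR (x : E3).ofLp (y : E3).ofLp (i + 2) (j + 2)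
      = matW (x : E3).ofLp (y : E3).ofLp i j := by
  have hx := sphere_sq x
  have hy := sphere_sq y
  fin_cases i <;> fin_cases j <;>
    simp [matR, matW, Matrix.vecMulVec_apply, Matrix.mul_apply, Fin.sum_univ_three, dotProduct,
      Matrix.one_apply]
  · linear_combination ((y : E3) 1 ^ 2 + (y : E3) 2 ^ 2) * hx + (1 - (x : E3) 0 ^ 2) * hy
  · linear_combination (-((y : E3) 0 * (y : E3) 1)) * hx - (x : E3) 0 * (x : E3) 1 * hy
  · linear_combination (-((y : E3) 0 * (y : E3) 2)) * hx - (x : E3) 0 * (x : E3) 2 * hy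
  · linear_combination (-((y : E3) 1 * (y : E3) 0)) * hx - (x : E3) 1 * (x : E3) 0 * hy
  · linear_combination ((y : E3) 0 ^ 2 + (y : E3) 2 ^ 2) * hx + (1 - (x : E3) 1 ^ 2) * hy
  · linear_combination (-((y : E3) 1 * (y : E3) 2)) * hx - (x : E3) 1 * (x : E3) 2 * hy
  · linear_combination (-((y : E3) 2 * (y : E3) 0)) * hx - (x : E3) 2 * (x : E3) 0 * hy
  · linear_combination (-((y : E3) 2 * (y : E3) 1)) * hx - (x : E3) 2 * (x : E3) 1 * hy
  · linear_combination ((y : E3) 0 ^ 2 + (y : E3) 1 ^ 2) * hx + (1 - (x : E3) 2 ^ 2) * hy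

include hY in
/-- The addition theorem for surface gradients. -/
theorem sum_surfGrad_mul_surfGrad (ℓ : ℕ) (x y : S2) (i j : Fin 3) :
    ∑ k, surfGrad (polyFun (Y ℓ k)) x i * surfGrad (polyFun (Y ℓ k)) y j
      = dens ℓ * ((Polynomial.derivative (Polynomial.derivative (legendre ℓ))).eval (sdot x y)
          * matV (x : E3).ofLp (y : E3).ofLp i j
        + (Polynomial.derivative (legendre ℓ)).eval (sdot x y)
          * matW (x : E3).ofLp (y : E3).ofLp i j) := by
  have e : ∀ k, surfGrad (polyFun (Y ℓ k)) x i * surfGrad (polyFun (Y ℓ k)) y j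
      = (x : E3) (i + 2) * (y : E3) (j + 2)
          * (polyFun (curlOp (i + 1) (Y ℓ k)) x * polyFun (curlOp (j + 1) (Y ℓ k)) y)
        - (x : E3) (i + 2) * (y : E3) (j + 1)
          * (polyFun (curlOp (i + 1) (Y ℓ k)) x * polyFun (curlOp (j + 2) (Y ℓ k)) y)
        - (x : E3) (i + 1) * (y : E3) (j + 2)
          * (polyFun (curlOp (i + 2) (Y ℓ k)) x * polyFun (curlOp (j + 1) (Y ℓ k)) y)
        + (x : E3) (i + 1) * (y : E3) (j + 1)
          * (polyFun (curlOp (i + 2) (Y ℓ k)) x * polyFun (curlOp (j + 2) (Y ℓ k)) y) := by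
    intro k
    rw [surfGrad_polyFun, surfGrad_polyFun]
    ring
  simp only [e, Finset.sum_add_distrib, Finset.sum_sub_distrib, ← Finset.mul_sum,
    sum_curlOp_mul_curlOp hY]
  rw [← rotate_matQ x y i j, ← rotate_matR x y i j]
  ring

theorem eval_one_derivative_legendre (ℓ : ℕ) :
    (Polynomial.derivative (legendre ℓ)).eval 1 = lam ℓ / 2 := by
  have h := congrArg (Polynomial.eval 1) (legendre_ode ℓ)
  simp [legendre_eval_one] at h
  rw [lam]
  linarith

theorem eval_neg_one_derivative_legendre (ℓ : ℕ) :
    (Polynomial.derivative (legendre ℓ)).eval (-1) = -(lam ℓ / 2 * (legendre ℓ).eval (-1)) := by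
  have h := congrArg (Polynomial.eval (-1)) (legendre_ode ℓ)
  simp at h
  rw [lam]
  linarith

theorem divHarmonic_apply (ℓ : ℕ) (p : Poly) (x : S2) (i : Fin 3) :
    divHarmonic ℓ p x i = (Real.sqrt (lam ℓ))⁻¹ * polyFun (curlOp i p) x := by
  simp [divHarmonic, surfCurl_polyFun]

theorem curlHarmonic_apply (ℓ : ℕ) (p : Poly) (x : S2) (i : Fin 3) :
    curlHarmonic ℓ p x i = (Real.sqrt (lam ℓ))⁻¹ * surfGrad (polyFun p) x i := by
  simp [curlHarmonic]

theorem norm_sq_surfGrad (p : Poly) (x : S2) :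
    ‖surfGrad (polyFun p) x‖ ^ 2 = ‖surfCurl (polyFun p) x‖ ^ 2 := by
  have hx := sphere_sq x
  rw [EuclideanSpace.real_norm_sq_eq, EuclideanSpace.real_norm_sq_eq, Fin.sum_univ_three,
    Fin.sum_univ_three]
  simp only [surfGrad_polyFun, surfCurl_polyFun]
  have h : (x : E3) 0 * polyFun (curlOp 0 p) x + (x : E3) 1 * polyFun (curlOp 1 p) x
      + (x : E3) 2 * polyFun (curlOp 2 p) x = 0 := by
    simp [curlOp_apply]
    ring
  simp
  linear_combination (polyFun (curlOp 0 p) x ^ 2 + polyFun (curlOp 1 p) x ^ 2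
    + polyFun (curlOp 2 p) x ^ 2) * hx - ((x : E3) 0 * polyFun (curlOp 0 p) x
    + (x : E3) 1 * polyFun (curlOp 1 p) x + (x : E3) 2 * polyFun (curlOp 2 p) x) * h

include hY in
-- The trace of the addition theorem on the diagonal: Q vanishes, R has trace 2, and P_ℓ'(1) =
-- λ_ℓ/2.
theorem sum_norm_sq_surfCurl (ℓ : ℕ) (x : S2) :
    ∑ k, ‖surfCurl (polyFun (Y ℓ k)) x‖ ^ 2 = dens ℓ * lam ℓ := by
  have hx := sphere_sq x
  simp only [EuclideanSpace.real_norm_sq_eq, surfCurl_polyFun]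
  rw [Finset.sum_comm]
  simp only [sq (polyFun _ _), sum_curlOp_mul_curlOp hY, sdot_self, eval_one_derivative_legendre]
  simp [Fin.sum_univ_three, matQ, matR, Matrix.vecMulVec_apply, dotProduct]
  linear_combination dens ℓ * lam ℓ * hx

include hY in
theorem sum_norm_sq_divHarmonic (n : ℕ) (x : S2) :
    ∑ k, ‖divHarmonic (n + 1) (Y (n + 1) k) x‖ ^ 2 = dens (n + 1) := by
  simp only [divHarmonic, norm_smul, mul_pow, ← Finset.mul_sum, sum_norm_sq_surfCurl hY, norm_inv,
    Real.norm_eq_abs, sq_abs, inv_pow, Real.sq_sqrt (lam_nonneg _)]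
  have := (lam_succ_pos n).ne'
  field_simp

include hY in
theorem sum_norm_sq_curlHarmonic (n : ℕ) (x : S2) :
    ∑ k, ‖curlHarmonic (n + 1) (Y (n + 1) k) x‖ ^ 2 = dens (n + 1) := by
  rw [← sum_norm_sq_divHarmonic hY n x]
  simp only [divHarmonic, curlHarmonic, norm_smul, mul_pow, norm_sq_surfGrad]

end Addition

/-! ### Expansion of the kernels -/

/-- Indices of the vector spherical harmonics of degree `n + 1`. -/
abbrev VIdx (n : ℕ) : Type := Fin (2 * (n + 1) + 1) ⊕ Fin (2 * (n + 1) + 1)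

/-- The vector spherical harmonics of degree `n + 1`. -/
def vecHarmonic (Y : ∀ ℓ : ℕ, Fin (2 * ℓ + 1) → MvPolynomial (Fin 3) ℝ) (n : ℕ) :
    VIdx n → S2 → E3 :=
  Sum.elim (fun k => divHarmonic (n + 1) (Y (n + 1) k))
    (fun k => curlHarmonic (n + 1) (Y (n + 1) k))

theorem hasSum_of_eq {f g : ℕ → ℝ} {a : ℝ} (h : ∀ n, f n = g n) (hf : HasSum f a) :
    HasSum g a := by
  rwa [← funext h]

section Kernel

variable {Y : ∀ ℓ : ℕ, Fin (2 * ℓ + 1) → MvPolynomial (Fin 3) ℝ} (hY : IsHarmonicBasis Y)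

include hY in
theorem sum_norm_sq_vecHarmonic (n : ℕ) (x : S2) :
    ∑ κ, ‖vecHarmonic Y n κ x‖ ^ 2 = 2 * dens (n + 1) := by
  rw [Fintype.sum_sum_type]
  simp only [vecHarmonic, Sum.elim_inl, Sum.elim_inr, sum_norm_sq_divHarmonic hY,
    sum_norm_sq_curlHarmonic hY]
  ring

include hY in
theorem sum_vecHarmonic_mul (n : ℕ) (x y : S2) (i j : Fin 3) :
    ∑ κ, vecHarmonic Y n κ x i * vecHarmonic Y n κ y j
      = dens (n + 1) / lam (n + 1)
        * ((Polynomial.derivative (Polynomial.derivative (legendre (n + 1)))).eval (sdot x y)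
          * (matQ (x : E3).ofLp (y : E3).ofLp i j + matV (x : E3).ofLp (y : E3).ofLp i j)
        + (Polynomial.derivative (legendre (n + 1))).eval (sdot x y)
          * (matR (x : E3).ofLp (y : E3).ofLp i j + matW (x : E3).ofLp (y : E3).ofLp i j)) := by
  have hs : (Real.sqrt (lam (n + 1)))⁻¹ * (Real.sqrt (lam (n + 1)))⁻¹ = (lam (n + 1))⁻¹ := by
    rw [← mul_inv, Real.mul_self_sqrt (lam_nonneg _)]
  rw [Fintype.sum_sum_type]
  simp only [vecHarmonic, Sum.elim_inl, Sum.elim_inr, divHarmonic_apply, curlHarmonic_apply,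
    mul_mul_mul_comm _ _ (Real.sqrt _)⁻¹, hs, ← Finset.mul_sum, sum_curlOp_mul_curlOp hY,
    sum_surfGrad_mul_surfGrad hY]
  ring

variable {φ : ℝ → ℝ} (hφ : ContinuousOn φ (Set.Icc (-1) 1))
  (hsum : Summable fun ℓ => dens ℓ * |legendreCoeff φ ℓ|)

/-- The Fourier–Legendre series. -/
def legendreSeries (φ : ℝ → ℝ) (t : ℝ) : ℝ :=
  ∑' ℓ, dens ℓ * legendreCoeff φ ℓ * (legendre ℓ).eval t

include hY in
theorem norm_legendreSeries_term_le (ℓ : ℕ) {t : ℝ} (ht : t ∈ Set.Icc (-1 : ℝ) 1) :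
    ‖dens ℓ * legendreCoeff φ ℓ * (legendre ℓ).eval t‖ ≤ dens ℓ * |legendreCoeff φ ℓ| := by
  rw [Real.norm_eq_abs, abs_mul, abs_mul, abs_of_pos (dens_pos ℓ)]
  exact mul_le_of_le_one_right (mul_nonneg (dens_pos ℓ).le (abs_nonneg _))
    (abs_legendre_le_one hY ℓ ht)

include hY hsum in
theorem hasSum_legendreSeries {t : ℝ} (ht : t ∈ Set.Icc (-1 : ℝ) 1) :
    HasSum (fun ℓ => dens ℓ * legendreCoeff φ ℓ * (legendre ℓ).eval t) (legendreSeries φ t) :=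
  (Summable.of_norm_bounded hsum fun ℓ => norm_legendreSeries_term_le hY ℓ ht).hasSum

include hY hsum in
theorem continuousOn_legendreSeries : ContinuousOn (legendreSeries φ) (Set.Icc (-1) 1) :=
  continuousOn_tsum (fun ℓ => (continuous_const.mul (legendre ℓ).continuous).continuousOn) hsum
    fun ℓ _ ht => norm_legendreSeries_term_le hY ℓ ht

include hY hsum in
theorem hasSum_integral_legendreSeries_mul (g : Polynomial ℝ) {t : ℝ}
    (ht : t ∈ Set.Icc (-1 : ℝ) 1) :
    HasSum (fun ℓ => ∫ u in (-1 : ℝ)..t, dens ℓ * legendreCoeff φ ℓ * (legendre ℓ).eval u * g.eval u)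
      (∫ u in (-1 : ℝ)..t, legendreSeries φ u * g.eval u) := by
  have hsub : Set.uIoc (-1) t ⊆ Set.Icc (-1 : ℝ) 1 := by
    rw [Set.uIoc_of_le ht.1]
    exact fun u hu => ⟨hu.1.le, hu.2.trans ht.2⟩
  refine intervalIntegral.hasSum_integral_of_dominated_convergence
    (fun ℓ u => dens ℓ * |legendreCoeff φ ℓ| * |g.eval u|)
    (fun ℓ => Continuous.aestronglyMeasurable (by fun_prop))
    (fun ℓ => Filter.Eventually.of_forall fun u hu => ?_)
    (Filter.Eventually.of_forall fun u _ => hsum.mul_right _) ?_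
    (Filter.Eventually.of_forall fun u hu =>
      (hasSum_legendreSeries hY hsum (hsub hu)).mul_right _)
  · rw [norm_mul]
    exact mul_le_mul_of_nonneg_right (norm_legendreSeries_term_le hY ℓ (hsub hu)) (norm_nonneg _)
  · simp only [tsum_mul_right]
    exact Continuous.intervalIntegrable (by fun_prop) _ _

include hY hφ hsum in
-- Both sides are continuous and have the same Legendre coefficients, so completeness applies to
-- their difference.
theorem legendreSeries_eq {t : ℝ} (ht : t ∈ Set.Icc (-1 : ℝ) 1) : legendreSeries φ t = φ t := by
  have hS := continuousOn_legendreSeries hY hsum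
  have hu : Set.uIcc (-1 : ℝ) 1 = Set.Icc (-1) 1 := Set.uIcc_of_le (by norm_num)
  rw [← sub_eq_zero]
  refine eq_zero_of_integral_mul_legendre (u := fun t => legendreSeries φ t - φ t) (hS.sub hφ)
    (fun m => ?_) t ht
  simp only [sub_mul]
  have hc := (legendre m).continuous.continuousOn (s := Set.Icc (-1) 1)
  rw [intervalIntegral.integral_sub
    (ContinuousOn.intervalIntegrable (by rw [hu]; exact hS.mul hc))
    (ContinuousOn.intervalIntegrable (by rw [hu]; exact hφ.mul hc)), sub_eq_zero]
  refine (hasSum_integral_legendreSeries_mul hY hsum (legendre m) (by norm_num)).unique ?_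
  have e : ∀ ℓ, ∫ u in (-1 : ℝ)..1, dens ℓ * legendreCoeff φ ℓ * (legendre ℓ).eval u
      * (legendre m).eval u
      = dens ℓ * legendreCoeff φ ℓ * ∫ u in (-1 : ℝ)..1, (legendre ℓ * legendre m).eval u := by
    intro ℓ
    rw [← intervalIntegral.integral_const_mul]
    simp only [Polynomial.eval_mul, mul_assoc]
  simp only [e]
  have h1 : (∫ u in (-1 : ℝ)..1, φ u * (legendre m).eval u)
      = dens m * legendreCoeff φ m * ∫ u in (-1 : ℝ)..1, (legendre m * legendre m).eval u := by
    rw [integral_legendre_sq, dens, legendreCoeff]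
    have := Real.pi_ne_zero
    have h2 : (2 * (m : ℝ) + 1) ≠ 0 := by positivity
    field_simp
    ring
  rw [h1]
  exact hasSum_single m fun ℓ hℓ => by rw [integral_legendre_mul_legendre hℓ, mul_zero]

include hY hφ hsum in
theorem hasSum_legendre {t : ℝ} (ht : t ∈ Set.Icc (-1 : ℝ) 1) :
    HasSum (fun ℓ => dens ℓ * legendreCoeff φ ℓ * (legendre ℓ).eval t) (φ t) := by
  rw [← legendreSeries_eq hY hφ hsum ht]
  exact hasSum_legendreSeries hY hsum ht

theorem legendre_zero : legendre 0 = 1 := by simp [legendre]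

theorem legendreCoeff_zero (φ : ℝ → ℝ) :
    legendreCoeff φ 0 = 2 * Real.pi * ∫ t in (-1 : ℝ)..1, φ t := by
  simp [legendreCoeff, legendre_zero]

/-- Legendre's equation in divergence form, ((1 − t²) P')' = −λ P, gives the primitive. Its factor 1
− t² cancels the one in the definition of κ. -/
theorem integral_legendre (ℓ : ℕ) (t : ℝ) :
    lam ℓ * ∫ u in (-1 : ℝ)..t, (legendre ℓ).eval u
      = -((1 - t ^ 2) * (Polynomial.derivative (legendre ℓ)).eval t) := by
  have h : ∀ u, HasDerivAt (fun u => -((1 - u ^ 2) * (Polynomial.derivative (legendre ℓ)).eval u))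
      (lam ℓ * (legendre ℓ).eval u) u := by
    intro u
    have h1 := congrArg (Polynomial.eval u) (legendre_ode ℓ)
    simp at h1
    have h2 := (((Polynomial.X ^ 2 - 1) * Polynomial.derivative (legendre ℓ)).hasDerivAt u)
    simp at h2
    refine (h2.congr_deriv ?_).congr_of_eventuallyEq (Filter.Eventually.of_forall fun v => ?_)
    · rw [lam, ← h1]
      ring
    · simp
      ring
  rw [← intervalIntegral.integral_const_mul, intervalIntegral.integral_eq_sub_of_hasDerivAt
    (fun u _ => h u) (Continuous.intervalIntegrable (by fun_prop) _ _)]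
  simp

variable (h0 : legendreCoeff φ 0 = 1)

include hY hφ hsum h0 in
theorem hasSum_legendre_succ {t : ℝ} (ht : t ∈ Set.Icc (-1 : ℝ) 1) :
    HasSum (fun n => dens (n + 1) * legendreCoeff φ (n + 1) * (legendre (n + 1)).eval t)
      (φ t - 1 / (4 * Real.pi)) := by
  have h := (hasSum_nat_add_iff' 1).2 (hasSum_legendre hY hφ hsum ht)
  simpa [h0, legendre_zero, dens] using h

include hY hφ hsum h0 in
-- Termwise integration of the kernel. By normalization the term of degree 0 is 1/(4π), exactly what
-- the integrand of κ subtracts.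
theorem hasSum_integral_succ {t : ℝ} (ht : t ∈ Set.Icc (-1 : ℝ) 1) :
    HasSum (fun n => (1 - t ^ 2) * (dens (n + 1) * legendreCoeff φ (n + 1) / lam (n + 1)
      * (Polynomial.derivative (legendre (n + 1))).eval t))
      ((4 * Real.pi)⁻¹ * ∫ u in (-1 : ℝ)..t, (1 - 4 * Real.pi * φ u)) := by
  have h := hasSum_integral_legendreSeries_mul hY hsum 1 ht
  simp only [Polynomial.eval_one, mul_one] at h
  have hpi := Real.pi_ne_zero
  have hsub : Set.uIcc (-1) t ⊆ Set.Icc (-1 : ℝ) 1 := by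
    rw [Set.uIcc_of_le ht.1]
    exact Set.Icc_subset_Icc_right ht.2
  rw [intervalIntegral.integral_congr fun u hu => legendreSeries_eq hY hφ hsum (hsub hu)] at h
  have h1 := ((hasSum_nat_add_iff' 1).2 h).neg
  have e : -((∫ u in (-1 : ℝ)..t, φ u)
      - ∑ i ∈ Finset.range 1, ∫ u in (-1 : ℝ)..t, dens i * legendreCoeff φ i * (legendre i).eval u)
      = (4 * Real.pi)⁻¹ * ∫ u in (-1 : ℝ)..t, (1 - 4 * Real.pi * φ u) := by
    rw [intervalIntegral.integral_sub intervalIntegrable_const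
      ((hφ.mono hsub).intervalIntegrable.const_mul _), intervalIntegral.integral_const_mul]
    simp [h0, legendre_zero, dens]
    field_simp
  rw [e] at h1
  refine hasSum_of_eq (fun n => ?_) h1
  rw [intervalIntegral.integral_const_mul]
  have h2 := integral_legendre (n + 1) t
  have h3 := (lam_succ_pos n).ne'
  field_simp
  linear_combination (-(dens (n + 1) * legendreCoeff φ (n + 1))) * h2

/-! ### The series of κ and κ' -/

theorem ne_of_one_sub_sq_ne_zero {t : ℝ} (h : 1 - t ^ 2 ≠ 0) : t ≠ 1 ∧ t ≠ -1 :=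
  ⟨fun h1 => h (by simp [h1]), fun h1 => h (by simp [h1])⟩

theorem kappa_of_ne (φ : ℝ → ℝ) {t : ℝ} (h : 1 - t ^ 2 ≠ 0) :
    kappa φ t = (1 - t ^ 2)⁻¹
      * ((4 * Real.pi)⁻¹ * ∫ u in (-1 : ℝ)..t, (1 - 4 * Real.pi * φ u)) := by
  obtain ⟨h1, h2⟩ := ne_of_one_sub_sq_ne_zero h
  rw [kappa, if_neg h1, if_neg h2]
  have := Real.pi_ne_zero
  field_simp

include hY hφ hsum h0 in
-- Inside the interval the factor 1 − t² is divided out. At the endpoints P_ℓ'(±1) = ±(λ_ℓ/2)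
-- P_ℓ(±1), so the series is ± half of that of φ(±1) − 1/(4π), which is the limit value built into
-- `kappa`.
theorem hasSum_kappa {t : ℝ} (ht : t ∈ Set.Icc (-1 : ℝ) 1) :
    HasSum (fun n => dens (n + 1) * legendreCoeff φ (n + 1) / lam (n + 1)
      * (Polynomial.derivative (legendre (n + 1))).eval t) (kappa φ t) := by
  have hpi := Real.pi_ne_zero
  by_cases h : 1 - t ^ 2 = 0
  · have h1 := hasSum_legendre_succ hY hφ hsum h0 ht
    rcases mul_self_eq_one_iff.1 (by linarith : t * t = 1) with rfl | rfl
    · convert! h1.mul_left (1 / 2 : ℝ) using 1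
      · funext n
        have := (lam_succ_pos n).ne'
        rw [eval_one_derivative_legendre, legendre_eval_one]
        field_simp
      · rw [kappa, if_pos rfl]
        field_simp
        ring
    · convert! h1.mul_left (-(1 / 2) : ℝ) using 1
      · funext n
        have := (lam_succ_pos n).ne'
        rw [eval_neg_one_derivative_legendre]
        field_simp
      · rw [kappa, if_neg (by norm_num), if_pos rfl]
        field_simp
        ring
  · rw [kappa_of_ne φ h]
    refine hasSum_of_eq (fun n => ?_) ((hasSum_integral_succ hY hφ hsum h0 ht).mul_left _)
    rw [inv_mul_cancel_left₀ h]

include hφ in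
-- Differentiating (1 − t²) κ = (4π)⁻¹ ∫ (1 − 4πφ) gives a first-order equation expressing κ'
-- through κ and φ.
theorem deriv_kappa {t : ℝ} (ht : t ∈ Set.Icc (-1 : ℝ) 1) (h : 1 - t ^ 2 ≠ 0) :
    deriv (kappa φ) t = (1 - t ^ 2)⁻¹ * (2 * t * kappa φ t - (φ t - 1 / (4 * Real.pi))) := by
  have hpi := Real.pi_ne_zero
  obtain ⟨h1, h2⟩ := ne_of_one_sub_sq_ne_zero h
  have hlt : t ∈ Set.Ioo (-1 : ℝ) 1 := ⟨lt_of_le_of_ne ht.1 h2.symm, lt_of_le_of_ne ht.2 h1⟩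
  have hn : Set.Icc (-1 : ℝ) 1 ∈ nhds t := Icc_mem_nhds hlt.1 hlt.2
  have hc : ContinuousOn (fun u => 1 - 4 * Real.pi * φ u) (Set.Icc (-1) 1) := by fun_prop
  have hsub : Set.uIcc (-1) t ⊆ Set.Icc (-1 : ℝ) 1 := by
    rw [Set.uIcc_of_le ht.1]
    exact Set.Icc_subset_Icc_right ht.2
  have hd : HasDerivAt (fun t => ∫ u in (-1 : ℝ)..t, (1 - 4 * Real.pi * φ u))
      (1 - 4 * Real.pi * φ t) t :=
    intervalIntegral.integral_hasDerivAt_right (hc.mono hsub).intervalIntegrable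
      ((hc.mono Set.Ioo_subset_Icc_self).stronglyMeasurableAtFilter isOpen_Ioo t hlt)
      (hc.continuousAt hn)
  have hq : HasDerivAt (fun t : ℝ => (1 - t ^ 2)⁻¹) (2 * t / (1 - t ^ 2) ^ 2) t := by
    refine (((hasDerivAt_pow 2 t).const_sub 1).inv h).congr_deriv ?_
    simp
  have hk := (hq.mul (hd.const_mul (4 * Real.pi)⁻¹)).congr_of_eventuallyEq (f₁ := kappa φ) (by
    have : ∀ᶠ u in nhds t, 1 - u ^ 2 ≠ 0 := ContinuousAt.eventually_ne (by fun_prop) h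
    filter_upwards [this] with u hu
    exact kappa_of_ne φ hu)
  rw [hk.deriv, kappa_of_ne φ h]
  field_simp
  ring

include hY hφ hsum h0 in
-- No termwise differentiation takes place: Legendre's equation gives each term the same relation as
-- `deriv_kappa`, so the series of P_ℓ'' converges as a combination of two series already summed.
theorem hasSum_deriv_kappa {t : ℝ} (ht : t ∈ Set.Icc (-1 : ℝ) 1) (h : 1 - t ^ 2 ≠ 0) :
    HasSum (fun n => dens (n + 1) * legendreCoeff φ (n + 1) / lam (n + 1)
      * (Polynomial.derivative (Polynomial.derivative (legendre (n + 1)))).eval t)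
      (deriv (kappa φ) t) := by
  rw [deriv_kappa hφ ht h]
  refine hasSum_of_eq (fun n => ?_) ((((hasSum_kappa hY hφ hsum h0 ht).mul_left (2 * t)).sub
    (hasSum_legendre_succ hY hφ hsum h0 ht)).mul_left _)
  have h1 := congrArg (Polynomial.eval t) (legendre_ode (n + 1))
  simp at h1
  have h2 := (lam_succ_pos n).ne'
  have h3 : lam (n + 1) = ((n : ℝ) + 1) * (n + 1 + 1) := by simp [lam]
  rw [← h3] at h1
  field_simp
  linear_combination dens (n + 1) * legendreCoeff φ (n + 1) * h1

/-- Both |x × y|² and |y − t x|² equal 1 − t², where t = x · y. So the κ' term needs no convergence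
at x = ±y. -/
theorem matQ_matV_eq_zero {x y : S2} (h : 1 - sdot x y ^ 2 = 0) :
    matQ (x : E3).ofLp (y : E3).ofLp = 0 ∧ matV (x : E3).ofLp (y : E3).ofLp = 0 := by
  have hx := sphere_sq x
  have hy := sphere_sq y
  have ht := sdot_eq x y
  have hQ : ∀ i, ((x : E3).ofLp ⨯₃ (y : E3).ofLp) i = 0 := by
    have h1 : ((x : E3).ofLp ⨯₃ (y : E3).ofLp) 0 ^ 2 + ((x : E3).ofLp ⨯₃ (y : E3).ofLp) 1 ^ 2
        + ((x : E3).ofLp ⨯₃ (y : E3).ofLp) 2 ^ 2 = 0 := by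
      rw [ht] at h
      simp [crossProduct]
      linear_combination ((y : E3) 0 ^ 2 + (y : E3) 1 ^ 2 + (y : E3) 2 ^ 2) * hx + hy + h
    intro i
    refine pow_eq_zero_iff (two_ne_zero) |>.1 (le_antisymm ?_ (sq_nonneg _))
    fin_cases i <;> simp only [Fin.zero_eta, Fin.mk_one, Fin.reduceFinMk] <;> nlinarith
  have hV : ∀ i, (y : E3) i - sdot x y * (x : E3) i = 0 := by
    have h1 : ((y : E3) 0 - sdot x y * (x : E3) 0) ^ 2 + ((y : E3) 1 - sdot x y * (x : E3) 1) ^ 2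
        + ((y : E3) 2 - sdot x y * (x : E3) 2) ^ 2 = 0 := by
      linear_combination h + hy + sdot x y ^ 2 * hx + 2 * sdot x y * ht
    intro i
    refine pow_eq_zero_iff (two_ne_zero) |>.1 (le_antisymm ?_ (sq_nonneg _))
    fin_cases i <;> simp only [Fin.zero_eta, Fin.mk_one, Fin.reduceFinMk] <;> nlinarith
  have e : (x : E3).ofLp ⬝ᵥ (y : E3).ofLp = sdot x y := rfl
  constructor
  · ext i j
    simp [matQ, Matrix.vecMulVec_apply, hQ]
  · ext i j
    simp [matV, Matrix.vecMulVec_apply, e, hV]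

include hY hφ hsum h0 in
/-- Expansion of the matrix kernel in vector spherical harmonics. -/
theorem hasSum_matKernel (x y : S2) (i j : Fin 3) :
    HasSum (fun n => legendreCoeff φ (n + 1)
      * ∑ κ, vecHarmonic Y n κ x i * vecHarmonic Y n κ y j) (matKernel φ x y i j) := by
  have ht := sdot_mem x y
  have hk := hasSum_kappa hY hφ hsum h0 ht
  have e : (x : E3).ofLp ⬝ᵥ (y : E3).ofLp = sdot x y := rfl
  have hm : matKernel φ x y i j = deriv (kappa φ) (sdot x y)
      * (matQ (x : E3).ofLp (y : E3).ofLp i j + matV (x : E3).ofLp (y : E3).ofLp i j)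
      + kappa φ (sdot x y)
      * (matR (x : E3).ofLp (y : E3).ofLp i j + matW (x : E3).ofLp (y : E3).ofLp i j) := by
    simp only [matKernel, divKernel, curlKernel, e, Matrix.add_apply, Matrix.smul_apply,
      smul_eq_mul]
    ring
  rw [hm]
  simp only [sum_vecHarmonic_mul hY]
  by_cases h : 1 - sdot x y ^ 2 = 0
  · obtain ⟨hQ, hV⟩ := matQ_matV_eq_zero h
    simp only [hQ, hV, Matrix.zero_apply, add_zero, mul_zero, zero_add]
    refine hasSum_of_eq (fun n => ?_) (hk.mul_right _)
    ring
  · refine hasSum_of_eq (fun n => ?_)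
      (((hasSum_deriv_kappa hY hφ hsum h0 ht h).mul_right _).add (hk.mul_right _))
    ring

end Kernel

open MvPolynomial (pderiv)

/-! ### Orthonormality of the vector spherical harmonics -/

theorem inner_E3 (u v : E3) : inner ℝ u v = ∑ i, u i * v i := by
  simp [PiLp.inner_apply, mul_comm]

theorem surfGrad_polyFun' (p : Poly) (x : S2) (i : Fin 3) :
    surfGrad (polyFun p) x i = polyFun (pderiv i p) x
      - (x : E3) i * ∑ j, (x : E3) j * polyFun (pderiv j p) x := by
  rw [surfGrad, gradient_polyFun, real_inner_comm, PiLp.sub_apply, PiLp.smul_apply, smul_eq_mul,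
    inner_gradP, mul_comm]
  simp only [gradP, mul_comm]

theorem sum_mul_curlOp (p : Poly) (x : S2) : ∑ i, (x : E3) i * polyFun (curlOp i p) x = 0 := by
  simp [Fin.sum_univ_three, curlOp_apply]
  ring

theorem inner_surfGrad_surfGrad (p q : Poly) (x : S2) :
    inner ℝ (surfGrad (polyFun p) x) (surfGrad (polyFun q) x)
      = inner ℝ (surfCurl (polyFun p) x) (surfCurl (polyFun q) x) := by
  have hx := sphere_sq x
  have h := sum_mul_curlOp p x
  rw [Fin.sum_univ_three] at h
  simp only [inner_E3, surfGrad_polyFun, surfCurl_polyFun, Fin.sum_univ_three]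
  simp
  linear_combination (polyFun (curlOp 0 p) x * polyFun (curlOp 0 q) x
    + polyFun (curlOp 1 p) x * polyFun (curlOp 1 q) x
    + polyFun (curlOp 2 p) x * polyFun (curlOp 2 q) x) * hx
    - ((x : E3) 0 * polyFun (curlOp 0 q) x
    + (x : E3) 1 * polyFun (curlOp 1 q) x + (x : E3) 2 * polyFun (curlOp 2 q) x) * h

/-- The normal part of ∇q drops out because x × ∇p is tangential, and (x × ∇) · ∇q = 0 turns the
rest into a divergence. It therefore integrates to zero, which is the orthogonality of the two types
of harmonics. -/
theorem inner_surfCurl_surfGrad (p q : Poly) (x : S2) :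
    inner ℝ (surfCurl (polyFun p) x) (surfGrad (polyFun q) x)
      = ∑ i, polyFun (curlOp i (p * pderiv i q)) x := by
  have h := sum_mul_curlOp p x
  have h2 : ∑ i, curlOp i (pderiv i q) = 0 := by
    simp only [Fin.sum_univ_three, curlOp_apply]
    simp
    rw [pderiv_comm 1 0 q, pderiv_comm 2 0 q, pderiv_comm 2 1 q]
    ring
  simp only [curlOp_mul, polyFun_add, polyFun_mul, Finset.sum_add_distrib, ← Finset.mul_sum]
  rw [← polyFun_sum, h2, polyFun_zero, mul_zero, zero_add]
  simp only [inner_E3, surfGrad_polyFun', surfCurl_polyFun, mul_sub, Finset.sum_sub_distrib]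
  have e : ∀ i, polyFun (curlOp i p) x * ((x : E3) i * ∑ j, (x : E3) j * polyFun (pderiv j q) x)
      = (∑ j, (x : E3) j * polyFun (pderiv j q) x) * ((x : E3) i * polyFun (curlOp i p) x) :=
    fun i => by ring
  simp only [e, ← Finset.mul_sum, h, mul_zero, sub_zero]
  exact Finset.sum_congr rfl fun i _ => mul_comm _ _

theorem integral_inner_surfCurl_surfGrad (p q : Poly) :
    ∫ x : S2, inner ℝ (surfCurl (polyFun p) x) (surfGrad (polyFun q) x) ∂surf = 0 := by
  simp only [inner_surfCurl_surfGrad]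
  rw [integral_finsetSum _ fun i _ => integrable_surf (by fun_prop)]
  exact Finset.sum_eq_zero fun i _ => integral_curlOp i _

theorem integral_inner_surfCurl_surfCurl (p : Poly) {q : Poly} {ℓ : ℕ}
    (hq : q ∈ solidHarmonics ℓ) :
    ∫ x : S2, inner ℝ (surfCurl (polyFun p) x) (surfCurl (polyFun q) x) ∂surf
      = lam ℓ * ∫ x : S2, polyFun p x * polyFun q x ∂surf := by
  have h := integral_mul_sphLap p q
  simp only [inner_E3, surfCurl_polyFun]
  rw [← neg_eq_iff_eq_neg] at h
  rw [← h, ← integral_const_mul, ← integral_neg, sphLap_harmonic hq]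
  refine integral_congr_ae (Filter.Eventually.of_forall fun x => ?_)
  simp [lam]
  ring

section Orthonormal

variable {Y : ∀ ℓ : ℕ, Fin (2 * ℓ + 1) → MvPolynomial (Fin 3) ℝ} (hY : IsHarmonicBasis Y)

theorem inv_sqrt_mul_lam (n : ℕ) :
    (Real.sqrt (lam (n + 1)))⁻¹ * ((Real.sqrt (lam (n + 1)))⁻¹ * lam (n + 1)) = 1 := by
  rw [← mul_assoc, ← mul_inv, Real.mul_self_sqrt (lam_nonneg _),
    inv_mul_cancel₀ (lam_succ_pos n).ne']

include hY in
theorem integral_inner_div_div (m n : ℕ) (k : Fin (2 * (m + 1) + 1)) (k' : Fin (2 * (n + 1) + 1)) :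
    ∫ x : S2, inner ℝ (divHarmonic (m + 1) (Y (m + 1) k) x) (divHarmonic (n + 1) (Y (n + 1) k') x)
      ∂surf = (Real.sqrt (lam (m + 1)))⁻¹ * ((Real.sqrt (lam (n + 1)))⁻¹ * (lam (n + 1)
        * ∫ x : S2, polyFun (Y (m + 1) k) x * polyFun (Y (n + 1) k') x ∂surf)) := by
  simp only [divHarmonic, real_inner_smul_left, real_inner_smul_right]
  rw [integral_const_mul, integral_const_mul,
    integral_inner_surfCurl_surfCurl _ (harmonicBasis_mem hY _ _)]
  ring

theorem inner_curl_curl (m n : ℕ) (p q : Poly) (x : S2) :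
    inner ℝ (curlHarmonic m p x) (curlHarmonic n q x)
      = inner ℝ (divHarmonic m p x) (divHarmonic n q x) := by
  simp only [divHarmonic, curlHarmonic, real_inner_smul_left, real_inner_smul_right,
    inner_surfGrad_surfGrad]

theorem integral_inner_div_curl (m n : ℕ) (p q : Poly) :
    ∫ x : S2, inner ℝ (divHarmonic m p x) (curlHarmonic n q x) ∂surf = 0 := by
  simp only [divHarmonic, curlHarmonic, real_inner_smul_left, real_inner_smul_right]
  rw [integral_const_mul, integral_const_mul, integral_inner_surfCurl_surfGrad, mul_zero, mul_zero]

include hY in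
theorem integral_inner_vecHarmonic_of_ne {m n : ℕ} (h : m ≠ n) (κ : VIdx m) (κ' : VIdx n) :
    ∫ x : S2, inner ℝ (vecHarmonic Y m κ x) (vecHarmonic Y n κ' x) ∂surf = 0 := by
  have h0 : ∀ k k', ∫ x : S2, polyFun (Y (m + 1) k) x * polyFun (Y (n + 1) k') x ∂surf = 0 :=
    fun k k' => integral_harmonic_mul_harmonic (harmonicBasis_mem hY _ k)
      (harmonicBasis_mem hY _ k') (by omega)
  rcases κ with k | k <;> rcases κ' with k' | k' <;>
    simp only [vecHarmonic, Sum.elim_inl, Sum.elim_inr, inner_curl_curl]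
  · rw [integral_inner_div_div hY, h0]; simp
  · exact integral_inner_div_curl _ _ _ _
  · simp only [real_inner_comm (divHarmonic _ _ _)]
    exact integral_inner_div_curl _ _ _ _
  · rw [integral_inner_div_div hY, h0]; simp

include hY in
theorem integral_inner_vecHarmonic (n : ℕ) (κ κ' : VIdx n) :
    ∫ x : S2, inner ℝ (vecHarmonic Y n κ x) (vecHarmonic Y n κ' x) ∂surf
      = if κ = κ' then 1 else 0 := by
  have hl := inv_sqrt_mul_lam n
  rcases κ with k | k <;> rcases κ' with k' | k' <;>
    simp only [vecHarmonic, Sum.elim_inl, Sum.elim_inr, inner_curl_curl, Sum.inl.injEq,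
      Sum.inr.injEq, reduceCtorEq, if_false]
  · rw [integral_inner_div_div hY, hY.orthonormal]
    split_ifs <;> simp [hl]
  · exact integral_inner_div_curl _ _ _ _
  · simp only [real_inner_comm (divHarmonic _ _ _)]
    exact integral_inner_div_curl _ _ _ _
  · rw [integral_inner_div_div hY, hY.orthonormal]
    split_ifs <;> simp [hl]

/-! ### Vector spherical harmonics as polynomials -/

include hY in
-- The bound n + 2 comes from the curl-free harmonics, whose components multiply `curlOp` of a
-- polynomial of degree n + 1 by a coordinate. It feeds the degree count for products.
theorem exists_vecHarmonic_eq_polyFun (n : ℕ) (κ : VIdx n) :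
    ∃ p : Fin 3 → Poly, (∀ i, (p i).totalDegree ≤ n + 2) ∧
      ∀ x i, vecHarmonic Y n κ x i = polyFun (p i) x := by
  have hL : ∀ (i : Fin 3) k, (curlOp i (Y (n + 1) k)).totalDegree ≤ n + 1 := by
    intro i k
    have h1 : ∀ a b : Fin 3, (MvPolynomial.X a * pderiv b (Y (n + 1) k)).IsHomogeneous (n + 1) := by
      intro a b
      have h := (MvPolynomial.isHomogeneous_X ℝ a).mul
        ((show (Y (n + 1) k).IsHomogeneous (n + 1) from (harmonicBasis_mem hY _ k).1).pderiv (i := b))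
      rwa [show 1 + (n + 1 - 1) = n + 1 by omega] at h
    rw [curlOp_apply]
    exact ((h1 _ _).sub (h1 _ _)).totalDegree_le
  rcases κ with k | k
  · refine ⟨fun i => (Real.sqrt (lam (n + 1)))⁻¹ • curlOp i (Y (n + 1) k), fun i => ?_,
      fun x i => ?_⟩
    · exact (MvPolynomial.totalDegree_smul_le _ _).trans ((hL i k).trans (by omega))
    · simp [vecHarmonic, divHarmonic_apply]
  · refine ⟨fun i => (Real.sqrt (lam (n + 1)))⁻¹ • (MvPolynomial.X (i + 2)
      * curlOp (i + 1) (Y (n + 1) k) - MvPolynomial.X (i + 1) * curlOp (i + 2) (Y (n + 1) k)),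
      fun i => ?_, fun x i => ?_⟩
    · have h1 : ∀ a b : Fin 3, (MvPolynomial.X a * curlOp b (Y (n + 1) k)).totalDegree ≤ n + 2 := by
        intro a b
        refine (MvPolynomial.totalDegree_mul _ _).trans ?_
        rw [MvPolynomial.totalDegree_X]
        have := hL b k
        omega
      exact (MvPolynomial.totalDegree_smul_le _ _).trans
        ((MvPolynomial.totalDegree_sub _ _).trans (max_le (h1 _ _) (h1 _ _)))
    · simp [vecHarmonic, curlHarmonic_apply, surfGrad_polyFun]

include hY in
theorem continuous_vecHarmonic (n : ℕ) (κ : VIdx n) : Continuous (vecHarmonic Y n κ) := by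
  obtain ⟨p, -, hp⟩ := exists_vecHarmonic_eq_polyFun hY n κ
  have e : vecHarmonic Y n κ = fun x : S2 => WithLp.toLp 2 fun i => polyFun (p i) x := by
    funext x
    ext i
    exact hp x i
  rw [e]
  fun_prop

theorem inner_vecHarmonic_self_eq_zero (n : ℕ) (κ : VIdx n) (x : S2) :
    inner ℝ (x : E3) (vecHarmonic Y n κ x) = 0 := by
  rw [inner_E3]
  rcases κ with k | k
  · simp only [vecHarmonic, Sum.elim_inl, divHarmonic_apply, mul_left_comm _ (Real.sqrt _)⁻¹,
      ← Finset.mul_sum, sum_mul_curlOp, mul_zero]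
  · simp [vecHarmonic, curlHarmonic_apply, surfGrad_polyFun, Fin.sum_univ_three]
    ring

include hY in
theorem integral_polyFun_mul_inner_vecHarmonic {m n : ℕ} (κ : VIdx m) (κ' : VIdx n) {ℓ : ℕ}
    (hℓ : m + n + 4 < ℓ) (k : Fin (2 * ℓ + 1)) :
    ∫ x : S2, inner ℝ (vecHarmonic Y m κ x) (vecHarmonic Y n κ' x) * polyFun (Y ℓ k) x ∂surf
      = 0 := by
  obtain ⟨p, hp, hp'⟩ := exists_vecHarmonic_eq_polyFun hY m κ
  obtain ⟨q, hq, hq'⟩ := exists_vecHarmonic_eq_polyFun hY n κ'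
  have e : ∀ x : S2, inner ℝ (vecHarmonic Y m κ x) (vecHarmonic Y n κ' x) * polyFun (Y ℓ k) x
      = polyFun (Y ℓ k) x * polyFun (∑ i, p i * q i) x := by
    intro x
    rw [inner_E3, polyFun_sum, mul_comm]
    simp only [hp', hq', polyFun_mul]
  simp only [e]
  refine integral_harmonic_mul_of_totalDegree_lt (harmonicBasis_mem hY ℓ k)
    (lt_of_le_of_lt (MvPolynomial.totalDegree_finsetSum_le fun i _ =>
      (MvPolynomial.totalDegree_mul _ _).trans (add_le_add (hp i) (hq i))) (by omega))

/-! ### Completeness of the vector spherical harmonics -/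

/-- For d ≥ 1 this exhibits the tangential part of the field p eᵢ as a combination of surface curls
and gradients of polynomials. Scalar completeness can then be used componentwise. -/
theorem mul_surfGrad_X_eq {p : Poly} {d : ℕ} (hp : p ∈ solidHarmonics d) (x : S2) (i j : Fin 3) :
    surfCurl (polyFun (curlOp i p)) x j + surfGrad (polyFun (pderiv i p)) x j
      - d * surfGrad (polyFun (MvPolynomial.X i * p)) x j
      = -((d : ℝ) * (d + 1)) * (polyFun p x * ((if i = j then 1 else 0) - (x : E3) i * (x : E3) j))
      := by
  have hx := sphere_sq x
  have h := congrArg (fun p => polyFun p x) (euler hp.1)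
  have h0 := congrArg (fun p => polyFun p x) (euler_pderiv hp.1 0)
  have h1 := congrArg (fun p => polyFun p x) (euler_pderiv hp.1 1)
  have h2 := congrArg (fun p => polyFun p x) (euler_pderiv hp.1 2)
  have hS := congrArg (fun p => polyFun p x) ((laplacian_apply p).symm.trans (LinearMap.mem_ker.1 hp.2))
  rw [Fin.sum_univ_three] at h h0 h1 h2 hS
  simp only [surfCurl_polyFun, surfGrad_polyFun', curlOp_apply, Fin.sum_univ_three, map_sub,
    Derivation.leibniz, MvPolynomial.pderiv_X, smul_eq_mul]
  have c10 := pderiv_comm 1 0 p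
  have c20 := pderiv_comm 2 0 p
  have c21 := pderiv_comm 2 1 p
  simp [c10, c20, c21] at h h0 h1 h2 hS
  fin_cases i <;> fin_cases j <;> simp [c10, c20, c21]
  · linear_combination (x : E3) 0 * h0 - polyFun (pderiv 0 (pderiv 0 p)) x * hx + (d : ℝ) * (x : E3) 0 * (x : E3) 0 * h
      - d * h - (x : E3) 0 * h0 - (x : E3) 1 * h1 - (x : E3) 2 * h2
      + ((x : E3) 1 ^ 2 + (x : E3) 2 ^ 2) * hS
  · linear_combination (x : E3) 0 * h1 - polyFun (pderiv 0 (pderiv 1 p)) x * hx + (d : ℝ) * (x : E3) 0 * (x : E3) 1 * h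
      - (x : E3) 0 * (x : E3) 1 * hS
  · linear_combination (x : E3) 0 * h2 - polyFun (pderiv 0 (pderiv 2 p)) x * hx + (d : ℝ) * (x : E3) 0 * (x : E3) 2 * h
      - (x : E3) 0 * (x : E3) 2 * hS
  · linear_combination (x : E3) 1 * h0 - polyFun (pderiv 0 (pderiv 1 p)) x * hx + (d : ℝ) * (x : E3) 1 * (x : E3) 0 * h
      - (x : E3) 1 * (x : E3) 0 * hS
  · linear_combination (x : E3) 1 * h1 - polyFun (pderiv 1 (pderiv 1 p)) x * hx + (d : ℝ) * (x : E3) 1 * (x : E3) 1 * h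
      - d * h - (x : E3) 0 * h0 - (x : E3) 1 * h1 - (x : E3) 2 * h2
      + ((x : E3) 0 ^ 2 + (x : E3) 2 ^ 2) * hS
  · linear_combination (x : E3) 1 * h2 - polyFun (pderiv 1 (pderiv 2 p)) x * hx + (d : ℝ) * (x : E3) 1 * (x : E3) 2 * h
      - (x : E3) 1 * (x : E3) 2 * hS
  · linear_combination (x : E3) 2 * h0 - polyFun (pderiv 0 (pderiv 2 p)) x * hx + (d : ℝ) * (x : E3) 2 * (x : E3) 0 * h
      - (x : E3) 2 * (x : E3) 0 * hS
  · linear_combination (x : E3) 2 * h1 - polyFun (pderiv 1 (pderiv 2 p)) x * hx + (d : ℝ) * (x : E3) 2 * (x : E3) 1 * h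
      - (x : E3) 2 * (x : E3) 1 * hS
  · linear_combination (x : E3) 2 * h2 - polyFun (pderiv 2 (pderiv 2 p)) x * hx + (d : ℝ) * (x : E3) 2 * (x : E3) 2 * h
      - d * h - (x : E3) 0 * h0 - (x : E3) 1 * h1 - (x : E3) 2 * h2
      + ((x : E3) 0 ^ 2 + (x : E3) 1 ^ 2) * hS

theorem surfCurl_polyFun_sum {ι : Type*} (s : Finset ι) (a : ι → ℝ) (p : ι → Poly) (x : S2) :
    surfCurl (polyFun (∑ k ∈ s, a k • p k)) x = ∑ k ∈ s, a k • surfCurl (polyFun (p k)) x := by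
  ext i
  simp [surfCurl_polyFun]

theorem surfGrad_polyFun_sum {ι : Type*} (s : Finset ι) (a : ι → ℝ) (p : ι → Poly) (x : S2) :
    surfGrad (polyFun (∑ k ∈ s, a k • p k)) x = ∑ k ∈ s, a k • surfGrad (polyFun (p k)) x := by
  ext i
  simp only [surfGrad_polyFun, map_sum, Derivation.map_smul, polyFun_sum, polyFun_smul,
    Finset.mul_sum, WithLp.ofLp_sum, WithLp.ofLp_smul, Finset.sum_apply, Pi.smul_apply, smul_eq_mul,
    ← Finset.sum_sub_distrib]
  exact Finset.sum_congr rfl fun k _ => by ring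

theorem surfCurl_polyFun_add (p q : Poly) (x : S2) :
    surfCurl (polyFun (p + q)) x = surfCurl (polyFun p) x + surfCurl (polyFun q) x := by
  ext i
  simp [surfCurl_polyFun]

theorem surfGrad_polyFun_add (p q : Poly) (x : S2) :
    surfGrad (polyFun (p + q)) x = surfGrad (polyFun p) x + surfGrad (polyFun q) x := by
  ext i
  simp [surfGrad_polyFun]
  ring

theorem surfCurl_normSqPoly_mul (q : Poly) (x : S2) :
    surfCurl (polyFun (normSqPoly * q)) x = surfCurl (polyFun q) x := by
  ext i
  simp [surfCurl_polyFun, curlOp_normSqPoly, polyFun_normSqPoly]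

theorem surfGrad_normSqPoly_mul (q : Poly) (x : S2) :
    surfGrad (polyFun (normSqPoly * q)) x = surfGrad (polyFun q) x := by
  ext i
  simp [surfGrad_polyFun, curlOp_normSqPoly, polyFun_normSqPoly]

@[fun_prop]
theorem continuous_surfCurl (p : Poly) : Continuous (surfCurl (polyFun p)) := by
  have e : surfCurl (polyFun p) = fun x : S2 => WithLp.toLp 2 fun i => polyFun (curlOp i p) x := by
    funext x
    ext i
    exact surfCurl_polyFun p x i
  rw [e]
  fun_prop

@[fun_prop]
theorem continuous_surfGrad (p : Poly) : Continuous (surfGrad (polyFun p)) := by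
  have e : surfGrad (polyFun p) = fun x : S2 => WithLp.toLp 2 fun i : Fin 3 =>
      (x : E3) (i + 2) * polyFun (curlOp (i + 1) p) x
      - (x : E3) (i + 1) * polyFun (curlOp (i + 2) p) x := by
    funext x
    ext i
    exact surfGrad_polyFun p x i
  rw [e]
  fun_prop

/-- Fourier coefficients with respect to the vector spherical harmonics. -/
def vecCoeff (Y : ∀ ℓ : ℕ, Fin (2 * ℓ + 1) → MvPolynomial (Fin 3) ℝ) (f : S2 → E3) (n : ℕ)
    (κ : VIdx n) : ℝ :=
  ∫ x, inner ℝ (f x) (vecHarmonic Y n κ x) ∂surf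

include hY in
-- Orthogonality to the basis passes to all polynomials by `harmonic_induction`: constants have zero
-- curl and gradient, and multiplication by |x|² changes neither field on the sphere.
theorem integral_inner_surf_eq_zero {f : S2 → E3} (hf : Continuous f)
    (h : ∀ n κ, vecCoeff Y f n κ = 0) (p : Poly) :
    ∫ x, inner ℝ (f x) (surfCurl (polyFun p) x) ∂surf = 0 ∧
      ∫ x, inner ℝ (f x) (surfGrad (polyFun p) x) ∂surf = 0 := by
  induction p using harmonic_induction with
  | harm ℓ p hp =>
    cases ℓ with
    | zero =>
      have h1 : p.IsHomogeneous 0 := hp.1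
      rw [← MvPolynomial.totalDegree_zero_iff_isHomogeneous,
        MvPolynomial.totalDegree_eq_zero_iff_eq_C] at h1
      have hc : ∀ i, curlOp i p = 0 := by
        intro i
        rw [h1, curlOp_apply, MvPolynomial.pderiv_C, MvPolynomial.pderiv_C, mul_zero, mul_zero,
          sub_zero]
      have h2 : ∀ x : S2, surfCurl (polyFun p) x = 0 := by
        intro x
        ext i
        simp [surfCurl_polyFun, hc]
      have h3 : ∀ x : S2, surfGrad (polyFun p) x = 0 := by
        intro x
        ext i
        simp [surfGrad_polyFun, hc]
      simp [h2, h3]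
    | succ n =>
      obtain ⟨a, rfl⟩ := exists_eq_sum_harmonicBasis hY hp
      have hs : Real.sqrt (lam (n + 1)) ≠ 0 := (Real.sqrt_pos.2 (lam_succ_pos n)).ne'
      have hl : ∀ k, ∫ x, inner ℝ (f x) (surfCurl (polyFun (Y (n + 1) k)) x) ∂surf = 0 := by
        intro k
        have h1 := h n (Sum.inl k)
        simp only [vecCoeff, vecHarmonic, Sum.elim_inl, divHarmonic, real_inner_smul_right] at h1
        rw [integral_const_mul] at h1
        exact (mul_eq_zero.1 h1).resolve_left (inv_ne_zero hs)
      have hr : ∀ k, ∫ x, inner ℝ (f x) (surfGrad (polyFun (Y (n + 1) k)) x) ∂surf = 0 := by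
        intro k
        have h1 := h n (Sum.inr k)
        simp only [vecCoeff, vecHarmonic, Sum.elim_inr, curlHarmonic, real_inner_smul_right] at h1
        rw [integral_const_mul] at h1
        exact (mul_eq_zero.1 h1).resolve_left (inv_ne_zero hs)
      simp only [surfCurl_polyFun_sum, surfGrad_polyFun_sum, inner_sum, real_inner_smul_right]
      rw [integral_finsetSum _ fun k _ => integrable_surf (by fun_prop),
        integral_finsetSum _ fun k _ => integrable_surf (by fun_prop)]
      simp [integral_const_mul, hl, hr]
  | add p q hp hq =>
    simp only [surfCurl_polyFun_add, surfGrad_polyFun_add, inner_add_right]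
    rw [integral_add (integrable_surf (by fun_prop)) (integrable_surf (by fun_prop)),
      integral_add (integrable_surf (by fun_prop)) (integrable_surf (by fun_prop)),
      hp.1, hp.2, hq.1, hq.2]
    simp
  | normSq q hq =>
    simpa only [surfCurl_normSqPoly_mul, surfGrad_normSqPoly_mul] using hq

include hY in
/-- Completeness of the vector spherical harmonics among tangential fields. -/
theorem eq_zero_of_vecCoeff_eq_zero {f : S2 → E3} (hf : Continuous f)
    (ht : ∀ x : S2, inner ℝ (x : E3) (f x) = 0) (h : ∀ n κ, vecCoeff Y f n κ = 0) (x : S2) :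
    f x = 0 := by
  have hZ := integral_inner_surf_eq_zero hY hf h
  have hfi : ∀ i, Continuous fun x => f x i := fun i => by fun_prop
  ext i
  refine eq_zero_of_integral_mul_harmonic (hfi i) (fun ℓ p hp => ?_) x
  -- Since f is tangential, pairing it with the tangential part of p eᵢ returns the component f_i
  -- times p.
  have key : ∀ x : S2, inner ℝ (f x) (surfCurl (polyFun (curlOp i p)) x)
      + inner ℝ (f x) (surfGrad (polyFun (pderiv i p)) x)
      - ℓ * inner ℝ (f x) (surfGrad (polyFun (MvPolynomial.X i * p)) x)
      = -((ℓ : ℝ) * (ℓ + 1)) * (f x i * polyFun p x) := by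
    intro x
    have h1 := ht x
    have hS := fun j => mul_surfGrad_X_eq hp x i j
    rw [inner_E3, Fin.sum_univ_three] at h1
    simp only [inner_E3, Fin.sum_univ_three]
    have e : (f x) 0 * (if i = 0 then (1 : ℝ) else 0) + (f x) 1 * (if i = 1 then (1 : ℝ) else 0)
        + (f x) 2 * (if i = 2 then (1 : ℝ) else 0) = f x i := by
      fin_cases i <;> simp
    linear_combination (f x) 0 * hS 0 + (f x) 1 * hS 1 + (f x) 2 * hS 2
      - (ℓ : ℝ) * (ℓ + 1) * polyFun p x * (e - (x : E3) i * h1)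
  cases ℓ with
  | zero =>
    have h1 : p.IsHomogeneous 0 := hp.1
    rw [← MvPolynomial.totalDegree_zero_iff_isHomogeneous,
      MvPolynomial.totalDegree_eq_zero_iff_eq_C] at h1
    -- For ℓ = 0 the factor ℓ(ℓ + 1) is lost, but for constant p the surface gradient of xᵢ p is
    -- itself the tangential part of p eᵢ.
    have h2 := (hZ (MvPolynomial.X i * p)).2
    rw [h1] at h2 ⊢
    rw [← h2]
    refine integral_congr_ae (Filter.Eventually.of_forall fun x => ?_)
    have h3 := ht x
    rw [inner_E3, Fin.sum_univ_three] at h3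
    simp only [inner_E3, Fin.sum_univ_three, surfGrad_polyFun', Derivation.leibniz,
      MvPolynomial.pderiv_X, MvPolynomial.pderiv_C, smul_eq_mul]
    fin_cases i <;> simp
    · linear_combination (MvPolynomial.coeff 0 p) * (x : E3) 0 * h3
    · linear_combination (MvPolynomial.coeff 0 p) * (x : E3) 1 * h3
    · linear_combination (MvPolynomial.coeff 0 p) * (x : E3) 2 * h3
  | succ n =>
    have h1 : ∫ x, -(((n + 1 : ℕ) : ℝ) * ((n + 1 : ℕ) + 1)) * (f x i * polyFun p x) ∂surf = 0 := by
      simp only [← key]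
      rw [integral_sub (integrable_surf (by fun_prop)) (integrable_surf (by fun_prop)),
        integral_add (integrable_surf (by fun_prop)) (integrable_surf (by fun_prop)),
        integral_const_mul, (hZ _).1, (hZ _).2, (hZ _).2]
      simp
    rw [integral_const_mul] at h1
    refine (mul_eq_zero.1 h1).resolve_left ?_
    have : (0 : ℝ) < ((n + 1 : ℕ) : ℝ) * ((n + 1 : ℕ) + 1) := by positivity
    linarith

end Orthonormal

/-! ### Series of vector spherical harmonics -/

/-- If fields with square integrals at most `B` converge pointwise, then the square integral of the
limit is at most `B`. -/
theorem integral_norm_sq_le_of_tendsto {g : S2 → E3} {G : ℕ → S2 → E3} (hg : Continuous g)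
    (hG : ∀ M, Continuous (G M)) {B : ℝ} (hB : ∀ M, ∫ x, ‖G M x‖ ^ 2 ∂surf ≤ B)
    (h : ∀ x, Filter.Tendsto (fun M => G M x) Filter.atTop (nhds (g x))) :
    ∫ x, ‖g x‖ ^ 2 ∂surf ≤ B := by
  have hB0 : 0 ≤ B := (integral_nonneg fun x => sq_nonneg _).trans (hB 0)
  rw [← ENNReal.ofReal_le_ofReal_iff hB0,
    ofReal_integral_eq_lintegral_ofReal (integrable_surf (by fun_prop))
      (Filter.Eventually.of_forall fun x => sq_nonneg _)]
  -- Fatou's lemma: no dominating function is required.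
  have h1 : ∀ x, ENNReal.ofReal (‖g x‖ ^ 2)
      = Filter.liminf (fun M => ENNReal.ofReal (‖G M x‖ ^ 2)) Filter.atTop := fun x =>
    (Filter.Tendsto.liminf_eq (ENNReal.tendsto_ofReal ((h x).norm.pow 2))).symm
  simp only [h1]
  have hm : ∀ M, Measurable fun x => ENNReal.ofReal (‖G M x‖ ^ 2) := fun M =>
    (ENNReal.continuous_ofReal.comp ((hG M).norm.pow 2)).measurable
  refine (lintegral_liminf_le hm).trans ?_
  refine Filter.liminf_le_of_le (by isBoundedDefault) fun b hb => ?_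
  obtain ⟨M, hM⟩ := hb.exists
  refine hM.trans ?_
  rw [← ofReal_integral_eq_lintegral_ofReal (integrable_surf (by fun_prop))
      (Filter.Eventually.of_forall fun x => sq_nonneg _)]
  exact ENNReal.ofReal_le_ofReal (hB M)

/-- The weight of degree `n + 1` in the Sobolev norm. -/
def sobWeight (σ : ℝ) (n : ℕ) : ℝ := (1 + lam (n + 1)) ^ σ

theorem one_add_lam_pos (ℓ : ℕ) : 0 < 1 + lam ℓ := by have := lam_nonneg ℓ; linarith

theorem sobWeight_pos (σ : ℝ) (n : ℕ) : 0 < sobWeight σ n := Real.rpow_pos_of_pos (one_add_lam_pos _) _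

theorem one_le_sobWeight {σ : ℝ} (hσ : 0 ≤ σ) (n : ℕ) : 1 ≤ sobWeight σ n :=
  Real.one_le_rpow (by have := lam_nonneg (n + 1); linarith) hσ

theorem rpow_le_sobWeight {σ : ℝ} (hσ : 0 ≤ σ) (n : ℕ) :
    ((n : ℝ) + 1) ^ (2 * σ) ≤ sobWeight σ n := by
  rw [Real.rpow_mul (by positivity), sobWeight]
  refine Real.rpow_le_rpow (by positivity) ?_ hσ
  rw [lam, Real.rpow_two]
  push_cast
  nlinarith [(Nat.cast_nonneg n : (0 : ℝ) ≤ n)]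

/-- The quotient `2 (2 ℓ + 1) / (4 π) (1 + λ_ℓ) ^ (-σ)` for `ℓ = n + 1`, whose sum is the constant
in the Sobolev embedding. -/
def embTerm (σ : ℝ) (n : ℕ) : ℝ := 2 * dens (n + 1) / sobWeight σ n

theorem embTerm_nonneg (σ : ℝ) (n : ℕ) : 0 ≤ embTerm σ n :=
  div_nonneg (mul_nonneg zero_le_two (dens_pos _).le) (sobWeight_pos σ n).le

/-- The terms are of size n^(1 − 2σ), which is where σ > 1 enters. -/
theorem summable_embTerm {σ : ℝ} (hσ : 1 < σ) : Summable (embTerm σ) := by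
  have h1 : Summable fun n : ℕ => (((n + 1 : ℕ) : ℝ)) ^ (1 - 2 * σ) :=
    (summable_nat_add_iff 1).2 (Real.summable_nat_rpow.2 (by linarith))
  refine Summable.of_nonneg_of_le (embTerm_nonneg σ) (fun n => ?_) (h1.mul_left 3)
  have hn : (0 : ℝ) < (n : ℝ) + 1 := by positivity
  rw [embTerm, div_le_iff₀ (sobWeight_pos σ n)]
  have h2 : 2 * dens (n + 1) ≤ 3 * ((n : ℝ) + 1) := by
    have hpi := Real.pi_gt_three
    rw [dens, ← mul_div_assoc, div_le_iff₀ (by positivity)]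
    push_cast
    nlinarith [(Nat.cast_nonneg n : (0 : ℝ) ≤ n)]
  have h3 : (((n + 1 : ℕ) : ℝ)) ^ (1 - 2 * σ) * ((n : ℝ) + 1) ^ (2 * σ) = (n : ℝ) + 1 := by
    push_cast
    rw [← Real.rpow_add hn, sub_add_cancel, Real.rpow_one]
  calc 2 * dens (n + 1) ≤ 3 * ((n : ℝ) + 1) := h2
    _ = 3 * ((((n + 1 : ℕ) : ℝ)) ^ (1 - 2 * σ) * ((n : ℝ) + 1) ^ (2 * σ)) := by rw [h3]
    _ ≤ 3 * ((((n + 1 : ℕ) : ℝ)) ^ (1 - 2 * σ) * sobWeight σ n) := by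
        gcongr
        exact rpow_le_sobWeight (by linarith) n
    _ = _ := by ring

/-- The weighted square sum of coefficients of degree `n + 1`. -/
def sobTerm (σ : ℝ) (c : ∀ n, VIdx n → ℝ) (n : ℕ) : ℝ := sobWeight σ n * ∑ κ, c n κ ^ 2

theorem sobTerm_nonneg (σ : ℝ) (c : ∀ n, VIdx n → ℝ) (n : ℕ) : 0 ≤ sobTerm σ c n :=
  mul_nonneg (sobWeight_pos σ n).le (Finset.sum_nonneg fun _ _ => sq_nonneg _)

section Series

variable (Y : ∀ ℓ : ℕ, Fin (2 * ℓ + 1) → MvPolynomial (Fin 3) ℝ)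

/-- The part of degree `n + 1` of a series of vector spherical harmonics. -/
def vecBlock (c : ∀ n, VIdx n → ℝ) (n : ℕ) (x : S2) : E3 := ∑ κ, c n κ • vecHarmonic Y n κ x

/-- Partial sums of a series of vector spherical harmonics. -/
def vecSum (c : ∀ n, VIdx n → ℝ) (L : ℕ) (x : S2) : E3 := ∑ n ∈ Finset.range L, vecBlock Y c n x

variable {Y} (hY : IsHarmonicBasis Y)

include hY in
theorem continuous_vecBlock (c : ∀ n, VIdx n → ℝ) (n : ℕ) : Continuous (vecBlock Y c n) := by
  have := continuous_vecHarmonic hY n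
  unfold vecBlock
  fun_prop

include hY in
theorem continuous_vecSum (c : ∀ n, VIdx n → ℝ) (L : ℕ) : Continuous (vecSum Y c L) := by
  have := continuous_vecBlock hY c
  unfold vecSum
  fun_prop

theorem inner_self_vecBlock (c : ∀ n, VIdx n → ℝ) (n : ℕ) (x : S2) :
    inner ℝ (x : E3) (vecBlock Y c n x) = 0 := by
  rw [vecBlock, inner_sum]
  simp [real_inner_smul_right, inner_vecHarmonic_self_eq_zero]

theorem inner_self_vecSum (c : ∀ n, VIdx n → ℝ) (L : ℕ) (x : S2) :
    inner ℝ (x : E3) (vecSum Y c L x) = 0 := by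
  simp [vecSum, inner_sum, inner_self_vecBlock]

include hY in
theorem integral_inner_vecBlock (c : ∀ n, VIdx n → ℝ) (m n : ℕ) (κ : VIdx n) :
    ∫ x, inner ℝ (vecBlock Y c m x) (vecHarmonic Y n κ x) ∂surf = if m = n then c n κ else 0 := by
  have h1 := continuous_vecHarmonic hY m
  have h2 := continuous_vecHarmonic hY n
  simp only [vecBlock, sum_inner, real_inner_smul_left]
  rw [integral_finsetSum _ fun κ' _ => integrable_surf (by fun_prop)]
  simp only [integral_const_mul]
  split_ifs with h
  · subst h
    simp [integral_inner_vecHarmonic hY]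
  · simp [integral_inner_vecHarmonic_of_ne hY h]

include hY in
theorem vecCoeff_vecSum (c : ∀ n, VIdx n → ℝ) (L n : ℕ) (κ : VIdx n) :
    vecCoeff Y (vecSum Y c L) n κ = if n < L then c n κ else 0 := by
  have h1 := continuous_vecBlock hY c
  have h2 := continuous_vecHarmonic hY n
  simp only [vecCoeff, vecSum, sum_inner]
  rw [integral_finsetSum _ fun κ' _ => integrable_surf (by fun_prop)]
  simp [integral_inner_vecBlock hY]

include hY in
theorem integral_inner_vecSum {f : S2 → E3} (hf : Continuous f) (c : ∀ n, VIdx n → ℝ) (L : ℕ) :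
    ∫ x, inner ℝ (f x) (vecSum Y c L x) ∂surf
      = ∑ n ∈ Finset.range L, ∑ κ, c n κ * vecCoeff Y f n κ := by
  have h1 := continuous_vecHarmonic hY
  simp only [vecSum, vecBlock, inner_sum, real_inner_smul_right]
  rw [integral_finsetSum _ fun n _ => integrable_surf (by fun_prop)]
  refine Finset.sum_congr rfl fun n _ => ?_
  rw [integral_finsetSum _ fun n _ => integrable_surf (by fun_prop)]
  simp only [integral_const_mul, vecCoeff]

include hY in
theorem integral_norm_sq_vecSum (c : ∀ n, VIdx n → ℝ) (L : ℕ) :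
    ∫ x, ‖vecSum Y c L x‖ ^ 2 ∂surf = ∑ n ∈ Finset.range L, ∑ κ, c n κ ^ 2 := by
  simp only [← real_inner_self_eq_norm_sq]
  rw [integral_inner_vecSum hY (continuous_vecSum hY c L)]
  refine Finset.sum_congr rfl fun n hn => Finset.sum_congr rfl fun κ _ => ?_
  rw [vecCoeff_vecSum hY, if_pos (Finset.mem_range.1 hn), sq]

include hY in
-- Cauchy–Schwarz, with the squares of the harmonics summed by the addition theorem.
theorem norm_sum_smul_vecHarmonic_sq_le (n : ℕ) (c : VIdx n → ℝ) (x : S2) :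
    ‖∑ κ, c κ • vecHarmonic Y n κ x‖ ^ 2 ≤ (∑ κ, c κ ^ 2) * (2 * dens (n + 1)) := by
  rw [← sum_norm_sq_vecHarmonic hY n x]
  have h1 : ‖∑ κ, c κ • vecHarmonic Y n κ x‖ ≤ ∑ κ, |c κ| * ‖vecHarmonic Y n κ x‖ := by
    refine (norm_sum_le _ _).trans (le_of_eq ?_)
    simp [norm_smul]
  refine (pow_le_pow_left₀ (norm_nonneg _) h1 2).trans
    ((Finset.sum_mul_sq_le_sq_mul_sq _ _ _).trans (le_of_eq ?_))
  simp only [sq_abs]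

include hY in
theorem norm_vecBlock_le (σ : ℝ) (c : ∀ n, VIdx n → ℝ) (n : ℕ) (x : S2) :
    ‖vecBlock Y c n x‖ ≤ Real.sqrt (sobTerm σ c n) * Real.sqrt (embTerm σ n) := by
  rw [← Real.sqrt_mul (sobTerm_nonneg σ c n)]
  refine Real.le_sqrt_of_sq_le ((norm_sum_smul_vecHarmonic_sq_le hY n (c n) x).trans (le_of_eq ?_))
  have := (sobWeight_pos σ n).ne'
  rw [sobTerm, embTerm]
  field_simp

theorem sqrt_mul_sqrt_le {a b : ℝ} (ha : 0 ≤ a) (hb : 0 ≤ b) :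
    Real.sqrt a * Real.sqrt b ≤ a + b := by
  nlinarith [Real.sq_sqrt ha, Real.sq_sqrt hb, sq_nonneg (Real.sqrt a - Real.sqrt b),
    Real.sqrt_nonneg a, Real.sqrt_nonneg b]

include hY in
theorem norm_vecBlock_le_add (σ : ℝ) (c : ∀ n, VIdx n → ℝ) (n : ℕ) (x : S2) :
    ‖vecBlock Y c n x‖ ≤ sobTerm σ c n + embTerm σ n :=
  (norm_vecBlock_le hY σ c n x).trans
    (sqrt_mul_sqrt_le (sobTerm_nonneg σ c n) (embTerm_nonneg σ n))

include hY in
/-- The Sobolev embedding, for partial sums. -/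
theorem norm_vecSum_sq_le {σ : ℝ} (hσ : 1 < σ) {c : ∀ n, VIdx n → ℝ}
    (hc : Summable (sobTerm σ c)) (L : ℕ) (x : S2) :
    ‖vecSum Y c L x‖ ^ 2 ≤ (∑' n, sobTerm σ c n) * ∑' n, embTerm σ n := by
  have h1 : ‖vecSum Y c L x‖
      ≤ ∑ n ∈ Finset.range L, Real.sqrt (sobTerm σ c n) * Real.sqrt (embTerm σ n) :=
    (norm_sum_le _ _).trans (Finset.sum_le_sum fun n _ => norm_vecBlock_le hY σ c n x)
  refine (pow_le_pow_left₀ (norm_nonneg _) h1 2).trans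
    ((Finset.sum_mul_sq_le_sq_mul_sq _ _ _).trans ?_)
  simp only [Real.sq_sqrt (sobTerm_nonneg σ c _), Real.sq_sqrt (embTerm_nonneg σ _)]
  exact mul_le_mul (hc.sum_le_tsum _ fun n _ => sobTerm_nonneg σ c n)
    ((summable_embTerm hσ).sum_le_tsum _ fun n _ => embTerm_nonneg σ n)
    (Finset.sum_nonneg fun n _ => embTerm_nonneg σ n) (tsum_nonneg fun n => sobTerm_nonneg σ c n)

theorem vecSobolevTerm_eq (σ : ℝ) (f : S2 → E3) (n : ℕ) :
    vecSobolevTerm Y σ f n = sobTerm σ (vecCoeff Y f) n := by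
  rw [vecSobolevTerm, sobTerm, Fintype.sum_sum_type, Finset.sum_add_distrib]
  rfl

theorem MemVecSobolev.summable_sobTerm {σ : ℝ} {f : S2 → E3} (hf : MemVecSobolev Y σ f) :
    Summable (sobTerm σ (vecCoeff Y f)) := by
  rw [← funext (vecSobolevTerm_eq (Y := Y) σ f)]
  exact hf.summable

theorem vecSobolevNorm_eq (σ : ℝ) (f : S2 → E3) :
    vecSobolevNorm Y σ f = Real.sqrt (∑' n, sobTerm σ (vecCoeff Y f) n) := by
  simp only [vecSobolevNorm, vecSobolevTerm_eq]

include hY in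
/-- A Sobolev field is the pointwise sum of its Fourier series. -/
theorem hasSum_vecBlock {σ : ℝ} (hσ : 1 < σ) {f : S2 → E3} (hf : MemVecSobolev Y σ f) (x : S2) :
    HasSum (fun n => vecBlock Y (vecCoeff Y f) n x) (f x) := by
  set c := vecCoeff Y f with hc
  have hm : Summable fun n => sobTerm σ c n + embTerm σ n :=
    hf.summable_sobTerm.add (summable_embTerm hσ)
  have hS : ∀ x, HasSum (fun n => vecBlock Y c n x) (∑' n, vecBlock Y c n x) := fun x =>
    (Summable.of_norm_bounded hm fun n => norm_vecBlock_le_add hY σ c n x).hasSum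
  have hcont : Continuous fun x => ∑' n, vecBlock Y c n x :=
    continuous_tsum (continuous_vecBlock hY c) hm fun n x => norm_vecBlock_le_add hY σ c n x
  have hfc := hf.continuous
  suffices h : f x - ∑' n, vecBlock Y c n x = 0 by
    rw [sub_eq_zero.1 h]
    exact hS x
  -- The series converges uniformly to a continuous tangential field with the coefficients of f, so
  -- completeness identifies the two.
  refine eq_zero_of_vecCoeff_eq_zero hY (f := fun x => f x - ∑' n, vecBlock Y c n x)
    (hfc.sub hcont) (fun x => ?_) (fun n κ => ?_) x
  · have h1 := (hS x).mapL (innerSL ℝ (x : E3))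
    simp only [innerSL_apply_apply, inner_self_vecBlock] at h1
    rw [inner_sub_right, hf.tangential, h1.unique hasSum_zero, sub_zero]
  · have hV := continuous_vecHarmonic hY n κ
    have hb := continuous_vecBlock hY c
    have h1 : HasSum (fun m => ∫ x, inner ℝ (vecBlock Y c m x) (vecHarmonic Y n κ x) ∂surf)
        (∫ x, inner ℝ (∑' n, vecBlock Y c n x) (vecHarmonic Y n κ x) ∂surf) := by
      refine hasSum_integral_of_dominated_convergence
        (fun m x => (sobTerm σ c m + embTerm σ m) * ‖vecHarmonic Y n κ x‖)
        (fun m => Continuous.aestronglyMeasurable (by fun_prop))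
        (fun m => Filter.Eventually.of_forall fun x => ?_)
        (Filter.Eventually.of_forall fun x => hm.mul_right _) ?_
        (Filter.Eventually.of_forall fun x => ?_)
      · exact (norm_inner_le_norm _ _).trans
          (mul_le_mul_of_nonneg_right (norm_vecBlock_le_add hY σ c m x) (norm_nonneg _))
      · simp only [tsum_mul_right]
        exact integrable_surf (by fun_prop)
      · have h2 := (hS x).mapL (innerSL ℝ (vecHarmonic Y n κ x))
        simp only [innerSL_apply_apply] at h2
        simpa only [real_inner_comm (vecHarmonic Y n κ x)] using h2
    simp only [integral_inner_vecBlock hY] at h1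
    have h2 : HasSum (fun m => if m = n then c n κ else 0) (c n κ) := hasSum_ite_eq n (c n κ)
    simp only [vecCoeff, inner_sub_left]
    rw [integral_sub (integrable_surf (by fun_prop)) (integrable_surf (by fun_prop)), h1.unique h2]
    simp [hc, vecCoeff]

include hY in
theorem tendsto_vecSum {σ : ℝ} (hσ : 1 < σ) {f : S2 → E3} (hf : MemVecSobolev Y σ f) (x : S2) :
    Filter.Tendsto (fun L => vecSum Y (vecCoeff Y f) L x) Filter.atTop (nhds (f x)) :=
  (hasSum_vecBlock hY hσ hf x).tendsto_sum_nat

include hY in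
/-- The Sobolev embedding. -/
theorem MemVecSobolev.norm_sq_le {σ : ℝ} (hσ : 1 < σ) {f : S2 → E3} (hf : MemVecSobolev Y σ f)
    (x : S2) :
    ‖f x‖ ^ 2 ≤ (∑' n, sobTerm σ (vecCoeff Y f) n) * ∑' n, embTerm σ n :=
  le_of_tendsto ((tendsto_vecSum hY hσ hf x).norm.pow 2)
    (Filter.Eventually.of_forall fun L => norm_vecSum_sq_le hY hσ hf.summable_sobTerm L x)

/-- The sum of the squares of the coefficients of degree larger than `n`. -/
def tailSum (c : ∀ n, VIdx n → ℝ) (n : ℕ) : ℝ := ∑' m, if n ≤ m then ∑ κ, c m κ ^ 2 else 0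

theorem sum_sq_le_sobTerm {σ : ℝ} (hσ : 0 ≤ σ) (c : ∀ n, VIdx n → ℝ) (n : ℕ) :
    ∑ κ, c n κ ^ 2 ≤ sobTerm σ c n :=
  le_mul_of_one_le_left (Finset.sum_nonneg fun _ _ => sq_nonneg _) (one_le_sobWeight hσ n)

theorem summable_tail {σ : ℝ} (hσ : 0 ≤ σ) {c : ∀ n, VIdx n → ℝ} (hc : Summable (sobTerm σ c))
    (n : ℕ) : Summable fun m => if n ≤ m then ∑ κ, c m κ ^ 2 else 0 := by
  refine Summable.of_nonneg_of_le (fun m => ?_) (fun m => ?_) hc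
  · split_ifs
    · exact Finset.sum_nonneg fun _ _ => sq_nonneg _
    · exact le_rfl
  · split_ifs
    · exact sum_sq_le_sobTerm hσ c m
    · exact sobTerm_nonneg σ c m

theorem vecSum_tail (c : ∀ n, VIdx n → ℝ) {n M : ℕ} (h : n ≤ M) (x : S2) :
    vecSum Y (fun m κ => if n ≤ m then c m κ else 0) M x = vecSum Y c M x - vecSum Y c n x := by
  rw [eq_sub_iff_add_eq', vecSum, vecSum, vecSum, ← Finset.sum_range_add_sum_Ico _ h,
    ← Finset.sum_range_add_sum_Ico _ h]
  congr 1
  rw [Finset.sum_eq_zero, zero_add]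
  · refine Finset.sum_congr rfl fun m hm => ?_
    simp [vecBlock, (Finset.mem_Ico.1 hm).1]
  · intro m hm
    simp [vecBlock, not_le.2 (Finset.mem_range.1 hm)]

include hY in
-- The Parseval inequality for the tail: finite sums are exact by orthonormality, and Fatou passes
-- to the limit.
theorem integral_norm_sq_sub_vecSum_le {σ : ℝ} (hσ : 1 < σ) {f : S2 → E3}
    (hf : MemVecSobolev Y σ f) (n : ℕ) :
    ∫ x, ‖f x - vecSum Y (vecCoeff Y f) n x‖ ^ 2 ∂surf ≤ tailSum (vecCoeff Y f) n := by
  have hfc := hf.continuous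
  have hs := continuous_vecSum hY (vecCoeff Y f) n
  refine integral_norm_sq_le_of_tendsto (G := fun M =>
    vecSum Y (fun m κ => if n ≤ m then vecCoeff Y f m κ else 0) M) (by fun_prop)
    (fun M => continuous_vecSum hY _ M) (fun M => ?_) (fun x => ?_)
  · rw [integral_norm_sq_vecSum hY]
    refine le_trans (le_of_eq ?_) ((summable_tail (by linarith) hf.summable_sobTerm n).sum_le_tsum
      (Finset.range M) fun m _ => ?_)
    · refine Finset.sum_congr rfl fun m _ => ?_
      split_ifs <;> simp
    · split_ifs
      · exact Finset.sum_nonneg fun _ _ => sq_nonneg _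
      · exact le_rfl
  · refine ((tendsto_vecSum hY hσ hf x).sub_const _).congr' ?_
    filter_upwards [Filter.eventually_ge_atTop n] with M hM
    exact (vecSum_tail _ hM x).symm

include hY in
theorem memVecSobolev_vecSum (σ : ℝ) (c : ∀ n, VIdx n → ℝ) (L : ℕ) :
    MemVecSobolev Y σ (vecSum Y c L) where
  continuous := continuous_vecSum hY c L
  tangential := inner_self_vecSum c L
  summable := by
    refine summable_of_ne_finset_zero (s := Finset.range L) fun n hn => ?_
    rw [vecSobolevTerm_eq, sobTerm]
    simp [vecCoeff_vecSum hY, Finset.mem_range.not.1 hn]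

include hY in
theorem tsum_sobTerm_vecSum (σ : ℝ) (c : ∀ n, VIdx n → ℝ) (L : ℕ) :
    ∑' n, sobTerm σ (vecCoeff Y (vecSum Y c L)) n = ∑ n ∈ Finset.range L, sobTerm σ c n := by
  rw [tsum_eq_sum (s := Finset.range L) fun n hn => ?_]
  · refine Finset.sum_congr rfl fun n hn => ?_
    simp [sobTerm, vecCoeff_vecSum hY, Finset.mem_range.1 hn]
  · simp [sobTerm, vecCoeff_vecSum hY, Finset.mem_range.not.1 hn]

end Series

/-! ### Products of Sobolev fields -/

section Product

variable {Y : ∀ ℓ : ℕ, Fin (2 * ℓ + 1) → MvPolynomial (Fin 3) ℝ} (hY : IsHarmonicBasis Y)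

include hY in
theorem integral_harmonicBasis_mul {ℓ m : ℕ} (k : Fin (2 * ℓ + 1)) (k' : Fin (2 * m + 1))
    (h : ℓ ≠ m) : ∫ x : S2, polyFun (Y ℓ k) x * polyFun (Y m k') x ∂surf = 0 :=
  integral_harmonic_mul_harmonic (harmonicBasis_mem hY ℓ k) (harmonicBasis_mem hY m k') h

include hY in
/-- Bessel's inequality. -/
theorem sum_coeff_sq_le {u : S2 → ℝ} (hu : Continuous u) (M : ℕ) :
    ∑ ℓ ∈ Finset.range M, ∑ k, coeff Y u ℓ k ^ 2 ≤ ∫ x, u x ^ 2 ∂surf := by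
  let P : S2 → ℝ := fun x => ∑ ℓ ∈ Finset.range M, ∑ k, coeff Y u ℓ k * polyFun (Y ℓ k) x
  have hP : Continuous P := by fun_prop
  have hmul : ∀ v : S2 → ℝ, Continuous v → ∫ x, v x * P x ∂surf
      = ∑ ℓ ∈ Finset.range M, ∑ k, coeff Y u ℓ k * coeff Y v ℓ k := by
    intro v hv
    simp only [P, Finset.mul_sum, mul_left_comm (v _)]
    rw [integral_finsetSum _ fun ℓ _ => integrable_surf (by fun_prop)]
    refine Finset.sum_congr rfl fun ℓ _ => ?_
    rw [integral_finsetSum _ fun ℓ _ => integrable_surf (by fun_prop)]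
    simp only [integral_const_mul, coeff]
  have hPc : ∀ ℓ < M, ∀ k, coeff Y P ℓ k = coeff Y u ℓ k := by
    intro ℓ hℓ k
    have h1 : ∀ m ∈ Finset.range M, m ≠ ℓ →
        ∫ x, (∑ k', coeff Y u m k' * polyFun (Y m k') x) * polyFun (Y ℓ k) x ∂surf = 0 := by
      intro m _ hm
      simp only [Finset.sum_mul, mul_assoc]
      rw [integral_finsetSum _ fun k' _ => integrable_surf (by fun_prop)]
      simp [integral_const_mul, integral_harmonicBasis_mul hY _ _ hm]
    rw [coeff]
    simp only [P, Finset.sum_mul (s := Finset.range M)]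
    rw [integral_finsetSum _ fun k' _ => integrable_surf (by fun_prop),
      Finset.sum_eq_single ℓ h1 fun h => absurd (Finset.mem_range.2 hℓ) h,
      integral_sum_mul_harmonicBasis hY]
  have h0 : 0 ≤ ∫ x, (u x - P x) ^ 2 ∂surf := integral_nonneg fun x => sq_nonneg _
  have e : ∀ x, (u x - P x) ^ 2 = u x ^ 2 - 2 * (u x * P x) + P x * P x := fun x => by ring
  simp only [e] at h0
  rw [integral_add (integrable_surf (by fun_prop)) (integrable_surf (by fun_prop)),
    integral_sub (integrable_surf (by fun_prop)) (integrable_surf (by fun_prop)),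
    integral_const_mul, hmul u hu, hmul P hP] at h0
  have h2 : ∑ ℓ ∈ Finset.range M, ∑ k, coeff Y u ℓ k * coeff Y P ℓ k
      = ∑ ℓ ∈ Finset.range M, ∑ k, coeff Y u ℓ k * coeff Y u ℓ k :=
    Finset.sum_congr rfl fun ℓ hℓ => Finset.sum_congr rfl fun k _ => by
      rw [hPc ℓ (Finset.mem_range.1 hℓ)]
  rw [h2] at h0
  simp only [sq (coeff _ _ _ _)]
  linarith

include hY in
-- The blocks have index at most n − 1 and polynomial degree at most n + 1, so the product has
-- degree at most 2n + 2 and is orthogonal to harmonics of larger degree.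
theorem coeff_inner_vecSum_eq_zero (c d : ∀ n, VIdx n → ℝ) {n ℓ : ℕ} (h : 2 * n + 2 < ℓ)
    (k : Fin (2 * ℓ + 1)) :
    coeff Y (fun x => inner ℝ (vecSum Y c n x) (vecSum Y d n x)) ℓ k = 0 := by
  have hV := continuous_vecHarmonic hY
  simp only [coeff, vecSum, vecBlock, sum_inner, inner_sum, real_inner_smul_left,
    real_inner_smul_right, Finset.sum_mul, mul_assoc]
  rw [integral_finsetSum _ fun _ _ => integrable_surf (by fun_prop)]
  refine Finset.sum_eq_zero fun a ha => ?_
  rw [integral_finsetSum _ fun _ _ => integrable_surf (by fun_prop)]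
  refine Finset.sum_eq_zero fun κ _ => ?_
  rw [integral_finsetSum _ fun _ _ => integrable_surf (by fun_prop)]
  refine Finset.sum_eq_zero fun b hb => ?_
  rw [integral_finsetSum _ fun _ _ => integrable_surf (by fun_prop)]
  refine Finset.sum_eq_zero fun κ' _ => ?_
  rw [Finset.mem_range] at ha hb
  rw [integral_const_mul, integral_const_mul,
    integral_polyFun_mul_inner_vecHarmonic hY _ _ (by omega), mul_zero, mul_zero]

variable {σ : ℝ} (hσ : 1 < σ) {f g : S2 → E3} (hf : MemVecSobolev Y σ f)
  (hg : MemVecSobolev Y σ g)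

include hY hσ hf hg in
-- Write the difference as ⟨f − f_n, g⟩ + ⟨f_n, g − g_n⟩. The undifferenced factor is bounded
-- uniformly by the Sobolev embedding, the other one in L₂ by its tail.
theorem integral_inner_sub_inner_vecSum_sq_le (n : ℕ) :
    ∫ x, (inner ℝ (f x) (g x)
      - inner ℝ (vecSum Y (vecCoeff Y f) n x) (vecSum Y (vecCoeff Y g) n x)) ^ 2 ∂surf
      ≤ 2 * (∑' n, embTerm σ n) * ((∑' n, sobTerm σ (vecCoeff Y g) n) * tailSum (vecCoeff Y f) n
        + (∑' n, sobTerm σ (vecCoeff Y f) n) * tailSum (vecCoeff Y g) n) := by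
  have hfc := hf.continuous
  have hgc := hg.continuous
  have hsf := continuous_vecSum hY (vecCoeff Y f) n
  have hsg := continuous_vecSum hY (vecCoeff Y g) n
  have hF := integral_norm_sq_sub_vecSum_le hY hσ hf n
  have hG := integral_norm_sq_sub_vecSum_le hY hσ hg n
  set K := ∑' n, embTerm σ n
  set Sf := ∑' n, sobTerm σ (vecCoeff Y f) n
  set Sg := ∑' n, sobTerm σ (vecCoeff Y g) n
  have hK : 0 ≤ K := tsum_nonneg (embTerm_nonneg σ)
  have hSf : 0 ≤ Sf := tsum_nonneg (sobTerm_nonneg σ _)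
  have hSg : 0 ≤ Sg := tsum_nonneg (sobTerm_nonneg σ _)
  have hpt : ∀ x, (inner ℝ (f x) (g x)
      - inner ℝ (vecSum Y (vecCoeff Y f) n x) (vecSum Y (vecCoeff Y g) n x)) ^ 2
      ≤ 2 * (Sg * K) * ‖f x - vecSum Y (vecCoeff Y f) n x‖ ^ 2
        + 2 * (Sf * K) * ‖g x - vecSum Y (vecCoeff Y g) n x‖ ^ 2 := by
    intro x
    have e : inner ℝ (f x) (g x)
        - inner ℝ (vecSum Y (vecCoeff Y f) n x) (vecSum Y (vecCoeff Y g) n x)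
        = inner ℝ (f x - vecSum Y (vecCoeff Y f) n x) (g x)
          + inner ℝ (vecSum Y (vecCoeff Y f) n x) (g x - vecSum Y (vecCoeff Y g) n x) := by
      rw [inner_sub_left, inner_sub_right]
      ring
    rw [e]
    have h1 : inner ℝ (f x - vecSum Y (vecCoeff Y f) n x) (g x) ^ 2
        ≤ ‖f x - vecSum Y (vecCoeff Y f) n x‖ ^ 2 * ‖g x‖ ^ 2 := by
      rw [← mul_pow, ← sq_abs]
      exact pow_le_pow_left₀ (abs_nonneg _) (abs_real_inner_le_norm _ _) 2
    have h2 : inner ℝ (vecSum Y (vecCoeff Y f) n x) (g x - vecSum Y (vecCoeff Y g) n x) ^ 2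
        ≤ ‖vecSum Y (vecCoeff Y f) n x‖ ^ 2 * ‖g x - vecSum Y (vecCoeff Y g) n x‖ ^ 2 := by
      rw [← mul_pow, ← sq_abs]
      exact pow_le_pow_left₀ (abs_nonneg _) (abs_real_inner_le_norm _ _) 2
    have h3 := mul_le_mul_of_nonneg_left (hg.norm_sq_le hY hσ x)
      (sq_nonneg ‖f x - vecSum Y (vecCoeff Y f) n x‖)
    have h4 := mul_le_mul_of_nonneg_right (norm_vecSum_sq_le hY hσ hf.summable_sobTerm n x)
      (sq_nonneg ‖g x - vecSum Y (vecCoeff Y g) n x‖)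
    refine (add_sq_le).trans ?_
    linarith
  refine (integral_mono (integrable_surf (by fun_prop)) (integrable_surf (by fun_prop)) hpt).trans ?_
  rw [integral_add (integrable_surf (by fun_prop)) (integrable_surf (by fun_prop)),
    integral_const_mul, integral_const_mul]
  have h5 := mul_le_mul_of_nonneg_left hF (mul_nonneg zero_le_two (mul_nonneg hSg hK))
  have h6 := mul_le_mul_of_nonneg_left hG (mul_nonneg zero_le_two (mul_nonneg hSf hK))
  linarith

include hY hσ hf hg in
-- Above degree 2n + 2 the truncated product has no coefficients, so Bessel's inequality for the
-- difference bounds those of ⟨f, g⟩. For n = 0 the truncations are zero, so every degree is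
-- covered, as the disjunction records.
theorem sum_coeff_inner_sq_le (n M : ℕ) :
    (∑ ℓ ∈ Finset.range M, if n = 0 ∨ 2 * n + 2 < ℓ then
      ∑ k, coeff Y (fun x => inner ℝ (f x) (g x)) ℓ k ^ 2 else 0)
      ≤ 2 * (∑' n, embTerm σ n) * ((∑' n, sobTerm σ (vecCoeff Y g) n) * tailSum (vecCoeff Y f) n
        + (∑' n, sobTerm σ (vecCoeff Y f) n) * tailSum (vecCoeff Y g) n) := by
  have hfc := hf.continuous
  have hgc := hg.continuous
  have hsf := continuous_vecSum hY (vecCoeff Y f) n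
  have hsg := continuous_vecSum hY (vecCoeff Y g) n
  refine le_trans ?_ (integral_inner_sub_inner_vecSum_sq_le hY hσ hf hg n)
  refine le_trans ?_ (sum_coeff_sq_le hY (u := fun x => inner ℝ (f x) (g x)
      - inner ℝ (vecSum Y (vecCoeff Y f) n x) (vecSum Y (vecCoeff Y g) n x)) (by fun_prop) M)
  refine Finset.sum_le_sum fun ℓ _ => ?_
  split_ifs with h
  · refine le_of_eq (Finset.sum_congr rfl fun k _ => ?_)
    congr 1
    have h0 : coeff Y (fun x => inner ℝ (vecSum Y (vecCoeff Y f) n x)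
        (vecSum Y (vecCoeff Y g) n x)) ℓ k = 0 := by
      rcases h with h | h
      · subst h
        simp [coeff, vecSum]
      · exact coeff_inner_vecSum_eq_zero hY _ _ h k
    have h1 : coeff Y (fun x => inner ℝ (f x) (g x)
        - inner ℝ (vecSum Y (vecCoeff Y f) n x) (vecSum Y (vecCoeff Y g) n x)) ℓ k
        = coeff Y (fun x => inner ℝ (f x) (g x)) ℓ k - coeff Y (fun x => inner ℝ
          (vecSum Y (vecCoeff Y f) n x) (vecSum Y (vecCoeff Y g) n x)) ℓ k := by
      simp only [coeff, sub_mul]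
      rw [integral_sub (integrable_surf (by fun_prop)) (integrable_surf (by fun_prop))]
    rw [h1, h0, sub_zero]
  · exact Finset.sum_nonneg fun k _ => sq_nonneg _

/-! ### Summation by parts and the product estimate -/

theorem sum_range_rpow_sub {σ : ℝ} (hσ : 0 < σ) (q : ℕ) :
    ∑ n ∈ Finset.range q, (((n : ℝ) + 1) ^ (2 * σ) - (n : ℝ) ^ (2 * σ)) = (q : ℝ) ^ (2 * σ) := by
  have h := Finset.sum_range_sub (fun n : ℕ => (n : ℝ) ^ (2 * σ)) q
  push_cast at h
  rw [h, Real.zero_rpow (by positivity), sub_zero]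

theorem rpow_sub_nonneg {σ : ℝ} (hσ : 0 < σ) (n : ℕ) :
    0 ≤ ((n : ℝ) + 1) ^ (2 * σ) - (n : ℝ) ^ (2 * σ) :=
  sub_nonneg.2 (Real.rpow_le_rpow (by positivity) (by linarith) (by positivity))

/-- After interchanging the sums, the coefficients of index m are weighted by a telescoping sum of
at most (m + 1)^(2σ), which the Sobolev weight dominates. -/
theorem sum_mul_tailSum_le {σ : ℝ} (hσ : 0 < σ) {c : ∀ n, VIdx n → ℝ}
    (hc : Summable (sobTerm σ c)) (M : ℕ) :
    ∑ n ∈ Finset.range M, (((n : ℝ) + 1) ^ (2 * σ) - (n : ℝ) ^ (2 * σ)) * tailSum c n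
      ≤ ∑' n, sobTerm σ c n := by
  have h1 : ∀ n : ℕ, Summable fun m => (((n : ℝ) + 1) ^ (2 * σ) - (n : ℝ) ^ (2 * σ))
      * if n ≤ m then ∑ κ, c m κ ^ 2 else 0 := fun n => (summable_tail hσ.le hc n).mul_left _
  simp only [tailSum, ← tsum_mul_left]
  rw [← Summable.tsum_finsetSum fun n _ => h1 n]
  refine Summable.tsum_le_tsum (fun m => ?_) (summable_sum fun n _ => h1 n) hc
  have h2 : ∀ n ∈ Finset.range M, (((n : ℝ) + 1) ^ (2 * σ) - (n : ℝ) ^ (2 * σ))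
      * (if n ≤ m then ∑ κ, c m κ ^ 2 else 0) = (if n ∈ Finset.range (m + 1) then
        (((n : ℝ) + 1) ^ (2 * σ) - (n : ℝ) ^ (2 * σ)) else 0) * ∑ κ, c m κ ^ 2 := by
    intro n _
    by_cases h : n ≤ m
    · rw [if_pos h, if_pos (by simpa [Nat.lt_succ_iff] using h)]
    · rw [if_neg h, if_neg (by simpa [Nat.lt_succ_iff] using h), mul_zero, zero_mul]
  rw [Finset.sum_congr rfl h2, ← Finset.sum_mul, sobTerm]
  refine mul_le_mul_of_nonneg_right ?_ (Finset.sum_nonneg fun _ _ => sq_nonneg _)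
  rw [← Finset.sum_filter]
  calc _ ≤ ∑ n ∈ Finset.range (m + 1), (((n : ℝ) + 1) ^ (2 * σ) - (n : ℝ) ^ (2 * σ)) :=
        Finset.sum_le_sum_of_subset_of_nonneg (fun n hn => (Finset.mem_filter.1 hn).2)
          fun n _ _ => rpow_sub_nonneg hσ n
    _ = ((m : ℝ) + 1) ^ (2 * σ) := by rw [sum_range_rpow_sub hσ]; push_cast; rfl
    _ ≤ _ := rpow_le_sobWeight hσ.le m

/-- The integer (ℓ − 1)/2 counts the n with 2n + 2 < ℓ, the truncation levels that control degree ℓ.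
The constant 7 is 1 + λ_2, for degrees without such n; for ℓ ≥ 3 one has 1 + ℓ ≤ 5 ⌊(ℓ − 1)/2⌋, with
equality at ℓ = 4. -/
theorem one_add_lam_rpow_le {σ : ℝ} (hσ : 0 < σ) (ℓ : ℕ) :
    (1 + lam ℓ) ^ σ ≤ 7 ^ σ + 25 ^ σ * (((ℓ - 1) / 2 : ℕ) : ℝ) ^ (2 * σ) := by
  have h7 : (0 : ℝ) ≤ 7 ^ σ := by positivity
  have h25 : (0 : ℝ) ≤ 25 ^ σ * (((ℓ - 1) / 2 : ℕ) : ℝ) ^ (2 * σ) := by positivity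
  have hl := one_add_lam_pos ℓ
  rcases Nat.lt_or_ge ℓ 3 with h | h
  · refine le_trans (Real.rpow_le_rpow hl.le ?_ hσ.le) (le_add_of_nonneg_right h25)
    have h1 : (ℓ : ℝ) ≤ 2 := by exact_mod_cast (by omega : ℓ ≤ 2)
    rw [lam]
    nlinarith [(Nat.cast_nonneg ℓ : (0 : ℝ) ≤ ℓ)]
  · refine le_trans ?_ (le_add_of_nonneg_left h7)
    rw [Real.rpow_mul (by positivity), ← Real.mul_rpow (by positivity) (by positivity)]
    refine Real.rpow_le_rpow hl.le ?_ hσ.le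
    have h1 : (1 + ℓ : ℝ) ≤ 5 * (((ℓ - 1) / 2 : ℕ) : ℝ) := by
      exact_mod_cast (by omega : 1 + ℓ ≤ 5 * ((ℓ - 1) / 2))
    rw [lam, Real.rpow_two]
    nlinarith [(Nat.cast_nonneg ℓ : (0 : ℝ) ≤ ℓ)]

/-- The constant in the product estimate. -/
def prodConst (σ : ℝ) : ℝ := 4 * (∑' n, embTerm σ n) * (7 ^ σ + 25 ^ σ)

include hY hσ hf hg in
theorem sum_sobolevTerm_inner_le (M : ℕ) :
    ∑ ℓ ∈ Finset.range M, sobolevTerm Y σ (fun x => inner ℝ (f x) (g x)) ℓ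
      ≤ prodConst σ * (∑' n, sobTerm σ (vecCoeff Y f) n) * ∑' n, sobTerm σ (vecCoeff Y g) n := by
  have hσ0 : 0 < σ := by linarith
  set K := ∑' n, embTerm σ n with hKdef
  set Sf := ∑' n, sobTerm σ (vecCoeff Y f) n with hSfdef
  set Sg := ∑' n, sobTerm σ (vecCoeff Y g) n with hSgdef
  have hK : 0 ≤ K := tsum_nonneg (embTerm_nonneg σ)
  have hSf : 0 ≤ Sf := tsum_nonneg (sobTerm_nonneg σ _)
  have hSg : 0 ≤ Sg := tsum_nonneg (sobTerm_nonneg σ _)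
  set E : ℕ → ℝ := fun ℓ => ∑ k, coeff Y (fun x => inner ℝ (f x) (g x)) ℓ k ^ 2 with hE
  have hE0 : ∀ ℓ, 0 ≤ E ℓ := fun ℓ => Finset.sum_nonneg fun _ _ => sq_nonneg _
  set w : ℕ → ℝ := fun n => ((n : ℝ) + 1) ^ (2 * σ) - (n : ℝ) ^ (2 * σ) with hw
  have hw0 : ∀ n, 0 ≤ w n := rpow_sub_nonneg hσ0
  have hH := fun n => sum_coeff_inner_sq_le hY hσ hf hg n M
  have htail0 : ∀ {h : S2 → E3}, MemVecSobolev Y σ h →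
      tailSum (vecCoeff Y h) 0 ≤ ∑' n, sobTerm σ (vecCoeff Y h) n := by
    intro h hh
    refine Summable.tsum_le_tsum (fun m => ?_) (summable_tail hσ0.le hh.summable_sobTerm 0)
      hh.summable_sobTerm
    rw [if_pos (Nat.zero_le m)]
    exact sum_sq_le_sobTerm hσ0.le _ m
  -- The level n = 0 bounds the whole unweighted energy.
  have hlow : ∑ ℓ ∈ Finset.range M, E ℓ ≤ 4 * K * (Sf * Sg) := by
    have h := hH 0
    simp only [true_or, if_true] at h
    have h1 := mul_le_mul_of_nonneg_left (htail0 hf) hSg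
    have h2 := mul_le_mul_of_nonneg_left (htail0 hg) hSf
    have h3 := mul_le_mul_of_nonneg_left (add_le_add h1 h2) (mul_nonneg zero_le_two hK)
    refine h.trans (h3.trans (le_of_eq ?_))
    ring
  -- The weight is unfolded as a telescoping sum over the levels n with 2n + 2 < ℓ; exchanging the
  -- sums leaves high-degree energies, each bounded by tails.
  have hhigh : ∑ ℓ ∈ Finset.range M, (((ℓ - 1) / 2 : ℕ) : ℝ) ^ (2 * σ) * E ℓ
      ≤ 4 * K * (Sf * Sg) := by
    have e : ∀ ℓ ∈ Finset.range M, (((ℓ - 1) / 2 : ℕ) : ℝ) ^ (2 * σ) * E ℓ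
        = ∑ n ∈ Finset.range M, w n * if 2 * n + 2 < ℓ then E ℓ else 0 := by
      intro ℓ hℓ
      rw [Finset.mem_range] at hℓ
      rw [← sum_range_rpow_sub hσ0, Finset.sum_mul]
      have h1 : ∀ n ∈ Finset.range M, (w n * if 2 * n + 2 < ℓ then E ℓ else 0)
          = if n ∈ Finset.range ((ℓ - 1) / 2) then w n * E ℓ else 0 := by
        intro n _
        have : (2 * n + 2 < ℓ) ↔ n ∈ Finset.range ((ℓ - 1) / 2) := by
          rw [Finset.mem_range]; omega
        simp only [this, mul_ite, mul_zero]
      rw [Finset.sum_congr rfl h1, Finset.sum_ite_mem, Finset.inter_eq_right.2]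
      intro n hn
      rw [Finset.mem_range] at hn ⊢
      omega
    rw [Finset.sum_congr rfl e, Finset.sum_comm]
    simp only [← Finset.mul_sum]
    have h1 : ∀ n ∈ Finset.range M, (w n * ∑ ℓ ∈ Finset.range M, if 2 * n + 2 < ℓ then E ℓ else 0)
        ≤ 2 * K * (Sg * (w n * tailSum (vecCoeff Y f) n)
          + Sf * (w n * tailSum (vecCoeff Y g) n)) := by
      intro n _
      have h2 : (∑ ℓ ∈ Finset.range M, if 2 * n + 2 < ℓ then E ℓ else 0)
          ≤ ∑ ℓ ∈ Finset.range M, if n = 0 ∨ 2 * n + 2 < ℓ then E ℓ else 0 := by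
        refine Finset.sum_le_sum fun ℓ _ => ?_
        by_cases h : 2 * n + 2 < ℓ
        · simp [h]
        · rw [if_neg h]
          split_ifs
          · exact hE0 ℓ
          · exact le_rfl
      refine (mul_le_mul_of_nonneg_left (h2.trans (hH n)) (hw0 n)).trans (le_of_eq ?_)
      ring
    refine (Finset.sum_le_sum h1).trans ?_
    rw [← Finset.mul_sum, Finset.sum_add_distrib, ← Finset.mul_sum, ← Finset.mul_sum]
    have h3 := mul_le_mul_of_nonneg_left (sum_mul_tailSum_le hσ0 hf.summable_sobTerm M) hSg
    have h4 := mul_le_mul_of_nonneg_left (sum_mul_tailSum_le hσ0 hg.summable_sobTerm M) hSf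
    have h5 := mul_le_mul_of_nonneg_left (add_le_add h3 h4) (mul_nonneg zero_le_two hK)
    refine h5.trans (le_of_eq ?_)
    ring
  calc ∑ ℓ ∈ Finset.range M, sobolevTerm Y σ (fun x => inner ℝ (f x) (g x)) ℓ
      ≤ ∑ ℓ ∈ Finset.range M, (7 ^ σ * E ℓ
        + 25 ^ σ * ((((ℓ - 1) / 2 : ℕ) : ℝ) ^ (2 * σ) * E ℓ)) := by
        refine Finset.sum_le_sum fun ℓ _ => ?_
        refine (mul_le_mul_of_nonneg_right (one_add_lam_rpow_le hσ0 ℓ) (hE0 ℓ)).trans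
          (le_of_eq ?_)
        ring
    _ = 7 ^ σ * ∑ ℓ ∈ Finset.range M, E ℓ
        + 25 ^ σ * ∑ ℓ ∈ Finset.range M, (((ℓ - 1) / 2 : ℕ) : ℝ) ^ (2 * σ) * E ℓ := by
        rw [Finset.sum_add_distrib, ← Finset.mul_sum, ← Finset.mul_sum]
    _ ≤ 7 ^ σ * (4 * K * (Sf * Sg)) + 25 ^ σ * (4 * K * (Sf * Sg)) := by gcongr
    _ = prodConst σ * Sf * Sg := by rw [prodConst, ← hKdef]; ring

theorem sobolevTerm_nonneg (σ : ℝ) (u : S2 → ℝ) (ℓ : ℕ) : 0 ≤ sobolevTerm Y σ u ℓ :=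
  mul_nonneg (Real.rpow_nonneg (one_add_lam_pos ℓ).le _) (Finset.sum_nonneg fun _ _ => sq_nonneg _)

include hY hσ hf hg in
/-- The inner product of two Sobolev fields of order larger than one is a Sobolev function. -/
theorem memSobolev_inner : MemSobolev Y σ (fun x => inner ℝ (f x) (g x)) where
  continuous := hf.continuous.inner hg.continuous
  summable := summable_of_sum_range_le (sobolevTerm_nonneg σ _)
    (sum_sobolevTerm_inner_le hY hσ hf hg)

include hY hσ hf hg in
theorem sobolevNorm_inner_le :
    sobolevNorm Y σ (fun x => inner ℝ (f x) (g x))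
      ≤ Real.sqrt (prodConst σ) * vecSobolevNorm Y σ f * vecSobolevNorm Y σ g := by
  have hK : 0 ≤ prodConst σ := by
    have : 0 ≤ ∑' n, embTerm σ n := tsum_nonneg (embTerm_nonneg σ)
    unfold prodConst
    positivity
  rw [vecSobolevNorm_eq, vecSobolevNorm_eq, ← Real.sqrt_mul hK,
    ← Real.sqrt_mul (mul_nonneg hK (tsum_nonneg (sobTerm_nonneg σ _)))]
  exact Real.sqrt_le_sqrt (Real.tsum_le_of_sum_range_le (sobolevTerm_nonneg σ _)
    (sum_sobolevTerm_inner_le hY hσ hf hg))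

end Product

/-! ### Estimates for the Fourier coefficients of a scaled kernel -/

section Decay

variable {s c ρ : ℝ} (hρ : 0 < ρ) (hρ1 : ρ < 1) {a : ℕ → ℝ}
  (ha : ∀ n : ℕ, |a n| ≤ c * (1 + ρ * ((n : ℝ) + 1)) ^ (-2 * s))

include ha in
theorem decay_const_nonneg (hρ : 0 < ρ) : 0 ≤ c := by
  have h := (abs_nonneg _).trans (ha 0)
  exact nonneg_of_mul_nonneg_left h (by positivity)

include ha hρ in
theorem abs_le_rpow_neg_of_decay {p : ℝ} (hp : p ≤ 2 * s) (n : ℕ) :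
    |a n| ≤ c * (1 + ρ * ((n : ℝ) + 1)) ^ (-p) := by
  refine (ha n).trans (mul_le_mul_of_nonneg_left ?_ (decay_const_nonneg ha hρ))
  refine Real.rpow_le_rpow_of_exponent_le ?_ (by linarith)
  have : 0 ≤ ρ * ((n : ℝ) + 1) := by positivity
  linarith

include ha hρ hρ1 in
-- The weight is at most (n + 2)^(2σ), and 1 + ρ(n + 1) ≥ ρ(n + 2) because ρ < 1. Each application
-- of the multiplier thus gains σ derivatives at the price ρ^(-σ).
theorem sobWeight_mul_sq_le_of_decay {σ : ℝ} (hσ : 0 < σ) (hσs : σ ≤ 2 * s) (n : ℕ) :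
    sobWeight σ n * a n ^ 2 ≤ (c * ρ ^ (-σ)) ^ 2 := by
  have hc := decay_const_nonneg ha hρ
  have hn : (0 : ℝ) < (n : ℝ) + 2 := by positivity
  have h1 : sobWeight σ n ≤ (((n : ℝ) + 2) ^ σ) ^ 2 := by
    rw [← Real.rpow_natCast, ← Real.rpow_mul hn.le, mul_comm, Real.rpow_mul hn.le, sobWeight]
    refine Real.rpow_le_rpow (one_add_lam_pos _).le ?_ hσ.le
    rw [lam]
    push_cast
    rw [Real.rpow_two]
    nlinarith [(Nat.cast_nonneg n : (0 : ℝ) ≤ n)]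
  have h2 : |a n| ≤ c * (ρ ^ (-σ) * ((n : ℝ) + 2) ^ (-σ)) := by
    refine (abs_le_rpow_neg_of_decay hρ ha hσs n).trans (mul_le_mul_of_nonneg_left ?_ hc)
    rw [← Real.mul_rpow hρ.le hn.le]
    refine Real.rpow_le_rpow_of_nonpos (by positivity) ?_ (by linarith)
    nlinarith
  have h3 : ((n : ℝ) + 2) ^ σ * |a n| ≤ c * ρ ^ (-σ) := by
    refine (mul_le_mul_of_nonneg_left h2 (by positivity)).trans (le_of_eq ?_)
    have : ((n : ℝ) + 2) ^ σ * ((n : ℝ) + 2) ^ (-σ) = 1 := by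
      rw [← Real.rpow_add hn, add_neg_cancel, Real.rpow_zero]
    linear_combination (c * ρ ^ (-σ)) * this
  calc sobWeight σ n * a n ^ 2 ≤ (((n : ℝ) + 2) ^ σ) ^ 2 * |a n| ^ 2 := by
        rw [sq_abs]
        exact mul_le_mul_of_nonneg_right h1 (sq_nonneg _)
    _ = (((n : ℝ) + 2) ^ σ * |a n|) ^ 2 := by ring
    _ ≤ _ := pow_le_pow_left₀ (by positivity) h3 2

theorem dens_succ_le (n : ℕ) : 2 * dens (n + 1) ≤ (n : ℝ) + 1 := by
  have hpi := Real.pi_gt_three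
  rw [dens, ← mul_div_assoc, div_le_iff₀ (by positivity)]
  push_cast
  nlinarith [(Nat.cast_nonneg n : (0 : ℝ) ≤ n)]

include ha hρ in
-- This is the size of the kernel in L₂, hence of the variance. Using only decay of order 2, with w
-- = 1 + ρ(n + 1) and w' = w − ρ each term is at most c² ρ⁻¹ w⁻³ ≤ c² ρ⁻¹/(w' w), and ρ/(w' w) =
-- 1/w' − 1/w telescopes.
theorem sum_dens_mul_sq_le_of_decay (hs : 1 < s) (L : ℕ) :
    ∑ n ∈ Finset.range L, 2 * dens (n + 1) * a n ^ 2 ≤ (c * ρ⁻¹) ^ 2 := by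
  have hc := decay_const_nonneg ha hρ
  have h1 : ∀ n : ℕ, 2 * dens (n + 1) * a n ^ 2
      ≤ (c * ρ⁻¹) ^ 2 * ((1 + ρ * (n : ℝ))⁻¹ - (1 + ρ * ((n + 1 : ℕ) : ℝ))⁻¹) := by
    intro n
    have h := abs_le_rpow_neg_of_decay hρ ha (p := 2) (by linarith) n
    push_cast
    set w := 1 + ρ * ((n : ℝ) + 1) with hw
    set w' := 1 + ρ * (n : ℝ) with hw'
    have hw1 : 1 ≤ w' := by
      have : 0 ≤ ρ * (n : ℝ) := by positivity
      linarith
    have hww : w = w' + ρ := by rw [hw, hw']; ring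
    have hw0 : 0 < w := by linarith
    rw [Real.rpow_neg hw0.le, Real.rpow_two] at h
    have h2 : a n ^ 2 ≤ (c * (w ^ 2)⁻¹) ^ 2 := by
      rw [← sq_abs]
      exact pow_le_pow_left₀ (abs_nonneg _) h 2
    have h3 : 2 * dens (n + 1) ≤ w * ρ⁻¹ := by
      refine (dens_succ_le n).trans ?_
      rw [hw, add_mul, mul_assoc, mul_comm, ← mul_assoc]
      have : 0 < ρ⁻¹ := by positivity
      have h4 : ρ * ρ⁻¹ = 1 := mul_inv_cancel₀ hρ.ne'
      nlinarith
    calc 2 * dens (n + 1) * a n ^ 2 ≤ w * ρ⁻¹ * (c * (w ^ 2)⁻¹) ^ 2 :=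
          mul_le_mul h3 h2 (sq_nonneg _) (by positivity)
      _ = c ^ 2 * ρ⁻¹ * (w * w * w)⁻¹ := by field_simp
      _ ≤ c ^ 2 * ρ⁻¹ * (1 * w' * w)⁻¹ := by
          gcongr <;> linarith
      _ = (c * ρ⁻¹) ^ 2 * (w'⁻¹ - w⁻¹) := by
          have : w' ≠ 0 := by positivity
          rw [inv_sub_inv this hw0.ne']
          field_simp
          rw [hww]
          ring
  refine (Finset.sum_le_sum fun n _ => h1 n).trans ?_
  rw [← Finset.mul_sum, Finset.sum_range_sub' (fun n : ℕ => (1 + ρ * (n : ℝ))⁻¹)]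
  refine mul_le_of_le_one_right (sq_nonneg _) ?_
  have : 0 ≤ (1 + ρ * (L : ℝ))⁻¹ := by positivity
  simpa using this

include ha hρ in
-- The terms are of size n^(1 − 2s) for fixed ρ, so s > 1 makes the Legendre series of the kernel
-- absolutely convergent. No uniformity in ρ is claimed or needed.
theorem summable_dens_mul_abs_of_decay (hs : 1 < s) :
    Summable fun n => dens (n + 1) * |a n| := by
  have hc := decay_const_nonneg ha hρ
  have h1 : Summable fun n : ℕ => (((n + 1 : ℕ) : ℝ)) ^ (1 - 2 * s) :=
    (summable_nat_add_iff 1).2 (Real.summable_nat_rpow.2 (by linarith))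
  refine Summable.of_nonneg_of_le (fun n => mul_nonneg (dens_pos _).le (abs_nonneg _)) (fun n => ?_)
    (h1.mul_left (c * ρ ^ (-2 * s)))
  have hn : (0 : ℝ) < (n : ℝ) + 1 := by positivity
  have h2 : dens (n + 1) ≤ (n : ℝ) + 1 := by
    have := dens_pos (n + 1)
    have := dens_succ_le n
    linarith
  have h3 : |a n| ≤ c * (ρ ^ (-2 * s) * ((n : ℝ) + 1) ^ (-2 * s)) := by
    refine (ha n).trans (mul_le_mul_of_nonneg_left ?_ hc)
    rw [← Real.mul_rpow hρ.le hn.le]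
    exact Real.rpow_le_rpow_of_nonpos (by positivity) (by linarith) (by linarith)
  refine (mul_le_mul h2 h3 (abs_nonneg _) hn.le).trans (le_of_eq ?_)
  have h4 : (((n + 1 : ℕ) : ℝ)) ^ (1 - 2 * s) = ((n : ℝ) + 1) * ((n : ℝ) + 1) ^ (-2 * s) := by
    push_cast
    rw [sub_eq_add_neg, Real.rpow_add hn, Real.rpow_one, neg_mul]
  rw [h4]
  ring

end Decay

/-- Approximation order and decay bound `1 - ψ̂_ρ` by `ρ ^ σ` times the square root of the
Sobolev weight. -/
theorem HasApproxOrder.exists_sq_one_sub_le {ψ : ℝ → ℝ → ℝ} {σ c s : ℝ} (h : HasApproxOrder ψ σ)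
    (hσ : 0 < σ) (hs : 0 < s) (hψ : ∀ ρ, 0 < ρ → ρ < 1 → ∀ n : ℕ,
      |legendreCoeff (ψ ρ) (n + 1)| ≤ c * (1 + ρ * ((n : ℝ) + 1)) ^ (-2 * s)) :
    ∃ K : ℝ, 0 < K ∧ ∀ ρ, 0 < ρ → ρ < 1 → ∀ n : ℕ,
      (legendreCoeff (ψ ρ) (n + 1) - 1) ^ 2 ≤ (K * ρ ^ σ) ^ 2 * sobWeight σ n := by
  obtain ⟨ρ₀, c₁, c₂, hρ₀, hρ₀1, hc₁, -, h⟩ := h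
  have hc : 0 ≤ c := decay_const_nonneg (fun n => hψ (1 / 2) (by norm_num) (by norm_num) n)
    (by norm_num)
  -- The constant c₁ serves the frequencies covered by the approximation order. The rest satisfy (n
  -- + 1)ρ ≥ ρ₀/2, where the crude bound 1 + c suffices.
  refine ⟨c₁ + (1 + c) * (2 / ρ₀) ^ σ, by positivity, fun ρ hρ hρ1 n => ?_⟩
  have hn : (0 : ℝ) < (n : ℝ) + 1 := by positivity
  set A := legendreCoeff (ψ ρ) (n + 1) with hA
  have hbig : 1 ≤ 2 / ρ₀ * (((n : ℝ) + 1) * ρ) →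
      |1 - A| ≤ (1 + c) * (2 / ρ₀) ^ σ * (((n : ℝ) + 1) * ρ) ^ σ := by
    intro h1
    have h2 : |A| ≤ c := by
      refine (hψ ρ hρ hρ1 n).trans (mul_le_of_le_one_right hc ?_)
      have : 0 ≤ ρ * ((n : ℝ) + 1) := by positivity
      exact Real.rpow_le_one_of_one_le_of_nonpos (by linarith) (by linarith)
    have h3 : |1 - A| ≤ 1 + c := by
      rw [abs_le] at h2 ⊢
      constructor <;> linarith
    rw [mul_assoc, ← Real.mul_rpow (by positivity) (by positivity)]
    exact h3.trans (le_mul_of_one_le_right (by linarith) (Real.one_le_rpow h1 hσ.le))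
  have hp : (0 : ℝ) ≤ (1 + c) * (2 / ρ₀) ^ σ := by positivity
  have hq : (0 : ℝ) ≤ (((n : ℝ) + 1) * ρ) ^ σ := by positivity
  have hmain : |1 - A| ≤ (c₁ + (1 + c) * (2 / ρ₀) ^ σ) * (((n : ℝ) + 1) * ρ) ^ σ := by
    rcases lt_or_ge ρ ρ₀ with hlt | hge
    · rcases le_or_gt (n + 1) ⌊ρ⁻¹ - 1⌋₊ with hle | hgt
      · have h1 := (h ρ hρ hlt).1 (n + 1) hle
        push_cast at h1
        nlinarith [mul_nonneg hp hq]
      · have h1 := Nat.lt_of_floor_lt hgt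
        push_cast at h1
        -- Beyond the floor, ρ⁻¹ ≤ n + 2 ≤ 2(n + 1).
        have h2 : 1 ≤ 2 * (((n : ℝ) + 1) * ρ) := by
          have h3 : ρ⁻¹ ≤ (n : ℝ) + 2 := by linarith
          rw [inv_le_iff_one_le_mul₀ hρ] at h3
          nlinarith [mul_nonneg (Nat.cast_nonneg n : (0 : ℝ) ≤ n) hρ.le]
        have h4 := hbig (h2.trans (mul_le_mul_of_nonneg_right
          ((le_div_iff₀ hρ₀).2 (by linarith)) (by positivity)))
        nlinarith [mul_nonneg hc₁.le hq]
    · have h4 := hbig (by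
        rw [div_mul_eq_mul_div, le_div_iff₀ hρ₀]
        nlinarith [mul_nonneg (Nat.cast_nonneg n : (0 : ℝ) ≤ n) hρ.le])
      nlinarith [mul_nonneg hc₁.le hq]
  calc (A - 1) ^ 2 = |1 - A| ^ 2 := by rw [sq_abs]; ring
    _ ≤ ((c₁ + (1 + c) * (2 / ρ₀) ^ σ) * (((n : ℝ) + 1) * ρ) ^ σ) ^ 2 :=
        pow_le_pow_left₀ (abs_nonneg _) hmain 2
    _ = ((c₁ + (1 + c) * (2 / ρ₀) ^ σ) * ρ ^ σ) ^ 2 * ((n : ℝ) + 1) ^ (2 * σ) := by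
        rw [Real.mul_rpow hn.le hρ.le, mul_comm 2 σ, Real.rpow_mul hn.le, Real.rpow_two]
        ring
    _ ≤ _ := mul_le_mul_of_nonneg_left (rpow_le_sobWeight hσ.le n) (sq_nonneg _)

/-! ### The quasi-interpolant as a series of vector spherical harmonics -/

/-- The field `x ↦ Ψ(x, y) v`. -/
def kernelField (φ : ℝ → ℝ) (y : S2) (v : E3) (x : S2) : E3 :=
  WithLp.toLp 2 (matKernel φ x y *ᵥ v.ofLp)

theorem quasiInterp_eq (φ : ℝ → ℝ) {N : ℕ} (X : Fin N → S2) (v : Fin N → E3) (x : S2) :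
    quasiInterp φ X v x = (4 * Real.pi / N) • ∑ j, kernelField φ (X j) (v j) x := rfl

theorem quasiInterp_add (φ : ℝ → ℝ) {N : ℕ} (X : Fin N → S2) (u v : Fin N → E3) :
    quasiInterp φ X (fun j => u j + v j) = quasiInterp φ X u + quasiInterp φ X v := by
  funext x
  simp [quasiInterp, Matrix.mulVec_add, Finset.sum_add_distrib]

/-- A kernel field is the combination of the kernel fields of the coordinate vectors. -/
theorem kernelField_eq_sum (φ : ℝ → ℝ) (y : S2) (v : E3) (x : S2) :
    kernelField φ y v x = ∑ b, v b • kernelField φ y (EuclideanSpace.single b 1) x := by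
  ext i
  simp [kernelField, Matrix.mulVec, dotProduct, Fin.sum_univ_three, mul_comm]

section Kernel

variable {Y : ∀ ℓ : ℕ, Fin (2 * ℓ + 1) → MvPolynomial (Fin 3) ℝ} (hY : IsHarmonicBasis Y)

/-- The coefficients of the field `x ↦ Ψ(x, y) v`. -/
def kernelCoeff (Y : ∀ ℓ : ℕ, Fin (2 * ℓ + 1) → MvPolynomial (Fin 3) ℝ) (φ : ℝ → ℝ) (y : S2)
    (v : E3) (n : ℕ) (κ : VIdx n) : ℝ :=
  legendreCoeff φ (n + 1) * inner ℝ (vecHarmonic Y n κ y) v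

include hY in
theorem sum_kernelCoeff_sq_le (φ : ℝ → ℝ) (y : S2) (v : E3) (n : ℕ) :
    ∑ κ, kernelCoeff Y φ y v n κ ^ 2
      ≤ 2 * dens (n + 1) * legendreCoeff φ (n + 1) ^ 2 * ‖v‖ ^ 2 := by
  have h : ∑ κ, inner ℝ (vecHarmonic Y n κ y) v ^ 2 ≤ 2 * dens (n + 1) * ‖v‖ ^ 2 := by
    rw [← sum_norm_sq_vecHarmonic hY n y, Finset.sum_mul]
    refine Finset.sum_le_sum fun κ _ => ?_
    rw [← mul_pow, ← sq_abs]
    exact pow_le_pow_left₀ (abs_nonneg _) (abs_real_inner_le_norm _ _) 2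
  simp only [kernelCoeff, mul_pow, ← Finset.mul_sum]
  refine (mul_le_mul_of_nonneg_left h (sq_nonneg _)).trans (le_of_eq ?_)
  ring

variable {φ : ℝ → ℝ} (hφ : ContinuousOn φ (Set.Icc (-1) 1))
  (hsum : Summable fun ℓ => dens ℓ * |legendreCoeff φ ℓ|) (h0 : legendreCoeff φ 0 = 1)

include hY hφ hsum h0 in
theorem hasSum_kernelField (y : S2) (v : E3) (x : S2) :
    HasSum (fun n => vecBlock Y (kernelCoeff Y φ y v) n x) (kernelField φ y v x) := by
  have h : HasSum (fun n => (vecBlock Y (kernelCoeff Y φ y v) n x).ofLp)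
      (matKernel φ x y *ᵥ v.ofLp) := by
    rw [Pi.hasSum]
    intro i
    have h1 := hasSum_sum (s := Finset.univ) fun (j : Fin 3) _ =>
      (hasSum_matKernel hY hφ hsum h0 x y i j).mul_right (v j)
    refine hasSum_of_eq (fun n => ?_) h1
    simp only [vecBlock, kernelCoeff, inner_E3, Finset.mul_sum, Finset.sum_mul,
      WithLp.ofLp_sum, WithLp.ofLp_smul, Finset.sum_apply, Pi.smul_apply, smul_eq_mul]
    rw [Finset.sum_comm]
    refine Finset.sum_congr rfl fun κ _ => Finset.sum_congr rfl fun j _ => ?_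
    ring
  exact h.mapL ((PiLp.continuousLinearEquiv 2 ℝ (fun _ : Fin 3 => ℝ)).symm :
    (Fin 3 → ℝ) →L[ℝ] E3)

include hY hφ hsum h0 in
-- Continuity is not visible in the closed formula, which involves κ' near t = ±1; it comes from
-- uniform convergence of the expansion.
theorem continuous_kernelField (y : S2) (v : E3) : Continuous (kernelField φ y v) := by
  have hb : ∀ n x, ‖vecBlock Y (kernelCoeff Y φ y v) n x‖
      ≤ dens (n + 1) * |legendreCoeff φ (n + 1)| * (2 * ‖v‖) := by
    intro n x
    have hd := (dens_pos (n + 1)).le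
    refine abs_le_of_sq_le_sq' ?_ (by positivity) |>.2
    refine (norm_sum_smul_vecHarmonic_sq_le hY n _ x).trans ((mul_le_mul_of_nonneg_right
      (sum_kernelCoeff_sq_le hY φ y v n) (by positivity)).trans (le_of_eq ?_))
    rw [mul_pow, mul_pow, sq_abs]
    ring
  have hs := ((summable_nat_add_iff 1).2 hsum).mul_right (2 * ‖v‖)
  have h := continuous_tsum (continuous_vecBlock hY (kernelCoeff Y φ y v)) hs hb
  have e : kernelField φ y v = fun x => ∑' n, vecBlock Y (kernelCoeff Y φ y v) n x :=
    funext fun x => (hasSum_kernelField hY hφ hsum h0 y v x).tsum_eq.symm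
  rwa [e]

include hY hφ hsum h0 in
theorem integral_norm_sq_kernelField_le {K : ℝ}
    (hK : ∀ L, ∑ n ∈ Finset.range L, 2 * dens (n + 1) * legendreCoeff φ (n + 1) ^ 2 ≤ K)
    (y : S2) (v : E3) : ∫ x, ‖kernelField φ y v x‖ ^ 2 ∂surf ≤ K * ‖v‖ ^ 2 := by
  refine integral_norm_sq_le_of_tendsto (continuous_kernelField hY hφ hsum h0 y v)
    (continuous_vecSum hY (kernelCoeff Y φ y v)) (fun L => ?_)
    (fun x => (hasSum_kernelField hY hφ hsum h0 y v x).tendsto_sum_nat)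
  rw [integral_norm_sq_vecSum hY]
  refine (Finset.sum_le_sum fun n _ => sum_kernelCoeff_sq_le hY φ y v n).trans ?_
  rw [← Finset.sum_mul]
  exact mul_le_mul_of_nonneg_right (hK L) (sq_nonneg _)

include hY hφ hsum h0 in
theorem continuous_quasiInterp {N : ℕ} (X : Fin N → S2) (v : Fin N → E3) :
    Continuous (quasiInterp φ X v) := by
  have h := fun j => continuous_kernelField hY hφ hsum h0 (X j) (v j)
  simp only [funext (quasiInterp_eq φ X v)]
  fun_prop

include hY hφ hsum h0 in
-- Joint continuity in the data and the point makes the L₂ norm a measurable function of the noise.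
theorem continuous_uncurry_quasiInterp {N : ℕ} (X : Fin N → S2) :
    Continuous fun p : (Fin N → E3) × S2 => quasiInterp φ X p.1 p.2 := by
  have h := fun j b => continuous_kernelField hY hφ hsum h0 (X j) (EuclideanSpace.single b 1)
  have hk : ∀ j, Continuous fun p : (Fin N → E3) × S2 => kernelField φ (X j) (p.1 j) p.2 := by
    intro j
    rw [funext fun p : (Fin N → E3) × S2 => kernelField_eq_sum φ (X j) (p.1 j) p.2]
    refine continuous_finsetSum _ fun b _ => ?_
    have hb : Continuous fun p : (Fin N → E3) × S2 => p.1 j b := by fun_prop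
    exact hb.smul ((h j b).comp continuous_snd)
  simp only [quasiInterp_eq]
  fun_prop

/-- The quadrature approximation of a vector Fourier coefficient. -/
def quadCoeff (Y : ∀ ℓ : ℕ, Fin (2 * ℓ + 1) → MvPolynomial (Fin 3) ℝ) {N : ℕ} (X : Fin N → S2)
    (f : S2 → E3) (n : ℕ) (κ : VIdx n) : ℝ :=
  4 * Real.pi / N * ∑ j, inner ℝ (f (X j)) (vecHarmonic Y n κ (X j))

include hY hφ hsum h0 in
-- The quasi-interpolant discretizes a multiplier: the integrals in the Fourier coefficients are
-- replaced by equal-weight sums over the nodes.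
theorem tendsto_vecSum_quadCoeff {N : ℕ} (X : Fin N → S2) (f : S2 → E3) (x : S2) :
    Filter.Tendsto (fun L => vecSum Y (fun n κ => legendreCoeff φ (n + 1) * quadCoeff Y X f n κ) L x)
      Filter.atTop (nhds (quasiInterp φ X (fun j => f (X j)) x)) := by
  have h := (hasSum_sum (s := Finset.univ) fun (j : Fin N) _ =>
    hasSum_kernelField hY hφ hsum h0 (X j) (f (X j)) x).const_smul (4 * Real.pi / (N : ℝ))
  rw [quasiInterp_eq]
  convert h.tendsto_sum_nat using 2
  refine Finset.sum_congr rfl fun n _ => ?_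
  simp only [vecBlock, Finset.smul_sum, smul_smul]
  rw [Finset.sum_comm]
  refine Finset.sum_congr rfl fun κ _ => ?_
  rw [← Finset.sum_smul]
  congr 1
  simp only [quadCoeff, kernelCoeff, Finset.mul_sum]
  refine Finset.sum_congr rfl fun j _ => ?_
  rw [real_inner_comm]
  ring

theorem sum_mul_quadCoeff {N : ℕ} (X : Fin N → S2) (f : S2 → E3) (c : ∀ n, VIdx n → ℝ) (L : ℕ) :
    ∑ n ∈ Finset.range L, ∑ κ, c n κ * quadCoeff Y X f n κ
      = 4 * Real.pi / N * ∑ j, inner ℝ (f (X j)) (vecSum Y c L (X j)) := by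
  simp only [vecSum, vecBlock, inner_sum, real_inner_smul_right, quadCoeff, Finset.mul_sum]
  rw [eq_comm, Finset.sum_comm]
  refine Finset.sum_congr rfl fun n _ => ?_
  rw [Finset.sum_comm]
  refine Finset.sum_congr rfl fun κ _ => Finset.sum_congr rfl fun j _ => ?_
  ring

theorem le_sq_of_le_mul_sqrt {S b : ℝ} (hS : 0 ≤ S) (h : S ≤ b * Real.sqrt S) : S ≤ b ^ 2 := by
  have h1 := Real.sq_sqrt hS
  rcases (Real.sqrt_nonneg S).eq_or_lt with h2 | h2
  · rw [← h2] at h1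
    nlinarith [sq_nonneg b]
  · have h3 : Real.sqrt S ≤ b := by nlinarith
    nlinarith

include hY in
/-- The quadrature error, filtered by a multiplier `a`, is controlled by the worst case error of
the quadrature in the scalar Sobolev space. -/
theorem sum_sq_quadrature_error_le {σ : ℝ} (hσ : 1 < σ) {N : ℕ} (X : Fin N → S2) {f : S2 → E3}
    (hf : MemVecSobolev Y σ f) {q M : ℝ} (hq : 0 ≤ q) (hM : 0 ≤ M)
    (hX : ∀ u : S2 → ℝ, MemSobolev Y σ u →
      |∫ x, u x ∂surf - 4 * Real.pi / N * ∑ j, u (X j)| ≤ q * sobolevNorm Y σ u)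
    {a : ℕ → ℝ} (ha : ∀ n, sobWeight σ n * a n ^ 2 ≤ M ^ 2) (L : ℕ) :
    ∑ n ∈ Finset.range L, ∑ κ, (a n * (quadCoeff Y X f n κ - vecCoeff Y f n κ)) ^ 2
      ≤ (q * Real.sqrt (prodConst σ) * M * vecSobolevNorm Y σ f) ^ 2 := by
  set e : ∀ n, VIdx n → ℝ := fun n κ => a n * (quadCoeff Y X f n κ - vecCoeff Y f n κ) with he
  -- The dual test field g has coefficients a · e, so that pairing the quadrature error with them
  -- gives the sum of e². The extra factor a is what keeps g in H^σ at cost M.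
  set c : ∀ n, VIdx n → ℝ := fun n κ => a n * e n κ with hc
  set S := ∑ n ∈ Finset.range L, ∑ κ, e n κ ^ 2 with hS
  have hS0 : 0 ≤ S := Finset.sum_nonneg fun _ _ => Finset.sum_nonneg fun _ _ => sq_nonneg _
  have hg := memVecSobolev_vecSum hY σ c L
  have h1 : S = 4 * Real.pi / N * ∑ j, inner ℝ (f (X j)) (vecSum Y c L (X j))
      - ∫ x, inner ℝ (f x) (vecSum Y c L x) ∂surf := by
    rw [← sum_mul_quadCoeff, integral_inner_vecSum hY hf.continuous, ← Finset.sum_sub_distrib]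
    refine Finset.sum_congr rfl fun n _ => ?_
    rw [← Finset.sum_sub_distrib]
    refine Finset.sum_congr rfl fun κ _ => ?_
    simp only [hc, he]
    ring
  have h2 : S ≤ q * (Real.sqrt (prodConst σ) * vecSobolevNorm Y σ f
      * vecSobolevNorm Y σ (vecSum Y c L)) := by
    rw [h1]
    refine (le_abs_self _).trans ?_
    rw [abs_sub_comm]
    exact (hX _ (memSobolev_inner hY hσ hf hg)).trans
      (mul_le_mul_of_nonneg_left (sobolevNorm_inner_le hY hσ hf hg) hq)
  have h3 : vecSobolevNorm Y σ (vecSum Y c L) ≤ M * Real.sqrt S := by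
    rw [vecSobolevNorm_eq, tsum_sobTerm_vecSum hY]
    refine Real.sqrt_le_iff.2 ⟨by positivity, ?_⟩
    rw [mul_pow, Real.sq_sqrt hS0, hS, Finset.mul_sum]
    refine Finset.sum_le_sum fun n _ => ?_
    simp only [sobTerm, hc, mul_pow]
    rw [← Finset.mul_sum, ← mul_assoc]
    exact mul_le_mul_of_nonneg_right (ha n) (Finset.sum_nonneg fun _ _ => sq_nonneg _)
  -- S is at most a constant times √S, and one factor √S cancels.
  refine le_sq_of_le_mul_sqrt hS0 (h2.trans ?_)
  have h4 : 0 ≤ q * (Real.sqrt (prodConst σ) * vecSobolevNorm Y σ f) :=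
    mul_nonneg hq (mul_nonneg (Real.sqrt_nonneg _) (Real.sqrt_nonneg _))
  refine le_trans (le_of_eq ?_) ((mul_le_mul_of_nonneg_left h3 h4).trans (le_of_eq ?_)) <;> ring

include hY hφ hsum h0 in
/-- The error of the quasi-interpolant for exact data. -/
theorem integral_norm_sq_quasiInterp_sub_le {σ : ℝ} (hσ : 1 < σ) {N : ℕ} (X : Fin N → S2)
    {f : S2 → E3} (hf : MemVecSobolev Y σ f) {q M R : ℝ} (hq : 0 ≤ q) (hM : 0 ≤ M)
    (hX : ∀ u : S2 → ℝ, MemSobolev Y σ u →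
      |∫ x, u x ∂surf - 4 * Real.pi / N * ∑ j, u (X j)| ≤ q * sobolevNorm Y σ u)
    (ha : ∀ n, sobWeight σ n * legendreCoeff φ (n + 1) ^ 2 ≤ M ^ 2)
    (hR : ∀ n, (legendreCoeff φ (n + 1) - 1) ^ 2 ≤ R ^ 2 * sobWeight σ n) :
    ∫ x, ‖quasiInterp φ X (fun j => f (X j)) x - f x‖ ^ 2 ∂surf
      ≤ 2 * (q * Real.sqrt (prodConst σ) * M * vecSobolevNorm Y σ f) ^ 2
        + 2 * (R * vecSobolevNorm Y σ f) ^ 2 := by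
  have hfc := hf.continuous
  have hqc := continuous_quasiInterp hY hφ hsum h0 X fun j => f (X j)
  refine integral_norm_sq_le_of_tendsto (hqc.sub hfc)
    (G := fun L x => vecSum Y (fun n κ => legendreCoeff φ (n + 1) * quadCoeff Y X f n κ
      - vecCoeff Y f n κ) L x) (fun L => continuous_vecSum hY _ L) (fun L => ?_) (fun x => ?_)
  · rw [integral_norm_sq_vecSum hY]
    have h1 := sum_sq_quadrature_error_le hY hσ X hf hq hM hX ha L
    have h2 : ∑ n ∈ Finset.range L, ∑ κ, ((legendreCoeff φ (n + 1) - 1) * vecCoeff Y f n κ) ^ 2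
        ≤ (R * vecSobolevNorm Y σ f) ^ 2 := by
      rw [mul_pow R, vecSobolevNorm_eq, Real.sq_sqrt (tsum_nonneg (sobTerm_nonneg σ _))]
      refine le_trans ?_ (mul_le_mul_of_nonneg_left (hf.summable_sobTerm.sum_le_tsum
        (Finset.range L) fun n _ => sobTerm_nonneg σ _ n) (sq_nonneg R))
      rw [Finset.mul_sum]
      refine Finset.sum_le_sum fun n _ => ?_
      simp only [mul_pow, ← Finset.mul_sum, sobTerm]
      rw [← mul_assoc]
      exact mul_le_mul_of_nonneg_right (hR n) (Finset.sum_nonneg fun _ _ => sq_nonneg _)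
    refine le_trans ?_ (add_le_add (mul_le_mul_of_nonneg_left h1 zero_le_two)
      (mul_le_mul_of_nonneg_left h2 zero_le_two))
    simp only [Finset.mul_sum, ← Finset.sum_add_distrib]
    refine Finset.sum_le_sum fun n _ => Finset.sum_le_sum fun κ _ => ?_
    -- The splitting a · quad − exact = a · (quad − exact) + (a − 1) · exact.
    refine le_trans (le_of_eq ?_) (add_sq_le.trans (le_of_eq (mul_add _ _ _)))
    ring
  · have h := (tendsto_vecSum_quadCoeff hY hφ hsum h0 X f x).sub (tendsto_vecSum hY hσ hf x)
    refine h.congr fun L => ?_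
    simp only [vecSum, vecBlock, sub_smul, Finset.sum_sub_distrib]

end Kernel

/-! ### The norm of `L₂` -/

theorem memLp_surf {g : S2 → E3} (hg : Continuous g) : MemLp g 2 surf :=
  hg.memLp_of_hasCompactSupport (HasCompactSupport.of_compactSpace g)

theorem L2norm_eq_sqrt {g : S2 → E3} (hg : Continuous g) :
    L2norm g = Real.sqrt (∫ x, ‖g x‖ ^ 2 ∂surf) := by
  rw [L2norm, (memLp_surf hg).eLpNorm_eq_integral_rpow_norm two_ne_zero ENNReal.ofNat_ne_top,
    ENNReal.toReal_ofReal (by positivity), Real.sqrt_eq_rpow]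
  simp

theorem L2norm_nonneg (g : S2 → E3) : 0 ≤ L2norm g := ENNReal.toReal_nonneg

theorem L2norm_sq {g : S2 → E3} (hg : Continuous g) :
    L2norm g ^ 2 = ∫ x, ‖g x‖ ^ 2 ∂surf := by
  rw [L2norm_eq_sqrt hg, Real.sq_sqrt (integral_nonneg fun x => sq_nonneg _)]

theorem L2norm_add_le {g h : S2 → E3} (hg : Continuous g) (hh : Continuous h) :
    L2norm (g + h) ≤ L2norm g + L2norm h := by
  have h1 := memLp_surf hg
  have h2 := memLp_surf hh
  rw [L2norm, L2norm, L2norm, ← ENNReal.toReal_add h1.eLpNorm_ne_top h2.eLpNorm_ne_top]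
  exact ENNReal.toReal_mono (ENNReal.add_ne_top.2 ⟨h1.eLpNorm_ne_top, h2.eLpNorm_ne_top⟩)
    (eLpNorm_add_le h1.1 h2.1 one_le_two)

/-! ### Second moments of the noise -/

section Moments

variable {Ω : Type*} [MeasurableSpace Ω] {P : Measure Ω} {B : ℝ} {N : ℕ}
  {ε : Fin N → Ω → E3}

theorem IsNoise.memLp_coord (hε : IsNoise P B ε) (j : Fin N) (a : Fin 3) :
    MemLp (fun ω => ε j ω a) 2 P :=
  (hε.memLp j).continuousLinearMap_comp (EuclideanSpace.proj a : E3 →L[ℝ] ℝ)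

theorem IsNoise.integrable_mul (hε : IsNoise P B ε) (j k : Fin N) (a b : Fin 3) :
    Integrable (fun ω => ε j ω a * ε k ω b) P :=
  (hε.memLp_coord j a).integrable_mul (hε.memLp_coord k b)

variable [IsProbabilityMeasure P]

theorem IsNoise.integral_coord (hε : IsNoise P B ε) (j : Fin N) (a : Fin 3) :
    ∫ ω, ε j ω a ∂P = 0 := by
  have h := (EuclideanSpace.proj a : E3 →L[ℝ] ℝ).integral_comp_comm
    ((hε.memLp j).integrable one_le_two)
  rw [hε.mean_zero, map_zero] at h
  exact h

theorem IsNoise.integral_mul_eq_zero (hε : IsNoise P B ε) {j k : Fin N} (hjk : j ≠ k)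
    (a b : Fin 3) : ∫ ω, ε j ω a * ε k ω b ∂P = 0 := by
  have hm : ∀ a : Fin 3, Measurable fun v : E3 => v a := fun a => by fun_prop
  have h := ((hε.indep.indepFun hjk).comp (hm a) (hm b)).integral_mul_eq_mul_integral
    ((hm a).comp (hε.measurable j)).aestronglyMeasurable
    ((hm b).comp (hε.measurable k)).aestronglyMeasurable
  refine h.trans ?_
  have h1 := hε.integral_coord j a
  simp only [Function.comp_def, h1, zero_mul]

/-- For mean zero the trace of the covariance matrix is the second moment of the norm. -/
theorem IsNoise.integral_norm_sq_le (hε : IsNoise P B ε) (j : Fin N) :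
    ∫ ω, ‖ε j ω‖ ^ 2 ∂P ≤ B := by
  refine le_trans (le_of_eq ?_) (hε.trace_le j)
  simp only [EuclideanSpace.real_norm_sq_eq]
  rw [integral_finsetSum _ fun a _ => (hε.memLp_coord j a).integrable_sq]
  simp [Matrix.trace, covMatrix, covariance, hε.integral_coord, sq]

end Moments

/-! ### The quasi-interpolant of noise -/

section Noise

variable {Y : ∀ ℓ : ℕ, Fin (2 * ℓ + 1) → MvPolynomial (Fin 3) ℝ} (hY : IsHarmonicBasis Y)
  {φ : ℝ → ℝ} (hφ : ContinuousOn φ (Set.Icc (-1) 1))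
  (hsum : Summable fun ℓ => dens ℓ * |legendreCoeff φ ℓ|) (h0 : legendreCoeff φ 0 = 1)
  {N : ℕ} (X : Fin N → S2)

/-- The inner product in `L₂` of two kernel fields. -/
def kernelGram (φ : ℝ → ℝ) (y z : S2) (u v : E3) : ℝ :=
  ∫ x, inner ℝ (kernelField φ y u x) (kernelField φ z v x) ∂surf

include hY hφ hsum h0 in
-- The dependence on the data vectors is bilinear with deterministic coefficients, so expectations
-- reduce to second moments of noise coordinates.
theorem kernelGram_eq_sum (y z : S2) (u v : E3) :
    kernelGram φ y z u v = ∑ a, ∑ b, u a * v b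
      * kernelGram φ y z (EuclideanSpace.single a 1) (EuclideanSpace.single b 1) := by
  have h := continuous_kernelField hY hφ hsum h0
  have e : ∀ x, inner ℝ (kernelField φ y u x) (kernelField φ z v x)
      = ∑ a, ∑ b, u a * v b * inner ℝ (kernelField φ y (EuclideanSpace.single a 1) x)
        (kernelField φ z (EuclideanSpace.single b 1) x) := by
    intro x
    rw [kernelField_eq_sum φ y u, kernelField_eq_sum φ z v]
    simp only [sum_inner, inner_sum, real_inner_smul_left, real_inner_smul_right, mul_assoc]
    rw [Finset.sum_comm]
    refine Finset.sum_congr rfl fun a _ => Finset.sum_congr rfl fun b _ => ?_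
    ring
  simp only [kernelGram, e]
  rw [integral_finsetSum _ fun a _ => integrable_surf (by fun_prop)]
  refine Finset.sum_congr rfl fun a _ => ?_
  rw [integral_finsetSum _ fun b _ => integrable_surf (by fun_prop)]
  simp only [integral_const_mul]

include hY hφ hsum h0 in
theorem integral_norm_sq_quasiInterp (v : Fin N → E3) :
    ∫ x, ‖quasiInterp φ X v x‖ ^ 2 ∂surf
      = (4 * Real.pi / N) ^ 2 * ∑ j, ∑ k, kernelGram φ (X j) (X k) (v j) (v k) := by
  have h := continuous_kernelField hY hφ hsum h0
  have e : ∀ x, ‖quasiInterp φ X v x‖ ^ 2 = (4 * Real.pi / N) ^ 2 * ∑ j, ∑ k,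
      inner ℝ (kernelField φ (X j) (v j) x) (kernelField φ (X k) (v k) x) := by
    intro x
    rw [quasiInterp_eq, norm_smul, mul_pow, Real.norm_eq_abs, sq_abs,
      ← real_inner_self_eq_norm_sq]
    simp only [sum_inner, inner_sum]
    rw [Finset.sum_comm]
  simp only [e]
  rw [integral_const_mul, integral_finsetSum _ fun j _ => integrable_surf (by fun_prop)]
  congr 1
  refine Finset.sum_congr rfl fun j _ => ?_
  rw [integral_finsetSum _ fun k _ => integrable_surf (by fun_prop)]
  rfl

variable {Ω : Type*} [MeasurableSpace Ω] {P : Measure Ω} {B : ℝ}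
  {ε : Fin N → Ω → E3} (hε : IsNoise P B ε)

include hY hφ hsum h0 hε in
theorem integrable_kernelGram (j k : Fin N) :
    Integrable (fun ω => kernelGram φ (X j) (X k) (ε j ω) (ε k ω)) P := by
  simp only [kernelGram_eq_sum hY hφ hsum h0 (X j) (X k) (ε j _)]
  exact integrable_finsetSum _ fun a _ => integrable_finsetSum _ fun b _ =>
    (hε.integrable_mul j k a b).mul_const _

include hY hφ hsum h0 in
theorem continuous_L2norm_quasiInterp_add {g : S2 → E3} (hg : Continuous g) :
    Continuous fun v : Fin N → E3 => L2norm (quasiInterp φ X v + g) := by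
  have h1 := continuous_uncurry_quasiInterp hY hφ hsum h0 X
  have h2 : Continuous fun v : Fin N → E3 => ∫ x, ‖quasiInterp φ X v x + g x‖ ^ 2 ∂surf := by
    have h3 : Continuous (Function.uncurry fun (v : Fin N → E3) (x : S2) =>
        ‖quasiInterp φ X v x + g x‖ ^ 2) :=
      ((h1.add (hg.comp continuous_snd)).norm).pow 2
    simpa using continuous_parametric_integral_of_continuous (μ := surf) h3 isCompact_univ
  refine h2.sqrt.congr fun v => ?_
  exact (L2norm_eq_sqrt ((continuous_quasiInterp hY hφ hsum h0 X v).add hg)).symm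

include hY hφ hsum h0 hε in
theorem aestronglyMeasurable_L2norm {g : S2 → E3} (hg : Continuous g) :
    AEStronglyMeasurable (fun ω => L2norm (quasiInterp φ X (fun j => ε j ω) + g)) P :=
  ((continuous_L2norm_quasiInterp_add hY hφ hsum h0 X hg).measurable.comp
    (measurable_pi_lambda _ hε.measurable)).aestronglyMeasurable

include hY hφ hsum h0 hε in
theorem integrable_integral_norm_sq_quasiInterp :
    Integrable (fun ω => ∫ x, ‖quasiInterp φ X (fun j => ε j ω) x‖ ^ 2 ∂surf) P := by
  simp only [integral_norm_sq_quasiInterp hY hφ hsum h0]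
  exact (integrable_finsetSum _ fun j _ => integrable_finsetSum _ fun k _ =>
    integrable_kernelGram hY hφ hsum h0 X hε j k).const_mul _

variable [IsProbabilityMeasure P]

include hY hφ hsum h0 hε in
theorem integral_kernelGram_eq_zero {j k : Fin N} (hjk : j ≠ k) :
    ∫ ω, kernelGram φ (X j) (X k) (ε j ω) (ε k ω) ∂P = 0 := by
  simp only [kernelGram_eq_sum hY hφ hsum h0 (X j) (X k) (ε j _)]
  rw [integral_finsetSum _ fun a _ => integrable_finsetSum _ fun b _ =>
    (hε.integrable_mul j k a b).mul_const _]
  refine Finset.sum_eq_zero fun a _ => ?_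
  rw [integral_finsetSum _ fun b _ => (hε.integrable_mul j k a b).mul_const _]
  refine Finset.sum_eq_zero fun b _ => ?_
  rw [integral_mul_const, hε.integral_mul_eq_zero hjk, zero_mul]

include hY hφ hsum h0 hε in
/-- The mean square norm of the quasi-interpolant of noise. -/
theorem integral_integral_norm_sq_quasiInterp_le {K : ℝ} (hK0 : 0 ≤ K)
    (hK : ∀ L, ∑ n ∈ Finset.range L, 2 * dens (n + 1) * legendreCoeff φ (n + 1) ^ 2 ≤ K) :
    ∫ ω, ∫ x, ‖quasiInterp φ X (fun j => ε j ω) x‖ ^ 2 ∂surf ∂P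
      ≤ (4 * Real.pi / N) ^ 2 * (N * (K * B)) := by
  have hint := integrable_kernelGram hY hφ hsum h0 X hε
  simp only [integral_norm_sq_quasiInterp hY hφ hsum h0]
  rw [integral_const_mul,
    integral_finsetSum _ fun j _ => integrable_finsetSum _ fun k _ => hint j k]
  refine mul_le_mul_of_nonneg_left ?_ (sq_nonneg _)
  have hj : ∀ j, ∫ ω, ∑ k, kernelGram φ (X j) (X k) (ε j ω) (ε k ω) ∂P ≤ K * B := by
    intro j
    rw [integral_finsetSum _ fun k _ => hint j k, Finset.sum_eq_single j
      (fun k _ hk => integral_kernelGram_eq_zero hY hφ hsum h0 X hε hk.symm) (by simp)]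
    refine (integral_mono (hint j j) (((hε.memLp j).integrable_norm_pow two_ne_zero).const_mul K)
      fun ω => ?_).trans ?_
    · simp only [kernelGram, real_inner_self_eq_norm_sq]
      exact integral_norm_sq_kernelField_le hY hφ hsum h0 hK (X j) (ε j ω)
    · rw [integral_const_mul]
      exact mul_le_mul_of_nonneg_left (hε.integral_norm_sq_le j) hK0
  refine (Finset.sum_le_sum fun j _ => hj j).trans (le_of_eq ?_)
  simp

include hY hφ hsum h0 hε in
theorem integrable_L2norm_quasiInterp :
    Integrable (fun ω => L2norm (quasiInterp φ X (fun j => ε j ω))) P := by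
  have hm := aestronglyMeasurable_L2norm hY hφ hsum h0 X hε (g := 0) continuous_const
  simp only [add_zero] at hm
  refine ((integrable_const (1 : ℝ)).add
    (integrable_integral_norm_sq_quasiInterp hY hφ hsum h0 X hε)).mono' hm
    (Filter.Eventually.of_forall fun ω => ?_)
  rw [Pi.add_apply]
  rw [← L2norm_sq (continuous_quasiInterp hY hφ hsum h0 X _), Real.norm_eq_abs,
    abs_of_nonneg (L2norm_nonneg _)]
  nlinarith [sq_nonneg (L2norm (quasiInterp φ X (fun j => ε j ω)) - 1),
    L2norm_nonneg (quasiInterp φ X (fun j => ε j ω))]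

include hY hφ hsum h0 hε in
-- The bound on the mean follows from the one on the mean square through L ≤ (T² + L²)/(2T), which
-- plays the role of Jensen's inequality. This is why T must be positive.
theorem integral_L2norm_quasiInterp_le {K T : ℝ} (hK0 : 0 ≤ K)
    (hK : ∀ L, ∑ n ∈ Finset.range L, 2 * dens (n + 1) * legendreCoeff φ (n + 1) ^ 2 ≤ K)
    (hT : 0 < T) (hKT : (4 * Real.pi / N) ^ 2 * (N * (K * B)) ≤ T ^ 2) :
    ∫ ω, L2norm (quasiInterp φ X (fun j => ε j ω)) ∂P ≤ T := by
  have h1 := (integral_integral_norm_sq_quasiInterp_le hY hφ hsum h0 X hε hK0 hK).trans hKT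
  have hI := integrable_integral_norm_sq_quasiInterp hY hφ hsum h0 X hε
  have h2 : ∀ ω, L2norm (quasiInterp φ X (fun j => ε j ω))
      ≤ (2 * T)⁻¹ * (T ^ 2 + ∫ x, ‖quasiInterp φ X (fun j => ε j ω) x‖ ^ 2 ∂surf) := by
    intro ω
    rw [← L2norm_sq (continuous_quasiInterp hY hφ hsum h0 X _), inv_mul_eq_div,
      le_div_iff₀ (by positivity)]
    nlinarith [sq_nonneg (L2norm (quasiInterp φ X (fun j => ε j ω)) - T)]
  refine (integral_mono (integrable_L2norm_quasiInterp hY hφ hsum h0 X hε)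
    (((integrable_const (T ^ 2)).add hI).const_mul _) h2).trans ?_
  rw [integral_const_mul, integral_add' (integrable_const _) hI, integral_const, inv_mul_eq_div,
    div_le_iff₀ (by positivity)]
  simp only [probReal_univ, one_smul]
  linarith

end Noise

end VecQI

end

/-! ### Assembly: deterministic error plus noise -/

theorem mainTheorem9
    (σ s : ℝ) (hσ : 1 < σ) (hs : 1 < s) (hσs : σ ≤ 2 * s)
    (Y : ∀ ℓ : ℕ, Fin (2 * ℓ + 1) → MvPolynomial (Fin 3) ℝ) (hY : VecQI.IsHarmonicBasis Y)
    (ψ : ℝ → ℝ → ℝ) (hψ : VecQI.IsScaledZonalFamily ψ)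
    (hψm : VecQI.HasApproxOrder ψ σ) (hψs : VecQI.HasFourierDecay ψ s)
    (N : ℕ → ℕ) (X : ∀ n, Fin (N n) → VecQI.S2) (hX : VecQI.IsQMCDesignSeq Y σ N X)
    (B : ℝ) :
    ∃ C : ℝ, 0 < C ∧
      ∀ (ρ : ℝ), 0 < ρ → ρ < 1 → ∀ (n : ℕ) (f : VecQI.S2 → VecQI.E3),
      VecQI.MemVecSobolev Y σ f →
      ∀ (Ω : Type*) [MeasurableSpace Ω] (P : MeasureTheory.Measure Ω)
        [MeasureTheory.IsProbabilityMeasure P] (ε : Fin (N n) → Ω → VecQI.E3),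
      VecQI.IsNoise P B ε →
        (∀ ω, MeasureTheory.MemLp
          (VecQI.noisyQuasiInterp (ψ ρ) (X n) f (fun j => ε j ω) - f) 2 VecQI.surf) ∧
        MeasureTheory.Integrable (fun ω => VecQI.L2norm
          (VecQI.noisyQuasiInterp (ψ ρ) (X n) f (fun j => ε j ω) - f)) P ∧
        ∫ ω, VecQI.L2norm
          (VecQI.noisyQuasiInterp (ψ ρ) (X n) f (fun j => ε j ω) - f) ∂P
          ≤ C * (ρ ^ σ + ρ ^ (-σ) * (N n : ℝ) ^ (-σ / 2)) * VecQI.vecSobolevNorm Y σ f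
            + C * ρ⁻¹ * (N n : ℝ) ^ (-(1 / 2) : ℝ) := by
  obtain ⟨c, hc, hdec⟩ := hψs
  obtain ⟨cq, hcq, hquad⟩ := hX.bound
  have hdec' : ∀ ρ, 0 < ρ → ρ < 1 → ∀ n : ℕ, |VecQI.legendreCoeff (ψ ρ) (n + 1)|
      ≤ c * (1 + ρ * ((n : ℝ) + 1)) ^ (-2 * s) := by
    intro ρ hρ hρ1 n
    simpa using hdec ρ hρ hρ1 (n + 1) n.succ_pos
  obtain ⟨K, hK, happ⟩ := hψm.exists_sq_one_sub_le (by linarith) (by linarith) hdec'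
  set A := Real.sqrt (VecQI.prodConst σ) with hA
  have hA0 : 0 ≤ A := Real.sqrt_nonneg _
  -- The sign of B is not prescribed, hence the absolute value; the summand 1 keeps D positive, as
  -- the noise bound requires, even when B = 0.
  set D := 4 * Real.pi * c * Real.sqrt |B| + 1 with hD
  have hD0 : 0 < D := by positivity
  have hDB : (4 * Real.pi * c) ^ 2 * B ≤ D ^ 2 := by
    have h1 : (4 * Real.pi * c) ^ 2 * B ≤ (4 * Real.pi * c * Real.sqrt |B|) ^ 2 := by
      rw [mul_pow _ (Real.sqrt |B|), Real.sq_sqrt (abs_nonneg B)]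
      exact mul_le_mul_of_nonneg_left (le_abs_self B) (sq_nonneg _)
    exact h1.trans (pow_le_pow_left₀ (by positivity) (by linarith) 2)
  refine ⟨2 * cq * A * c + 2 * K + D, by positivity, ?_⟩
  intro ρ hρ hρ1 n f hf Ω _ P _ ε hε
  have hN : (0 : ℝ) < N n := by exact_mod_cast hX.pos n
  have hφ := hψ.continuousOn ρ hρ hρ1
  have h0 : VecQI.legendreCoeff (ψ ρ) 0 = 1 := by
    rw [VecQI.legendreCoeff_zero, hψ.normalized ρ hρ hρ1]
  -- The decay condition starts at ℓ = 1; the single term of degree 0 does not affect summability.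
  have hsum : Summable fun ℓ => VecQI.dens ℓ * |VecQI.legendreCoeff (ψ ρ) ℓ| :=
    (summable_nat_add_iff 1).1 (VecQI.summable_dens_mul_abs_of_decay hρ (hdec' ρ hρ hρ1) hs)
  have hfc := hf.continuous
  have hqf := VecQI.continuous_quasiInterp hY hφ hsum h0 (X n) fun j => f (X n j)
  have hqε := fun ω => VecQI.continuous_quasiInterp hY hφ hsum h0 (X n) fun j => ε j ω
  set g : VecQI.S2 → VecQI.E3 := fun x => VecQI.quasiInterp (ψ ρ) (X n) (fun j => f (X n j)) x - f x
    with hg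
  have hgc : Continuous g := hqf.sub hfc
  have hsplit : ∀ ω, VecQI.noisyQuasiInterp (ψ ρ) (X n) f (fun j => ε j ω) - f
      = VecQI.quasiInterp (ψ ρ) (X n) (fun j => ε j ω) + g := by
    intro ω
    rw [VecQI.noisyQuasiInterp, VecQI.quasiInterp_add]
    funext x
    simp only [hg, Pi.add_apply, Pi.sub_apply]
    abel
  set F := VecQI.vecSobolevNorm Y σ f with hF
  have hF0 : 0 ≤ F := Real.sqrt_nonneg _
  set p := ρ ^ σ with hp
  set r := ρ ^ (-σ) with hr
  set w := (N n : ℝ) ^ (-σ / 2) with hw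
  have hp0 : 0 < p := Real.rpow_pos_of_pos hρ _
  have hr0 : 0 < r := Real.rpow_pos_of_pos hρ _
  have hw0 : 0 < w := Real.rpow_pos_of_pos hN _
  have hdet : VecQI.L2norm g ≤ (2 * cq * A * c + 2 * K) * (p + r * w) * F := by
    have h1 := VecQI.integral_norm_sq_quasiInterp_sub_le hY hφ hsum h0 hσ (X n) hf
      (q := cq * w) (M := c * r) (R := K * p) (by positivity) (by positivity) (hquad n)
      (VecQI.sobWeight_mul_sq_le_of_decay hρ hρ1 (hdec' ρ hρ hρ1) (by linarith) hσs)
      (happ ρ hρ hρ1)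
    rw [VecQI.L2norm_eq_sqrt hgc]
    refine Real.sqrt_le_iff.2 ⟨by positivity, h1.trans ?_⟩
    have e1 : 0 ≤ cq * w * A * (c * r) * F := by positivity
    have e2 : 0 ≤ K * p * F := by positivity
    have e3 : 2 * (cq * w * A * (c * r) * F) + 2 * (K * p * F)
        ≤ (2 * cq * A * c + 2 * K) * (p + r * w) * F := by
      have e4 : 0 ≤ 2 * cq * A * c * p * F := by positivity
      have e5 : 0 ≤ 2 * K * (r * w) * F := by positivity
      linarith
    -- For nonnegative a and b, 2a² + 2b² ≤ (2a + 2b)²; this is the source of the factors 2 in the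
    -- constant.
    refine le_trans ?_ (pow_le_pow_left₀ (by positivity) e3 2)
    nlinarith [mul_nonneg e1 e2, sq_nonneg (cq * w * A * (c * r) * F), sq_nonneg (K * p * F)]
  set t := (N n : ℝ) ^ (-(1 / 2) : ℝ) with ht
  have ht0 : 0 < t := Real.rpow_pos_of_pos hN _
  have htsq : t ^ 2 = (N n : ℝ)⁻¹ := by
    rw [ht, ← Real.rpow_natCast, ← Real.rpow_mul hN.le, ← Real.rpow_neg_one]
    norm_num
  have hnoise : ∫ ω, VecQI.L2norm (VecQI.quasiInterp (ψ ρ) (X n) fun j => ε j ω) ∂P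
      ≤ D * ρ⁻¹ * t := by
    refine VecQI.integral_L2norm_quasiInterp_le hY hφ hsum h0 (X n) hε (sq_nonneg (c * ρ⁻¹))
      (VecQI.sum_dens_mul_sq_le_of_decay hρ (hdec' ρ hρ hρ1) hs) (by positivity) ?_
    calc (4 * Real.pi / (N n : ℝ)) ^ 2 * (N n * ((c * ρ⁻¹) ^ 2 * B))
        = (4 * Real.pi * c) ^ 2 * B * ((ρ⁻¹) ^ 2 * (N n : ℝ)⁻¹) := by
          field_simp
      _ ≤ D ^ 2 * ((ρ⁻¹) ^ 2 * (N n : ℝ)⁻¹) := mul_le_mul_of_nonneg_right hDB (by positivity)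
      _ = (D * ρ⁻¹ * t) ^ 2 := by rw [← htsq]; ring
  have hI := VecQI.integrable_L2norm_quasiInterp hY hφ hsum h0 (X n) hε
  have hle : ∀ ω, VecQI.L2norm (VecQI.quasiInterp (ψ ρ) (X n) (fun j => ε j ω) + g)
      ≤ VecQI.L2norm (VecQI.quasiInterp (ψ ρ) (X n) fun j => ε j ω) + VecQI.L2norm g :=
    fun ω => VecQI.L2norm_add_le (hqε ω) hgc
  have hI2 := hI.add (MeasureTheory.integrable_const (μ := P) (VecQI.L2norm g))
  simp only [hsplit]
  have hI3 : MeasureTheory.Integrable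
      (fun ω => VecQI.L2norm (VecQI.quasiInterp (ψ ρ) (X n) (fun j => ε j ω) + g)) P := by
    refine hI2.mono' (VecQI.aestronglyMeasurable_L2norm hY hφ hsum h0 (X n) hε hgc)
      (Filter.Eventually.of_forall fun ω => ?_)
    rw [Real.norm_eq_abs, abs_of_nonneg (VecQI.L2norm_nonneg _)]
    exact hle ω
  refine ⟨fun ω => VecQI.memLp_surf ((hqε ω).add hgc), hI3, ?_⟩
  refine (MeasureTheory.integral_mono hI3 hI2 hle).trans ?_
  rw [MeasureTheory.integral_add' hI (MeasureTheory.integrable_const _),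
    MeasureTheory.integral_const, MeasureTheory.probReal_univ, one_smul]
  have e1 : 0 ≤ D * (p + r * w) * F := by positivity
  have e2 : 0 ≤ (2 * cq * A * c + 2 * K) * ρ⁻¹ * t := by positivity
  linarith
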